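/- Let $\hbar,m>0$, let $U\subseteq\mathbb R^d$ be an open coordinate domain, let $g_{ij}$ be a smooth Riemannian metric on $U$ with inverse $g^{ij}$, determinant $g=\det(g_{ij})$ and Christoffel symbols $\Gamma^i_{kl}$, let $V$ be a smooth real function on $U$, and let $x_0\in U$ be such that $U$ is star-shaped about $x_0$. Put $d\mu(x)=dx^1\cdots dx^d$, $dv=\sqrt g\,d\mu$, and $$\hat H=-\frac{\hbar^2}{2m\sqrt g}\,\partial_i\sqrt g\,g^{ij}\partial_j+V .$$ A Green's function at $x_0$ on $U$ is a $C^2$ function $G(x,t)=G(x,t|x_0,0)$ on $U\times(0,\infty)$ with $-\hbar\,\partial_tG=\hat HG$ and $\int \varphi\, G(\cdot,t)\,dv\to\varphi(x_0)$ as $t\to0^+$ for all $\varphi\in C_c^\infty(U)$. Write $\Delta x=x-x_0$, $x_\alpha=x_0+\alpha\,\Delta x$, and $G(x|x_0;\Delta t)=G(x,\Delta t)$. For a weight function $\chi$, two families of densities $\rho_{\Delta t}(x)\,d\mu$ and $\sigma_{\Delta t}(x)\,d\mu$ are called equivalent with weight $\chi$ if, for all $M\ge0$ and all indices $i_1,\dots,i_M$,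 the integrals $\int\chi\,\Delta x^{i_1}\cdots\Delta x^{i_M}\rho_{\Delta t}\,d\mu$ and $\int\chi\,\Delta x^{i_1}\cdots\Delta x^{i_M}\sigma_{\Delta t}\,d\mu$ exist for small $\Delta t>0$ and their difference is $o(\Delta t)$ as $\Delta t\to0^+$. Define $$A^0=\Big[\Delta x^i+\tfrac{\hbar\Delta t}{2m}\,g^{kl}\Gamma^i_{kl}(x_0)\Big]\frac{g_{ij}(x_0)}{2\hbar\Delta t/m}\Big[\Delta x^j+\tfrac{\hbar\Delta t}{2m}\,g^{kl}\Gamma^j_{kl}(x_0)\Big]+\tfrac{\Delta t}{\hbar}V(x_0)$$ (so that the quantum spurious drift is $-\tfrac{\hbar\Delta t}{2m}g^{kl}\Gamma^i_{kl}(x_0)$) and, for $\alpha\in[0,1]$, with all functions in $(\cdots)_\alpha$ evaluated at $x_\alpha$, $$A^\alpha=\Big[\Delta x^i-\tfrac{\hbar\Delta t}{m}\Big(\tfrac1{2\sqrt g}\partial_k(\sqrt g\,g^{ik})-\alpha\,\partial_kg^{ik}\Big)_{\alpha}\Big]\frac{g_{ij}(x_\alpha)}{2\hbar\Delta t/m}\Big[\Delta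 x^j-\tfrac{\hbar\Delta t}{m}\Big(\tfrac1{2\sqrt g}\partial_l(\sqrt g\,g^{jl})-\alpha\,\partial_lg^{jl}\Big)_{\alpha}\Big]$$ $$\qquad+\tfrac{\hbar\alpha}{2m}\Delta t\Big(\partial_i\big(\tfrac1{\sqrt g}\partial_k(\sqrt g\,g^{ki})\big)\Big)_{\alpha}-\tfrac{\hbar\alpha^2}{2m}\Delta t\,(\partial_i\partial_jg^{ij})_\alpha+\tfrac{\Delta t}{\hbar}V(x_\alpha).$$ Then the following hold. 1. On $U$, $g^{kl}\Gamma^i_{kl}=-\tfrac1{\sqrt g}\partial_k(\sqrt g\,g^{ik})$. Hence, for all $\Delta t>0$, $A^0$ is unchanged if each $g^{kl}\Gamma^i_{kl}(x_0)$ is replaced by $-\big(\tfrac1{\sqrt g}\partial_k(\sqrt g\,g^{ki})\big)(x_0)$, and $A^\alpha$ at $\alpha=0$ is $A^0$. 2. For every weight $\chi\in C_c^\infty(U)$, every Green's function $G$ at $x_0$ on $U$, and every $\alpha\in[0,1]$, the three families $$dv(x)\,G(x|x_0;\Delta t),\qquad \frac{\sqrt{g(x_0)}\,d\mu(x)}{(2\pi\hbar\Delta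 t/m)^{d/2}}\,e^{-A^0},\qquad \frac{\sqrt{g(x_\alpha)}\,d\mu(x)}{(2\pi\hbar\Delta t/m)^{d/2}}\,e^{-A^\alpha}$$ are pairwise equivalent with weight $\chi$. The equivalence of the last two does not depend on the existence of $G$. 3. Suppose moreover that $U=\mathbb R^d$, that $g_{ij}$ is uniformly elliptic and bounded together with its first and second partial derivatives, and that $V$ is bounded below. Then the same three families are pairwise equivalent with weight $\chi=1$, i.e. all their moments agree up to $o(\Delta t)$; here $G$ is any nonnegative Green's function at $x_0$ on $\mathbb R^d$ with $G(\cdot,t)\in L^1(dv)$ for all $t>0$ and $\int fG(\cdot,t)\,dv\to f(x_0)$ as $t\to0^+$ for all bounded continuous $f$. Again the equivalence of the last two does not depend on the existence of $G$. -/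

import Mathlib

open Set Filter Topology MeasureTheory
open scoped ContDiff Matrix

noncomputable section

namespace CurvedQM

/-- Points of a coordinate chart, `x = (x^1, …, x^d)`. The reference measure `dμ(x)` is
Lebesgue measure `volume`. -/
abbrev Coord (d : ℕ) : Type := Fin d → ℝ

variable {d : ℕ}

/-- The partial derivative `∂_i f (x)`. -/
def pd (i : Fin d) (f : Coord d → ℝ) (x : Coord d) : ℝ :=
  fderiv ℝ f x (Pi.single i 1)

/-- `g_ij` is a smooth Riemannian metric on `U` (`PosDef` includes symmetry). -/
structure IsMetricOn (g : Coord d → Matrix (Fin d) (Fin d) ℝ) (U : Set (Coord d)) : Prop where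
  smooth : ∀ i j, ContDiffOn ℝ ∞ (fun x => g x i j) U
  posDef : ∀ x ∈ U, (g x).PosDef

/-- `√g(x)`, with `g(x) = det (g_ij(x))`. -/
def sqrtDet (g : Coord d → Matrix (Fin d) (Fin d) ℝ) (x : Coord d) : ℝ :=
  √((g x).det)

/-- The inverse metric `g^{ij}(x)`. -/
def gInv (g : Coord d → Matrix (Fin d) (Fin d) ℝ) (i j : Fin d) (x : Coord d) : ℝ :=
  (g x)⁻¹ i j

/-- `Γ^k_{ij} = ½ g^{kl} (∂_i g_{jl} + ∂_j g_{il} - ∂_l g_{ij})`. -/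
def christoffel (g : Coord d → Matrix (Fin d) (Fin d) ℝ) (k i j : Fin d) (x : Coord d) : ℝ :=
  1 / 2 * ∑ l, gInv g k l x *
    (pd i (fun y => g y j l) x + pd j (fun y => g y i l) x - pd l (fun y => g y i j) x)

/-- The contraction `g^{kl} Γ^i_{kl}`. -/
def contractedChristoffel (g : Coord d → Matrix (Fin d) (Fin d) ℝ) (i : Fin d) (x : Coord d) :
    ℝ :=
  ∑ k, ∑ l, gInv g k l x * christoffel g i k l x

/-- `(1/√g) ∂_k (√g g^{ki})`. -/
def divInv (g : Coord d → Matrix (Fin d) (Fin d) ℝ) (i : Fin d) (x : Coord d) : ℝ :=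
  1 / sqrtDet g x * ∑ k, pd k (fun y => sqrtDet g y * gInv g k i y) x

/-- `Ĥ ψ = -(ħ²/2m) g^{-1/2} ∂_i (√g g^{ij} ∂_j ψ) + V ψ`. -/
def hamiltonian (hbar m : ℝ) (g : Coord d → Matrix (Fin d) (Fin d) ℝ) (V : Coord d → ℝ)
    (ψ : Coord d → ℝ) (x : Coord d) : ℝ :=
  -(hbar ^ 2 / (2 * m * sqrtDet g x)) *
      ∑ i, pd i (fun y => sqrtDet g y * ∑ j, gInv g i j y * pd j ψ y) x
    + V x * ψ x

/-- `G t x = G(x, t | x₀, 0)` solves `-ħ ∂_t G = Ĥ G` on `U` for `t > 0`, and as `t → 0+` it tends,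
as a distribution on `U`, to the covariant delta function `δ(x, x₀)`, i.e.
`∫ φ(x) δ(x, x₀) dv(x) = φ(x₀)` with `dv = √g dμ`. -/
structure IsGreenFunction (hbar m : ℝ) (g : Coord d → Matrix (Fin d) (Fin d) ℝ)
    (V : Coord d → ℝ) (U : Set (Coord d)) (x₀ : Coord d) (G : ℝ → Coord d → ℝ) : Prop where
  contDiffOn : ContDiffOn ℝ 2 (fun p : ℝ × Coord d => G p.1 p.2) (Ioi 0 ×ˢ U)
  equation : ∀ t > 0, ∀ x ∈ U,
    -hbar * deriv (fun s => G s x) t = hamiltonian hbar m g V (G t) x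
  initial : ∀ φ : Coord d → ℝ, ContDiff ℝ ∞ φ → HasCompactSupport φ → tsupport φ ⊆ U →
    Tendsto (fun t => ∫ x, φ x * (sqrtDet g x * G t x)) (𝓝[>] 0) (𝓝 (φ x₀))

/-- The Green's function on all of `ℝ^d`, in the class of nonnegative integrable kernels that
concentrate at `x₀` when tested against bounded continuous functions. This selects the kernel
`e^{-tĤ/ħ} δ(x, x₀)` among the solutions of the Cauchy problem, which without a condition at
infinity are not unique. -/
structure IsGlobalGreenFunction (hbar m : ℝ) (g : Coord d → Matrix (Fin d) (Fin d) ℝ)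
    (V : Coord d → ℝ) (x₀ : Coord d) (G : ℝ → Coord d → ℝ) : Prop where
  isGreen : IsGreenFunction hbar m g V univ x₀ G
  nonneg : ∀ t > 0, ∀ x, 0 ≤ G t x
  integrable : ∀ t > 0, Integrable (fun x => sqrtDet g x * G t x)
  initial_bdd : ∀ f : Coord d → ℝ, Continuous f → (∃ C, ∀ x, |f x| ≤ C) →
    Tendsto (fun t => ∫ x, f x * (sqrtDet g x * G t x)) (𝓝[>] 0) (𝓝 (f x₀))

/-- Density with respect to `dμ(x)` of `dv(x) G(x | x₀; Δt)`. -/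
def greenDensity (g : Coord d → Matrix (Fin d) (Fin d) ℝ) (G : ℝ → Coord d → ℝ)
    (t : ℝ) (x : Coord d) : ℝ :=
  sqrtDet g x * G t x

/-- The Gaussian time-slice action `A⁰(x, x₀; Δt)`, drift written with `(1/√g) ∂_k (√g g^{ki})`. -/
def gaussAction (hbar m : ℝ) (g : Coord d → Matrix (Fin d) (Fin d) ℝ) (V : Coord d → ℝ)
    (x₀ : Coord d) (t : ℝ) (x : Coord d) : ℝ :=
  (∑ i, ∑ j, (x i - x₀ i - hbar * t / (2 * m) * divInv g i x₀)
      * (g x₀ i j / (2 * hbar * t / m))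
      * (x j - x₀ j - hbar * t / (2 * m) * divInv g j x₀))
    + t / hbar * V x₀

/-- The same action, with the quantum spurious drift `-(ħΔt/2m) g^{kl} Γ^i_{kl}`. -/
def gaussActionChristoffel (hbar m : ℝ) (g : Coord d → Matrix (Fin d) (Fin d) ℝ)
    (V : Coord d → ℝ) (x₀ : Coord d) (t : ℝ) (x : Coord d) : ℝ :=
  (∑ i, ∑ j, (x i - x₀ i + hbar * t / (2 * m) * contractedChristoffel g i x₀)
      * (g x₀ i j / (2 * hbar * t / m))
      * (x j - x₀ j + hbar * t / (2 * m) * contractedChristoffel g j x₀))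
    + t / hbar * V x₀

/-- The density with respect to `dμ(x)` of the Gaussian representation. -/
def gaussDensity (hbar m : ℝ) (g : Coord d → Matrix (Fin d) (Fin d) ℝ) (V : Coord d → ℝ)
    (x₀ : Coord d) (t : ℝ) (x : Coord d) : ℝ :=
  sqrtDet g x₀ / (2 * Real.pi * hbar * t / m) ^ ((d : ℝ) / 2)
    * Real.exp (-gaussActionChristoffel hbar m g V x₀ t x)

/-- `x_α = x₀ + α (x - x₀)`. -/
def interp (α : ℝ) (x₀ x : Coord d) : Coord d := x₀ + α • (x - x₀)

/-- The drift combination `(1/2√g) ∂_k (√g g^{ik}) - α ∂_k g^{ik}` at the point `y`. -/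
def alphaDrift (α : ℝ) (g : Coord d → Matrix (Fin d) (Fin d) ℝ) (i : Fin d) (y : Coord d) : ℝ :=
  1 / 2 * divInv g i y - α * ∑ k, pd k (gInv g i k) y

/-- The time-slice action `A^α(x, x₀; Δt)`, all functions being evaluated at `x_α`. -/
def alphaAction (α hbar m : ℝ) (g : Coord d → Matrix (Fin d) (Fin d) ℝ) (V : Coord d → ℝ)
    (x₀ : Coord d) (t : ℝ) (x : Coord d) : ℝ :=
  (∑ i, ∑ j, (x i - x₀ i - hbar * t / m * alphaDrift α g i (interp α x₀ x))
      * (g (interp α x₀ x) i j / (2 * hbar * t / m))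
      * (x j - x₀ j - hbar * t / m * alphaDrift α g j (interp α x₀ x)))
    + hbar * α / (2 * m) * t * ∑ i, pd i (divInv g i) (interp α x₀ x)
    - hbar * α ^ 2 / (2 * m) * t * ∑ i, ∑ j, pd i (pd j (gInv g i j)) (interp α x₀ x)
    + t / hbar * V (interp α x₀ x)

/-- The density with respect to `dμ(x)` of the `α`-representation. -/
def alphaDensity (α hbar m : ℝ) (g : Coord d → Matrix (Fin d) (Fin d) ℝ) (V : Coord d → ℝ)
    (x₀ : Coord d) (t : ℝ) (x : Coord d) : ℝ :=
  sqrtDet g (interp α x₀ x) / (2 * Real.pi * hbar * t / m) ^ ((d : ℝ) / 2)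
    * Real.exp (-alphaAction α hbar m g V x₀ t x)

/-- The weighted monomial `χ(x) Δx^{i_1} ⋯ Δx^{i_M}` times a density `ρ`; `χ = 1` gives the integrand
of the `M`-th moment. -/
def momentIntegrand (χ : Coord d → ℝ) (x₀ : Coord d) (ρ : Coord d → ℝ) {M : ℕ}
    (I : Fin M → Fin d) (x : Coord d) : ℝ :=
  χ x * (∏ k, (x (I k) - x₀ (I k))) * ρ x

/-- Equivalence of two approximate time-slice Green's functions: all moments (weighted by `χ`)
exist for small `Δt` and are equal up to order `Δt`, i.e. up to an error `o(Δt)`. -/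
def MomentsAgree (χ : Coord d → ℝ) (x₀ : Coord d) (ρ σ : ℝ → Coord d → ℝ) : Prop :=
  ∀ (M : ℕ) (I : Fin M → Fin d),
    (∀ᶠ t in 𝓝[>] (0 : ℝ), Integrable (momentIntegrand χ x₀ (ρ t) I) ∧
      Integrable (momentIntegrand χ x₀ (σ t) I)) ∧
    (fun t : ℝ => (∫ x, momentIntegrand χ x₀ (ρ t) I x) - ∫ x, momentIntegrand χ x₀ (σ t) I x)
      =o[𝓝[>] 0] (fun t : ℝ => t)

/-- Uniform ellipticity of `g_ij` on `ℝ^d`, with bounded derivatives up to order two. -/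
def BoundedGeometry (g : Coord d → Matrix (Fin d) (Fin d) ℝ) : Prop :=
  (∃ c > 0, ∀ (x v : Coord d), c * ∑ i, v i ^ 2 ≤ ∑ i, ∑ j, v i * g x i j * v j) ∧
  (∃ C, ∀ x i j k l, |g x i j| ≤ C ∧ |pd k (fun y => g y i j) x| ≤ C ∧
    |pd k (pd l (fun y => g y i j)) x| ≤ C)

end CurvedQM

end

/-!
Write `L = -Ĥ/ħ`. Each of the three families `ρ_t` satisfies the weak short-time expansion
`∫ φ ρ_t dμ = φ(x₀) + t (Lφ)(x₀) + o(t)` for every test function `φ` on the chart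
(`CurvedQM.HasShortTimeExpansion`). Applied to `φ = χ Δx^{i_1} ⋯ Δx^{i_M}` this is the equivalence
with weight `χ`, since the right-hand side does not depend on the family.

For a Green's function the expansion follows from the symmetry of `Ĥ` with respect to `dv`:
`∫ φ G dv` is differentiable in time with derivative `∫ (Lφ) G dv`, and `Lφ` is again a test
function, so both have limits as `t → 0+` by the initial condition
(`CurvedQM.IsGreenFunction.hasShortTimeExpansion`).

For the `α`-density, put `x = x₀ + sz` with `s² = ħt/m`. The action becomes
`½ z·g(x_α)z - s β(x_α)·z + s² γ(x_α)` with `x_α = x₀ + αsz`. After the exponential of the last two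
terms is expanded, every term is a Gaussian moment whose amplitude and precision matrix depend on
the parameter `h = sz`. By the chain rule the Taylor coefficients in `s` of such an integral are
divergences in `h`, at `h = 0`, of Gaussian moments with frozen parameter, and these are known in
closed form (`CurvedQM.GaussReg.integral_smul_expansion`). As `√g(x_α)` normalizes the
Gaussian, the coefficient of `s²` is
`½ ∂_k∂_l (φ(x₀ + h) g^{kl}(x₀ + αh)) + ∂_k (φ(x₀ + h) b^k(x₀ + αh)) - φ(x₀) c(x₀)` at `h = 0`,
where `b` is the drift and `c` collects the remaining terms of the action. The drift
and the two terms with second derivatives in `A^α` make the powers of `α` cancel, leaving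
`(m/ħ) (Lφ)(x₀)` (`CurvedQM.secondOrderCoeff_alpha`). The Gaussian density is the case `α = 0`,
by the contraction identity for the Christoffel symbols.

On all of `ℝ^d` the moments are split by `1 = χ + (1 - χ)` with a cutoff `χ` equal to one near `x₀`.
The part with `χ` is covered by the expansion; for the other part it suffices that the moments
weighted by `|x - x₀|⁴` are `O(t²)` (`CurvedQM.Concentrates`). For the `α`-densities this holds by
Gaussian domination. For a Green's function it follows from Grönwall's inequality for
`∫ φ G dv` with truncated weights `φ`: since the coefficients of `L` other than `V` are bounded and
`V` is bounded below, `∫ P G dv` grows at most exponentially, up to a source given by the moment of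
the derivatives of `P`, which is of lower order at infinity
(`CurvedQM.IsGlobalGreenFunction.moment_le`). Starting from the mass, this bounds all moments; as
`|x - x₀|²` and `|x - x₀|⁴` vanish at `x₀`, two further applications gain a factor `t` each
(`CurvedQM.IsGlobalGreenFunction.concentrates`).
-/

namespace CurvedQM

variable {d : ℕ}

/-! ### Partial derivatives -/

lemma pd_congr {f g : Coord d → ℝ} {x : Coord d} (h : f =ᶠ[𝓝 x] g) (i : Fin d) :
    pd i f x = pd i g x := by
  simp only [pd, h.fderiv_eq]

lemma pd_add {f g : Coord d → ℝ} {x : Coord d} (hf : DifferentiableAt ℝ f x)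
    (hg : DifferentiableAt ℝ g x) (i : Fin d) :
    pd i (fun y => f y + g y) x = pd i f x + pd i g x := by
  simp only [pd, fderiv_fun_add hf hg]; rfl

lemma pd_sub {f g : Coord d → ℝ} {x : Coord d} (hf : DifferentiableAt ℝ f x)
    (hg : DifferentiableAt ℝ g x) (i : Fin d) :
    pd i (fun y => f y - g y) x = pd i f x - pd i g x := by
  simp only [pd, fderiv_fun_sub hf hg]; rfl

lemma pd_mul {f g : Coord d → ℝ} {x : Coord d} (hf : DifferentiableAt ℝ f x)
    (hg : DifferentiableAt ℝ g x) (i : Fin d) :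
    pd i (fun y => f y * g y) x = pd i f x * g x + f x * pd i g x := by
  simp only [pd, fderiv_fun_mul hf hg]
  simp [mul_comm, add_comm]

lemma pd_const (c : ℝ) (x : Coord d) (i : Fin d) : pd i (fun _ => c) x = 0 := by
  simp [pd]

lemma pd_const_mul {f : Coord d → ℝ} {x : Coord d} (hf : DifferentiableAt ℝ f x) (c : ℝ)
    (i : Fin d) : pd i (fun y => c * f y) x = c * pd i f x := by
  rw [pd_mul (differentiableAt_const c) hf, pd_const]; ring

lemma pd_sum {ι : Type*} (s : Finset ι) {f : ι → Coord d → ℝ} {x : Coord d}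
    (hf : ∀ a ∈ s, DifferentiableAt ℝ (f a) x) (i : Fin d) :
    pd i (fun y => ∑ a ∈ s, f a y) x = ∑ a ∈ s, pd i (f a) x := by
  simp only [pd, fderiv_fun_sum hf]
  simp

lemma pd_comp {φ : ℝ → ℝ} {φ' : ℝ} {f : Coord d → ℝ} {x : Coord d} (hφ : HasDerivAt φ φ' (f x))
    (hf : DifferentiableAt ℝ f x) (i : Fin d) :
    pd i (fun y => φ (f y)) x = φ' * pd i f x := by
  have h := hφ.comp_hasFDerivAt x hf.hasFDerivAt
  have h2 : pd i (φ ∘ f) x = φ' * pd i f x := by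
    simp only [pd, h.fderiv]; simp
  exact h2

/-- Partial derivatives of a function composed with a homothety and a translation. -/
lemma pd_comp_affine {f : Coord d → ℝ} (c : Coord d) (α : ℝ) {x : Coord d}
    (hf : DifferentiableAt ℝ f (c + α • x)) (i : Fin d) :
    pd i (fun y => f (c + α • y)) x = α * pd i f (c + α • x) := by
  have h1 : HasFDerivAt (fun y : Coord d => c + α • y)
      (α • ContinuousLinearMap.id ℝ (Coord d)) x :=
    ((hasFDerivAt_id x).const_smul α).const_add c
  have h := hf.hasFDerivAt.comp x h1
  have h2 : pd i (f ∘ fun y : Coord d => c + α • y) x = α * pd i f (c + α • x) := by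
    simp only [pd, h.fderiv]; simp
  exact h2

lemma hasDerivAt_pd {f : Coord d → ℝ} {x : Coord d} (hf : DifferentiableAt ℝ f x) (i : Fin d) :
    HasDerivAt (fun r : ℝ => f (x + r • Pi.single i 1)) (pd i f x) 0 :=
  hf.hasFDerivAt.hasLineDerivAt (Pi.single i 1)

lemma fderiv_apply_eq_sum_pd (f : Coord d → ℝ) (x v : Coord d) :
    fderiv ℝ f x v = ∑ i, v i * pd i f x := by
  conv_lhs => rw [← Finset.univ_sum_single v]
  rw [map_sum]
  refine Finset.sum_congr rfl fun i _ => ?_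
  rw [pd, ← smul_eq_mul, ← map_smul]
  congr 1
  ext j
  by_cases h : j = i
  · subst h; simp
  · simp [h]

lemma ContDiffOn.pd {n k : WithTop ℕ∞} {f : Coord d → ℝ} {U : Set (Coord d)}
    (hf : ContDiffOn ℝ n f U) (hU : IsOpen U) (hk : k + 1 ≤ n) (i : Fin d) :
    ContDiffOn ℝ k (pd i f) U :=
  (hf.fderiv_of_isOpen hU hk).clm_apply contDiffOn_const

lemma ContDiff.pd {n k : WithTop ℕ∞} {f : Coord d → ℝ}
    (hf : ContDiff ℝ n f) (hk : k + 1 ≤ n) (i : Fin d) : ContDiff ℝ k (CurvedQM.pd i f) :=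
  (hf.fderiv_right hk).clm_apply contDiff_const

lemma tsupport_pd_subset (f : Coord d → ℝ) (i : Fin d) : tsupport (pd i f) ⊆ tsupport f :=
  (closure_mono (Function.support_subset_iff'.2 fun x hx => by
    simp [pd, Function.notMem_support.1 hx])).trans (tsupport_fderiv_subset ℝ (f := f))

lemma eventuallyEq_zero_of_notMem_tsupport {f : Coord d → ℝ} {x : Coord d} (hx : x ∉ tsupport f) :
    f =ᶠ[𝓝 x] fun _ => 0 :=
  notMem_tsupport_iff_eventuallyEq.1 hx

/-- If `f` is supported in `U`, then `f * g` is smooth as soon as `g` is smooth on `U`. The values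
of `g` outside `U` play no role. -/
lemma contDiff_mul_of_tsupport_subset {n : WithTop ℕ∞} {f g : Coord d → ℝ} {U : Set (Coord d)}
    (hU : IsOpen U) (hf : ContDiff ℝ n f) (hs : tsupport f ⊆ U) (hg : ContDiffOn ℝ n g U) :
    ContDiff ℝ n (fun x => f x * g x) := by
  rw [contDiff_iff_contDiffAt]
  intro x
  by_cases hx : x ∈ U
  · exact hf.contDiffAt.mul (hg.contDiffAt (hU.mem_nhds hx))
  · have h := eventuallyEq_zero_of_notMem_tsupport fun h => hx (hs h)
    refine (contDiffAt_const (c := (0 : ℝ))).congr_of_eventuallyEq ?_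
    filter_upwards [h] with y hy
    simp [hy]

lemma continuous_mul_of_tsupport_subset {f g : Coord d → ℝ} {U : Set (Coord d)}
    (hU : IsOpen U) (hf : Continuous f) (hs : tsupport f ⊆ U) (hg : ContinuousOn g U) :
    Continuous (fun x => f x * g x) :=
  contDiff_zero.1
    (contDiff_mul_of_tsupport_subset hU (contDiff_zero.2 hf) hs (contDiffOn_zero.2 hg))

/-- Test functions: smooth functions with compact support contained in `U`. -/
structure TestOn (U : Set (Coord d)) (φ : Coord d → ℝ) : Prop where
  smooth : ContDiff ℝ ∞ φ
  compact : HasCompactSupport φ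
  subset : tsupport φ ⊆ U

namespace TestOn

variable {U : Set (Coord d)} {φ ψ : Coord d → ℝ}

lemma eq_zero (h : TestOn U φ) {x : Coord d} (hx : x ∉ U) : φ x = 0 :=
  image_eq_zero_of_notMem_tsupport fun h' => hx (h.subset h')

lemma differentiable (h : TestOn U φ) : Differentiable ℝ φ :=
  h.smooth.differentiable (by simp)

lemma pd (h : TestOn U φ) (i : Fin d) : TestOn U (CurvedQM.pd i φ) where
  smooth := ContDiff.pd h.smooth (by simp) i
  compact := h.compact.of_isClosed_subset (isClosed_tsupport _) (tsupport_pd_subset φ i)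
  subset := (tsupport_pd_subset φ i).trans h.subset

lemma mul_smoothOn {W : Set (Coord d)} (h : TestOn U φ) (hW : IsOpen W) (hUW : U ⊆ W)
    (hψ : ContDiffOn ℝ ∞ ψ W) : TestOn U (fun x => φ x * ψ x) where
  smooth := contDiff_mul_of_tsupport_subset hW h.smooth (h.subset.trans hUW) hψ
  compact := h.compact.mul_right
  subset := (tsupport_mul_subset_left).trans h.subset

lemma add (h : TestOn U φ) (h' : TestOn U ψ) : TestOn U (fun x => φ x + ψ x) where
  smooth := h.smooth.add h'.smooth
  compact := h.compact.add h'.compact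
  subset := (tsupport_add φ ψ).trans (union_subset h.subset h'.subset)

lemma zero : TestOn U (fun _ => 0) where
  smooth := contDiff_const
  compact := HasCompactSupport.zero
  subset := by simp [tsupport]

lemma sum {ι : Type*} (s : Finset ι) {f : ι → Coord d → ℝ} (h : ∀ a ∈ s, TestOn U (f a)) :
    TestOn U (fun x => ∑ a ∈ s, f a x) := by
  classical
  induction s using Finset.induction_on with
  | empty => simpa using zero
  | insert a s ha ih =>
    simp only [Finset.sum_insert ha]
    exact (h a (by simp)).add (ih fun b hb => h b (by simp [hb]))

lemma continuous_mul (h : TestOn U φ) (hU : IsOpen U) (hψ : ContinuousOn ψ U) :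
    Continuous (fun x => φ x * ψ x) :=
  continuous_mul_of_tsupport_subset hU h.smooth.continuous h.subset hψ

lemma integrable_mul (h : TestOn U φ) (hU : IsOpen U) (hψ : ContinuousOn ψ U) :
    Integrable (fun x => φ x * ψ x) :=
  (h.continuous_mul hU hψ).integrable_of_hasCompactSupport h.compact.mul_right

lemma exists_bound (h : TestOn U φ) : ∃ C, 0 ≤ C ∧ ∀ x, |φ x| ≤ C := by
  obtain ⟨C, hC⟩ := h.compact.exists_bound_of_continuous h.smooth.continuous
  exact ⟨C, (norm_nonneg _).trans (hC 0), hC⟩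

end TestOn

/-- Integration by parts against a test function. -/
lemma integral_mul_pd {U : Set (Coord d)} (hU : IsOpen U) {φ F : Coord d → ℝ} (hφ : TestOn U φ)
    (hF : ContDiffOn ℝ 1 F U) (i : Fin d) :
    ∫ x, φ x * pd i F x = -∫ x, pd i φ x * F x :=
  integral_mul_fderiv_eq_neg_fderiv_mul_of_integrable
    ((hφ.pd i).integrable_mul hU hF.continuousOn)
    (hφ.integrable_mul hU (ContDiffOn.pd (k := 0) hF hU (by simp) i).continuousOn)
    (hφ.integrable_mul hU hF.continuousOn)
    (fun x _ => hφ.differentiable x)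
    (fun x hx => (hF.differentiableOn (by simp)).differentiableAt (hU.mem_nhds (hφ.subset hx)))

/-! ### The metric, its inverse and its determinant -/

/-- Jacobi's formula for the derivative of a determinant. -/
lemma pd_det {A : Coord d → Matrix (Fin d) (Fin d) ℝ} {x : Coord d}
    (hA : ∀ i j, DifferentiableAt ℝ (fun y => A y i j) x) (hdet : (A x).det ≠ 0) (k : Fin d) :
    pd k (fun y => (A y).det) x
      = (A x).det * ∑ a, ∑ b, (A x)⁻¹ b a * pd k (fun y => A y a b) x := by
  have h0 : HasDerivAt (fun r : ℝ => (A (x + r • Pi.single k 1)).det)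
      (∑ i, ((A x).updateCol i fun a => pd k (fun y => A y a i) x).det) 0 := by
    simp only [Matrix.det_apply']
    rw [Finset.sum_comm]
    refine HasDerivAt.fun_sum fun σ _ => ?_
    rw [← Finset.mul_sum]
    refine HasDerivAt.const_mul _ ?_
    have := HasDerivAt.fun_finsetProd (u := Finset.univ) (x := (0 : ℝ))
      (f := fun (i : Fin d) (r : ℝ) => A (x + r • Pi.single k 1) (σ i) i)
      (f' := fun i => pd k (fun y => A y (σ i) i) x) (fun i _ => hasDerivAt_pd (hA (σ i) i) k)
    convert this using 1
    refine Finset.sum_congr rfl fun i _ => ?_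
    rw [← Finset.mul_prod_erase Finset.univ _ (Finset.mem_univ i), mul_comm, smul_eq_mul]
    congr 1
    · refine Finset.prod_congr rfl fun j hj => ?_
      rw [Matrix.updateCol_ne (Finset.ne_of_mem_erase hj)]
      simp
    · simp
  have hd : DifferentiableAt ℝ (fun y => (A y).det) x := by
    simp only [Matrix.det_apply']
    fun_prop
  rw [(hasDerivAt_pd hd k).unique h0, Finset.sum_comm, Finset.mul_sum]
  refine Finset.sum_congr rfl fun i _ => ?_
  rw [← Matrix.cramer_apply, Matrix.cramer_eq_adjugate_mulVec, Matrix.mulVec, dotProduct,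
    Finset.mul_sum]
  refine Finset.sum_congr rfl fun a _ => ?_
  rw [Matrix.inv_def, Ring.inverse_eq_inv', Matrix.smul_apply, smul_eq_mul]
  field_simp

lemma contDiffOn_det {n : WithTop ℕ∞} {A : Coord d → Matrix (Fin d) (Fin d) ℝ} {U : Set (Coord d)}
    (hA : ∀ i j, ContDiffOn ℝ n (fun y => A y i j) U) : ContDiffOn ℝ n (fun y => (A y).det) U := by
  simp only [Matrix.det_apply']
  exact ContDiffOn.sum fun σ _ => contDiffOn_const.mul (contDiffOn_prod fun i _ => hA _ _)

namespace IsMetricOn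

variable {g : Coord d → Matrix (Fin d) (Fin d) ℝ} {U : Set (Coord d)} {x : Coord d}

lemma det_pos (hg : IsMetricOn g U) (hx : x ∈ U) : 0 < (g x).det := (hg.posDef x hx).det_pos

lemma sqrtDet_pos (hg : IsMetricOn g U) (hx : x ∈ U) : 0 < sqrtDet g x :=
  Real.sqrt_pos.2 (hg.det_pos hx)

lemma symm (hg : IsMetricOn g U) (hx : x ∈ U) (i j : Fin d) : g x i j = g x j i := by
  have := congrFun (congrFun (hg.posDef x hx).1 j) i
  simpa [Matrix.conjTranspose_apply] using this

lemma gInv_symm (hg : IsMetricOn g U) (hx : x ∈ U) (i j : Fin d) :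
    gInv g i j x = gInv g j i x := by
  have := congrFun (congrFun (hg.posDef x hx).1.inv j) i
  simpa [Matrix.conjTranspose_apply, gInv] using this

lemma contDiffOn_sqrtDet (hg : IsMetricOn g U) : ContDiffOn ℝ ∞ (sqrtDet g) U :=
  (contDiffOn_det hg.smooth).sqrt fun _ hx => (hg.det_pos hx).ne'

lemma contDiffOn_gInv (hg : IsMetricOn g U) (i j : Fin d) : ContDiffOn ℝ ∞ (gInv g i j) U := by
  have h : ∀ x, gInv g i j x = (g x).det⁻¹ * (g x).adjugate i j := fun x => by
    rw [gInv, Matrix.inv_def, Ring.inverse_eq_inv', Matrix.smul_apply, smul_eq_mul]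
  rw [show gInv g i j = _ from funext h]
  refine ((contDiffOn_det hg.smooth).inv fun x hx => (hg.det_pos hx).ne').mul ?_
  simp only [Matrix.adjugate_apply]
  refine contDiffOn_det fun a b => ?_
  by_cases h : a = j
  · subst h; simpa using contDiffOn_const
  · simpa [Matrix.updateRow_ne h] using hg.smooth a b

lemma sum_gInv_mul (hg : IsMetricOn g U) (hx : x ∈ U) (i j : Fin d) :
    ∑ k, gInv g i k x * g x k j = if i = j then 1 else 0 := by
  have := congrFun (congrFun (Matrix.nonsing_inv_mul (g x) (hg.det_pos hx).ne'.isUnit) i) j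
  simpa [Matrix.mul_apply, Matrix.one_apply, gInv] using this

lemma sum_mul_gInv (hg : IsMetricOn g U) (hx : x ∈ U) (i j : Fin d) :
    ∑ k, g x i k * gInv g k j x = if i = j then 1 else 0 := by
  have := congrFun (congrFun (Matrix.mul_nonsing_inv (g x) (hg.det_pos hx).ne'.isUnit) i) j
  simpa [Matrix.mul_apply, Matrix.one_apply, gInv] using this

lemma differentiableAt (hg : IsMetricOn g U) (hU : IsOpen U) (hx : x ∈ U) (i j : Fin d) :
    DifferentiableAt ℝ (fun y => g y i j) x :=
  ((hg.smooth i j).differentiableOn (by simp)).differentiableAt (hU.mem_nhds hx)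

lemma differentiableAt_gInv (hg : IsMetricOn g U) (hU : IsOpen U) (hx : x ∈ U) (i j : Fin d) :
    DifferentiableAt ℝ (gInv g i j) x :=
  ((hg.contDiffOn_gInv i j).differentiableOn (by simp)).differentiableAt (hU.mem_nhds hx)

lemma differentiableAt_sqrtDet (hg : IsMetricOn g U) (hU : IsOpen U) (hx : x ∈ U) :
    DifferentiableAt ℝ (sqrtDet g) x :=
  (hg.contDiffOn_sqrtDet.differentiableOn (by simp)).differentiableAt (hU.mem_nhds hx)

lemma pd_sqrtDet (hg : IsMetricOn g U) (hU : IsOpen U) (hx : x ∈ U) (k : Fin d) :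
    pd k (sqrtDet g) x
      = sqrtDet g x * (1 / 2 * ∑ a, ∑ b, gInv g b a x * pd k (fun y => g y a b) x) := by
  have hd : DifferentiableAt ℝ (fun y => (g y).det) x :=
    ((contDiffOn_det hg.smooth).differentiableOn (by simp)).differentiableAt (hU.mem_nhds hx)
  have h := pd_comp (Real.hasDerivAt_sqrt (hg.det_pos hx).ne') hd k
  have h2 := pd_det (fun i j => hg.differentiableAt hU hx i j) (hg.det_pos hx).ne' k
  have h3 : √((g x).det) * √((g x).det) = (g x).det := Real.mul_self_sqrt (hg.det_pos hx).le
  have h4 : √((g x).det) ≠ 0 := (hg.sqrtDet_pos hx).ne'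
  change pd k (fun y => √((g y).det)) x = _
  rw [h, h2]
  simp only [sqrtDet, gInv]
  rw [← h3]
  simp only [Real.sqrt_mul_self (Real.sqrt_nonneg _)]
  field_simp

/-- `∂_k g^{ij} = - g^{ia} (∂_k g_{ab}) g^{bj}`. -/
lemma pd_gInv (hg : IsMetricOn g U) (hU : IsOpen U) (hx : x ∈ U) (k i j : Fin d) :
    pd k (gInv g i j) x
      = -∑ a, ∑ b, gInv g i a x * pd k (fun y => g y a b) x * gInv g b j x := by
  have key : ∀ b, ∑ a, gInv g i a x * pd k (fun y => g y a b) x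
      = -∑ a, pd k (gInv g i a) x * g x a b := by
    intro b
    have h1 : pd k (fun y => ∑ a, gInv g i a y * g y a b) x = 0 := by
      rw [← pd_const (if i = b then 1 else 0) x k]
      refine pd_congr ?_ k
      filter_upwards [hU.mem_nhds hx] with y hy
      exact hg.sum_gInv_mul hy i b
    rw [pd_sum _ (f := fun a y => gInv g i a y * g y a b) fun a _ =>
      (hg.differentiableAt_gInv hU hx i a).mul (hg.differentiableAt hU hx a b)] at h1
    simp only [pd_mul (hg.differentiableAt_gInv hU hx i _) (hg.differentiableAt hU hx _ b),
      Finset.sum_add_distrib] at h1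
    linarith
  rw [Finset.sum_comm]
  simp only [← Finset.sum_mul, key, neg_mul, Finset.sum_neg_distrib, neg_neg]
  simp only [Finset.sum_mul, mul_assoc]
  rw [Finset.sum_comm]
  simp only [← Finset.mul_sum, hg.sum_mul_gInv hx]
  simp

lemma contDiffOn_divInv (hg : IsMetricOn g U) (hU : IsOpen U) (i : Fin d) :
    ContDiffOn ℝ ∞ (divInv g i) U := by
  unfold divInv
  refine (contDiffOn_const.div hg.contDiffOn_sqrtDet fun x hx => (hg.sqrtDet_pos hx).ne').mul ?_
  exact ContDiffOn.sum fun k _ =>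
    ContDiffOn.pd (hg.contDiffOn_sqrtDet.mul (hg.contDiffOn_gInv k i)) hU (by simp) k

/-- `(1/√g) ∂_k (√g g^{ki}) = ∂_k g^{ki} + ½ g^{ki} g^{ab} ∂_k g_{ab}`. -/
lemma divInv_eq (hg : IsMetricOn g U) (hU : IsOpen U) (hx : x ∈ U) (i : Fin d) :
    divInv g i x = ∑ k, (pd k (gInv g k i) x
      + gInv g k i x * (1 / 2 * ∑ a, ∑ b, gInv g b a x * pd k (fun y => g y a b) x)) := by
  rw [divInv, Finset.mul_sum]
  refine Finset.sum_congr rfl fun k _ => ?_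
  rw [pd_mul (hg.differentiableAt_sqrtDet hU hx) (hg.differentiableAt_gInv hU hx k i),
    hg.pd_sqrtDet hU hx k]
  have := (hg.sqrtDet_pos hx).ne'
  field_simp
  ring

/-- `g^{kl} Γ^i_{kl} = -(1/√g) ∂_k (√g g^{ki})`. -/
theorem contractedChristoffel_eq (hg : IsMetricOn g U) (hU : IsOpen U) (hx : x ∈ U) (i : Fin d) :
    contractedChristoffel g i x = -divInv g i x := by
  have hpd : ∀ k a b, pd k (fun y => g y a b) x = pd k (fun y => g y b a) x := fun k a b =>
    pd_congr (by filter_upwards [hU.mem_nhds hx] with y hy using hg.symm hy a b) k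
  -- `S` and `T` are the two contractions of `∂_a g_{bc}` with two inverse metrics
  set S := ∑ k, ∑ l, ∑ m, gInv g k l x * gInv g i m x * pd k (fun y => g y l m) x with hS
  set T := ∑ k, ∑ l, ∑ m, gInv g k l x * gInv g i m x * pd m (fun y => g y k l) x with hT
  have h1 : contractedChristoffel g i x = S - 1 / 2 * T := by
    have hS' : S = ∑ k, ∑ l, ∑ m, gInv g k l x * gInv g i m x * pd l (fun y => g y k m) x := by
      rw [hS, Finset.sum_comm]
      refine Finset.sum_congr rfl fun l _ => Finset.sum_congr rfl fun k _ =>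
        Finset.sum_congr rfl fun m _ => ?_
      rw [hg.gInv_symm hx k l]
    have : contractedChristoffel g i x = 1 / 2 * S + 1 / 2 * S - 1 / 2 * T := by
      nth_rewrite 2 [hS']
      rw [hS, hT]
      simp only [contractedChristoffel, christoffel, Finset.mul_sum, ← Finset.sum_add_distrib,
        ← Finset.sum_sub_distrib]
      refine Finset.sum_congr rfl fun k _ => Finset.sum_congr rfl fun l _ =>
        Finset.sum_congr rfl fun m _ => ?_
      ring
    rw [this]; ring
  have h2 : divInv g i x = -S + 1 / 2 * T := by
    rw [hg.divInv_eq hU hx, Finset.sum_add_distrib]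
    congr 1
    · rw [hS, ← Finset.sum_neg_distrib]
      refine Finset.sum_congr rfl fun k _ => ?_
      rw [hg.pd_gInv hU hx]
      congr 1
      refine Finset.sum_congr rfl fun a _ => Finset.sum_congr rfl fun b _ => ?_
      rw [hg.gInv_symm hx b i]; ring
    · rw [hT, Finset.mul_sum]
      simp only [Finset.mul_sum]
      rw [Finset.sum_comm]
      conv_rhs => rw [Finset.sum_congr rfl fun k _ => Finset.sum_comm]
      conv_rhs => rw [Finset.sum_comm]
      rw [Finset.sum_comm]
      refine Finset.sum_congr rfl fun m _ => Finset.sum_congr rfl fun k _ =>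
        Finset.sum_congr rfl fun l _ => ?_
      rw [hg.gInv_symm hx l k, hg.gInv_symm hx m i]; ring
  rw [h1, h2]; ring

end IsMetricOn

/-! ### The generator and its symmetry -/

/-- The generator `L = -Ĥ/ħ` of the diffusion: a Green's function solves `∂_t G = L G`. -/
noncomputable def generator (hbar m : ℝ) (g : Coord d → Matrix (Fin d) (Fin d) ℝ) (V : Coord d → ℝ)
    (φ : Coord d → ℝ) (x : Coord d) : ℝ :=
  -(1 / hbar) * hamiltonian hbar m g V φ x

/-- The densitized gradient `√g g^{ij} ∂_j ψ`. -/
noncomputable def flux (g : Coord d → Matrix (Fin d) (Fin d) ℝ) (ψ : Coord d → ℝ) (i : Fin d)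
    (y : Coord d) : ℝ :=
  sqrtDet g y * ∑ j, gInv g i j y * pd j ψ y

section Generator

variable {hbar m : ℝ} {g : Coord d → Matrix (Fin d) (Fin d) ℝ} {U : Set (Coord d)}
  {V : Coord d → ℝ} {φ ψ : Coord d → ℝ} {x₀ : Coord d}

lemma TestOn.flux (hU : IsOpen U) (hg : IsMetricOn g U) (hφ : TestOn U φ) (i : Fin d) :
    TestOn U (flux g φ i) := by
  have h : CurvedQM.flux g φ i
      = fun y => (∑ j, CurvedQM.pd j φ y * gInv g i j y) * sqrtDet g y := by
    funext y
    simp only [CurvedQM.flux, mul_comm (CurvedQM.pd _ φ y)]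
    ring
  rw [h]
  exact (TestOn.sum _ fun j _ =>
    (hφ.pd j).mul_smoothOn hU subset_rfl (hg.contDiffOn_gInv i j)).mul_smoothOn hU subset_rfl
      hg.contDiffOn_sqrtDet

lemma ContDiffOn.flux (hU : IsOpen U) (hg : IsMetricOn g U) (hψ : ContDiffOn ℝ 2 ψ U) (i : Fin d) :
    ContDiffOn ℝ 1 (flux g ψ i) U :=
  (hg.contDiffOn_sqrtDet.of_le (by simp)).mul
    (ContDiffOn.sum fun j _ => ((hg.contDiffOn_gInv i j).of_le (by simp)).mul
      (ContDiffOn.pd hψ hU (by norm_num) j))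

lemma TestOn.generator (hU : IsOpen U) (hg : IsMetricOn g U) (hV : ContDiffOn ℝ ∞ V U)
    (hφ : TestOn U φ) : TestOn U (generator hbar m g V φ) := by
  have h : CurvedQM.generator hbar m g V φ = fun x => (∑ i, CurvedQM.pd i (CurvedQM.flux g φ i) x)
      * (hbar / (2 * m) * (sqrtDet g x)⁻¹) + φ x * (-(1 / hbar) * V x) := by
    funext x
    simp only [CurvedQM.generator, hamiltonian]
    change -(1 / hbar) * (-(hbar ^ 2 / (2 * m * sqrtDet g x)) *
      ∑ i, CurvedQM.pd i (CurvedQM.flux g φ i) x + V x * φ x) = _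
    by_cases hb : hbar = 0
    · simp [hb]
    · field_simp
      ring
  rw [h]
  refine TestOn.add ?_ ?_
  · exact (TestOn.sum _ fun i _ => (hφ.flux hU hg i).pd i).mul_smoothOn hU subset_rfl
      (contDiffOn_const.mul (hg.contDiffOn_sqrtDet.inv fun x hx => (hg.sqrtDet_pos hx).ne'))
  · exact hφ.mul_smoothOn hU subset_rfl (contDiffOn_const.mul hV)

/-- Green's second identity for the Laplace–Beltrami operator, one function being a test
function. -/
lemma integral_mul_div_flux (hU : IsOpen U) (hg : IsMetricOn g U) (hφ : TestOn U φ)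
    (hψ : ContDiffOn ℝ 2 ψ U) :
    ∑ i, ∫ x, φ x * pd i (flux g ψ i) x = ∑ i, ∫ x, pd i (flux g φ i) x * ψ x := by
  have hψ1 : ∀ j, ContDiffOn ℝ 1 (pd j ψ) U := fun j => ContDiffOn.pd hψ hU (by norm_num) j
  have hsg : ∀ i j, ContDiffOn ℝ ∞ (fun x => sqrtDet g x * gInv g i j x) U := fun i j =>
    hg.contDiffOn_sqrtDet.mul (hg.contDiffOn_gInv i j)
  have htest : ∀ i j, TestOn U (fun x => pd i φ x * (sqrtDet g x * gInv g i j x)) := fun i j =>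
    (hφ.pd i).mul_smoothOn hU subset_rfl (hsg i j)
  have h1 : ∀ i, ∫ x, φ x * pd i (flux g ψ i) x
      = ∑ j, ∫ x, pd j (fun y => pd i φ y * (sqrtDet g y * gInv g i j y)) x * ψ x := by
    intro i
    rw [integral_mul_pd hU hφ (ContDiffOn.flux hU hg hψ i)]
    have : ∀ x, pd i φ x * flux g ψ i x
        = ∑ j, pd i φ x * (sqrtDet g x * gInv g i j x) * pd j ψ x := fun x => by
      simp only [flux, Finset.mul_sum, mul_assoc]
    simp only [this]
    rw [integral_finsetSum _ fun j _ => (htest i j).integrable_mul hU (hψ1 j).continuousOn,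
      ← Finset.sum_neg_distrib]
    refine Finset.sum_congr rfl fun j _ => ?_
    rw [integral_mul_pd hU (htest i j) (hψ.of_le (by norm_num)), neg_neg]
  have h2 : ∀ j, ∫ x, pd j (flux g φ j) x * ψ x
      = ∑ i, ∫ x, pd j (fun y => pd i φ y * (sqrtDet g y * gInv g i j y)) x * ψ x := by
    intro j
    rw [← integral_finsetSum _ fun i _ => ((htest i j).pd j).integrable_mul hU hψ.continuousOn]
    refine integral_congr_ae (Eventually.of_forall fun x => ?_)
    simp only [← Finset.sum_mul]
    by_cases hx : x ∈ U
    · congr 1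
      rw [← pd_sum _ fun i _ => (htest i j).differentiable x]
      refine pd_congr ?_ j
      filter_upwards [hU.mem_nhds hx] with y hy
      simp only [flux, Finset.mul_sum]
      refine Finset.sum_congr rfl fun i _ => ?_
      rw [hg.gInv_symm hy j i]; ring
    · rw [((hφ.flux hU hg j).pd j).eq_zero hx,
        Finset.sum_eq_zero fun i _ => ((htest i j).pd j).eq_zero hx]
  rw [Finset.sum_congr rfl fun i _ => h1 i, Finset.sum_congr rfl fun j _ => h2 j, Finset.sum_comm]

/-- The generator is symmetric with respect to `dv = √g dμ`. -/
lemma integral_mul_generator (hm : m ≠ 0) (hb : hbar ≠ 0) (hU : IsOpen U) (hg : IsMetricOn g U)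
    (hV : ContDiffOn ℝ ∞ V U) (hφ : TestOn U φ) (hψ : ContDiffOn ℝ 2 ψ U) :
    ∫ x, φ x * (sqrtDet g x * generator hbar m g V ψ x)
      = ∫ x, generator hbar m g V φ x * (sqrtDet g x * ψ x) := by
  have hI : ∀ i, Integrable fun x => φ x * pd i (flux g ψ i) x := fun i =>
    hφ.integrable_mul hU (ContDiffOn.pd (k := 0) (ContDiffOn.flux hU hg hψ i) hU
      (by simp) i).continuousOn
  have hI' : ∀ i, Integrable fun x => pd i (flux g φ i) x * ψ x := fun i =>
    ((hφ.flux hU hg i).pd i).integrable_mul hU hψ.continuousOn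
  have hIV : Integrable fun x => φ x * (sqrtDet g x * V x * ψ x) :=
    hφ.integrable_mul hU
      ((hg.contDiffOn_sqrtDet.continuousOn.mul hV.continuousOn).mul hψ.continuousOn)
  have e1 : ∀ x, φ x * (sqrtDet g x * generator hbar m g V ψ x)
      = hbar / (2 * m) * ∑ i, φ x * pd i (flux g ψ i) x
        + -(1 / hbar) * (φ x * (sqrtDet g x * V x * ψ x)) := by
    intro x
    by_cases hx : x ∈ U
    · have := (hg.sqrtDet_pos hx).ne'
      rw [← Finset.mul_sum]
      change φ x * (sqrtDet g x * (-(1 / hbar) * (-(hbar ^ 2 / (2 * m * sqrtDet g x)) *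
        ∑ i, pd i (flux g ψ i) x + V x * ψ x))) = _
      field_simp
      ring
    · simp [hφ.eq_zero hx]
  have e2 : ∀ x, generator hbar m g V φ x * (sqrtDet g x * ψ x)
      = hbar / (2 * m) * ∑ i, pd i (flux g φ i) x * ψ x
        + -(1 / hbar) * (φ x * (sqrtDet g x * V x * ψ x)) := by
    intro x
    by_cases hx : x ∈ U
    · have := (hg.sqrtDet_pos hx).ne'
      rw [← Finset.sum_mul]
      change -(1 / hbar) * (-(hbar ^ 2 / (2 * m * sqrtDet g x)) *
        ∑ i, pd i (flux g φ i) x + V x * φ x) * (sqrtDet g x * ψ x) = _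
      field_simp
      ring
    · rw [(hφ.generator hU hg hV).eq_zero hx, hφ.eq_zero hx,
        Finset.sum_eq_zero fun i _ => by rw [((hφ.flux hU hg i).pd i).eq_zero hx, zero_mul]]
      simp
  have i1 := integral_add ((integrable_finsetSum Finset.univ fun i _ => hI i).const_mul
    (hbar / (2 * m))) (hIV.const_mul (-(1 / hbar)))
  have i2 := integral_add ((integrable_finsetSum Finset.univ fun i _ => hI' i).const_mul
    (hbar / (2 * m))) (hIV.const_mul (-(1 / hbar)))
  simp only [e1, e2]
  rw [i1, i2, integral_const_mul, integral_const_mul, integral_const_mul,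
    integral_finsetSum _ fun i _ => hI i, integral_finsetSum _ fun i _ => hI' i,
    integral_mul_div_flux hU hg hφ hψ]

/-! ### Short-time expansion of a Green's function -/

/-- `∫ φ ρ_t dμ = φ(x₀) + t (Lφ)(x₀) + o(t)` for every test function `φ` on `U`. Two families of
densities with this property have the same localized moments up to `o(t)`. -/
def HasShortTimeExpansion (hbar m : ℝ) (g : Coord d → Matrix (Fin d) (Fin d) ℝ) (V : Coord d → ℝ)
    (U : Set (Coord d)) (x₀ : Coord d) (ρ : ℝ → Coord d → ℝ) : Prop :=
  ∀ φ, TestOn U φ → (fun t : ℝ => (∫ x, φ x * ρ t x) - φ x₀ - t * generator hbar m g V φ x₀)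
    =o[𝓝[>] 0] (fun t : ℝ => t)

/-- If `u → a` and `u' → b` as `t → 0+`, then `u t = a + t b + o(t)`. -/
lemma isLittleO_of_tendsto_deriv {u u' : ℝ → ℝ} {a b : ℝ} (hu : ∀ t > 0, HasDerivAt u (u' t) t)
    (h0 : Tendsto u (𝓝[>] 0) (𝓝 a)) (h1 : Tendsto u' (𝓝[>] 0) (𝓝 b)) :
    (fun t => u t - a - t * b) =o[𝓝[>] 0] (fun t : ℝ => t) := by
  set f : ℝ → ℝ := Function.update u 0 a with hf
  have hfu : ∀ t > 0, f =ᶠ[𝓝 t] u := fun t ht => by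
    filter_upwards [Ioi_mem_nhds ht] with s hs
    exact Function.update_of_ne (ne_of_gt hs) _ _
  have hd : ∀ t > 0, HasDerivAt f (u' t) t := fun t ht => (hu t ht).congr_of_eventuallyEq (hfu t ht)
  have hfa : f 0 = a := Function.update_self ..
  have hderiv : HasDerivWithinAt f b (Ici 0) 0 := by
    refine hasDerivWithinAt_Ici_of_tendsto_deriv (s := Ioi 0)
      (fun t ht => (hd t ht).differentiableAt.differentiableWithinAt) ?_ self_mem_nhdsWithin ?_
    · rw [ContinuousWithinAt, hfa]
      refine h0.congr' ?_
      filter_upwards [self_mem_nhdsWithin] with t ht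
      exact ((hfu t ht).eq_of_nhds).symm
    · refine h1.congr' ?_
      filter_upwards [self_mem_nhdsWithin] with t ht
      exact ((hd t ht).deriv).symm
  have := (hasDerivWithinAt_iff_isLittleO.1 hderiv).mono
    (nhdsWithin_mono (0 : ℝ) (Ioi_subset_Ici_self (a := (0 : ℝ))))
  refine (this.congr' ?_ ?_)
  · filter_upwards [self_mem_nhdsWithin] with t ht
    rw [(hfu t ht).eq_of_nhds, hfa]; simp
  · exact Eventually.of_forall fun t => by simp

namespace IsGreenFunction

variable {G : ℝ → Coord d → ℝ}

lemma contDiffOn_slice (hG : IsGreenFunction hbar m g V U x₀ G) {t : ℝ} (ht : 0 < t) :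
    ContDiffOn ℝ 2 (G t) U :=
  hG.contDiffOn.comp (contDiffOn_const.prodMk contDiffOn_id) fun _ hx => ⟨ht, hx⟩

lemma hasDerivAt (hU : IsOpen U) (hG : IsGreenFunction hbar m g V U x₀ G) {t : ℝ} (ht : 0 < t)
    {x : Coord d} (hx : x ∈ U) :
    HasDerivAt (fun s => G s x) (fderiv ℝ (fun p : ℝ × Coord d => G p.1 p.2) (t, x) (1, 0)) t := by
  have hd : DifferentiableAt ℝ (fun p : ℝ × Coord d => G p.1 p.2) (t, x) :=
    (hG.contDiffOn.differentiableOn (by simp)).differentiableAt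
      ((isOpen_Ioi.prod hU).mem_nhds ⟨ht, hx⟩)
  have h2 : HasDerivAt (fun s : ℝ => (s, x)) ((1 : ℝ), (0 : Coord d)) t :=
    (hasDerivAt_id t).prodMk (hasDerivAt_const t x)
  exact hd.hasFDerivAt.comp_hasDerivAt t h2

lemma integrable_mul (hU : IsOpen U) (hg : IsMetricOn g U)
    (hG : IsGreenFunction hbar m g V U x₀ G) (hφ : TestOn U φ) {t : ℝ} (ht : 0 < t) :
    Integrable fun x => φ x * (sqrtDet g x * G t x) :=
  hφ.integrable_mul hU
    (hg.contDiffOn_sqrtDet.continuousOn.mul (hG.contDiffOn_slice ht).continuousOn)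

/-- The weak form of the heat equation: `d/dt ∫ φ G dv = ∫ (Lφ) G dv`. -/
lemma hasDerivAt_integral (hm : m ≠ 0) (hb : hbar ≠ 0) (hU : IsOpen U) (hg : IsMetricOn g U)
    (hV : ContDiffOn ℝ ∞ V U) (hG : IsGreenFunction hbar m g V U x₀ G) (hφ : TestOn U φ)
    {t : ℝ} (ht : 0 < t) :
    HasDerivAt (fun s => ∫ x, φ x * (sqrtDet g x * G s x))
      (∫ x, generator hbar m g V φ x * (sqrtDet g x * G t x)) t := by
  set D : ℝ × Coord d → ℝ := fun p => fderiv ℝ (fun p : ℝ × Coord d => G p.1 p.2) p (1, 0) with hD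
  have hDc : ContinuousOn D (Ioi 0 ×ˢ U) :=
    ((hG.contDiffOn.fderiv_of_isOpen (isOpen_Ioi.prod hU) (m := 1) (by norm_num)).clm_apply
      contDiffOn_const).continuousOn
  have hDx : ∀ s > 0, ContinuousOn (fun x => D (s, x)) U := fun s hs =>
    hDc.comp (by fun_prop) fun x hx => ⟨hs, hx⟩
  have hsub : Icc (t / 2) (2 * t) ×ˢ tsupport φ ⊆ Ioi 0 ×ˢ U := fun p hp =>
    ⟨lt_of_lt_of_le (by positivity) hp.1.1, hφ.subset hp.2⟩
  obtain ⟨C, hC⟩ := (isCompact_Icc.prod hφ.compact).exists_bound_of_continuousOn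
    ((((hφ.smooth.continuous.comp continuous_snd).continuousOn).mul
      ((hg.contDiffOn_sqrtDet.continuousOn.comp continuous_snd.continuousOn
        fun p hp => hp.2).mul hDc)).mono hsub)
  have key := hasDerivAt_integral_of_dominated_loc_of_deriv_le (μ := volume)
    (F := fun s x => φ x * (sqrtDet g x * G s x)) (x₀ := t)
    (F' := fun s x => φ x * (sqrtDet g x * D (s, x))) (s := Ioo (t / 2) (2 * t))
    (bound := (tsupport φ).indicator fun _ => C)
    (Ioo_mem_nhds (by linarith) (by linarith)) ?_ (hG.integrable_mul hU hg hφ ht) ?_ ?_ ?_ ?_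
  · have h2 : ∫ x, φ x * (sqrtDet g x * D (t, x))
        = ∫ x, generator hbar m g V φ x * (sqrtDet g x * G t x) := by
      rw [← integral_mul_generator hm hb hU hg hV hφ (hG.contDiffOn_slice ht)]
      refine integral_congr_ae (Eventually.of_forall fun x => ?_)
      by_cases hx : x ∈ U
      · have h3 := hG.equation t ht x hx
        rw [(hG.hasDerivAt hU ht hx).deriv] at h3
        simp only [generator, ← h3, hD]
        field_simp
      · simp [hφ.eq_zero hx]
    rw [← h2]
    exact key.2
  · filter_upwards [Ioi_mem_nhds ht] with s hs
    exact (hG.integrable_mul hU hg hφ hs).aestronglyMeasurable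
  · exact (hφ.continuous_mul hU
      (hg.contDiffOn_sqrtDet.continuousOn.mul (hDx t ht))).aestronglyMeasurable
  · refine Eventually.of_forall fun x s hs => ?_
    by_cases hx : x ∈ tsupport φ
    · rw [indicator_of_mem hx]
      exact hC (s, x) ⟨Ioo_subset_Icc_self hs, hx⟩
    · simp [indicator_of_notMem hx, image_eq_zero_of_notMem_tsupport hx]
  · exact (integrable_indicator_iff (isClosed_tsupport φ).measurableSet).2
      (integrableOn_const hφ.compact.measure_lt_top.ne)
  · refine Eventually.of_forall fun x s hs => ?_
    by_cases hx : x ∈ U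
    · exact ((hG.hasDerivAt hU (lt_trans (by positivity) hs.1) hx).const_mul _).const_mul _
    · simpa [hφ.eq_zero hx] using hasDerivAt_const s (0 : ℝ)

/-- Both `∫ φ G dv` and its time derivative `∫ (Lφ) G dv` are integrals of a test function against
`G`, so the initial condition gives their limits as `t → 0+`. -/
theorem hasShortTimeExpansion (hm : m ≠ 0) (hb : hbar ≠ 0) (hU : IsOpen U) (hg : IsMetricOn g U)
    (hV : ContDiffOn ℝ ∞ V U) (hG : IsGreenFunction hbar m g V U x₀ G) :
    HasShortTimeExpansion hbar m g V U x₀ (greenDensity g G) := by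
  intro φ hφ
  have hLφ : TestOn U (generator hbar m g V φ) := hφ.generator hU hg hV
  exact isLittleO_of_tendsto_deriv (fun t ht => hG.hasDerivAt_integral hm hb hU hg hV hφ ht)
    (hG.initial φ hφ.smooth hφ.compact hφ.subset)
    (hG.initial _ hLφ.smooth hLφ.compact hLφ.subset)

end IsGreenFunction

end Generator

/-! ### Quadratic forms and Gaussian integrals -/

/-- The squared Euclidean norm on coordinate space (whose built-in norm is the supremum norm). -/
def sqNorm (z : Coord d) : ℝ := ∑ i, z i ^ 2

/-- The quadratic form `z ↦ z^i A_{ij} z^j`. -/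
def quadForm (A : Matrix (Fin d) (Fin d) ℝ) (z : Coord d) : ℝ := ∑ i, ∑ j, z i * A i j * z j

lemma sqNorm_nonneg (z : Coord d) : 0 ≤ sqNorm z := Finset.sum_nonneg fun _ _ => sq_nonneg _

lemma sq_le_sqNorm (z : Coord d) (i : Fin d) : z i ^ 2 ≤ sqNorm z :=
  Finset.single_le_sum (f := fun i => z i ^ 2) (fun _ _ => sq_nonneg _) (Finset.mem_univ i)

lemma abs_le_one_add_sqNorm (z : Coord d) (i : Fin d) : |z i| ≤ 1 + sqNorm z := by
  have := sq_le_sqNorm z i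
  rw [← sq_abs] at this
  nlinarith [sq_nonneg (|z i| - 1)]

@[fun_prop]
lemma continuous_sqNorm : Continuous (sqNorm : Coord d → ℝ) := by unfold sqNorm; fun_prop

@[fun_prop]
lemma continuous_quadForm (A : Matrix (Fin d) (Fin d) ℝ) : Continuous (quadForm A) := by
  unfold quadForm; fun_prop

lemma sqNorm_smul (s : ℝ) (z : Coord d) : sqNorm (s • z) = s ^ 2 * sqNorm z := by
  simp [sqNorm, Finset.mul_sum, mul_pow]

lemma quadForm_smul (A : Matrix (Fin d) (Fin d) ℝ) (s : ℝ) (z : Coord d) :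
    quadForm A (s • z) = s ^ 2 * quadForm A z := by
  simp only [quadForm, Finset.mul_sum, Pi.smul_apply, smul_eq_mul]
  refine Finset.sum_congr rfl fun i _ => Finset.sum_congr rfl fun j _ => ?_
  ring

lemma quadForm_eq_dotProduct (A : Matrix (Fin d) (Fin d) ℝ) (z : Coord d) :
    quadForm A z = z ⬝ᵥ (A *ᵥ z) := by
  simp [quadForm, dotProduct, Matrix.mulVec, Finset.mul_sum, mul_assoc]

lemma sqNorm_eq_zero {z : Coord d} (h : sqNorm z = 0) : z = 0 := by
  funext i
  have := (Finset.sum_eq_zero_iff_of_nonneg fun _ _ => sq_nonneg _).1 h i (Finset.mem_univ i)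
  simpa using this

lemma quadForm_pos {A : Matrix (Fin d) (Fin d) ℝ} (hA : A.PosDef) {z : Coord d} (hz : z ≠ 0) :
    0 < quadForm A z := by
  rw [quadForm_eq_dotProduct]
  simpa using hA.dotProduct_mulVec_pos hz

lemma isCompact_sqNorm_eq_one : IsCompact {z : Coord d | sqNorm z = 1} := by
  refine Metric.isCompact_of_isClosed_isBounded
    (isClosed_eq continuous_sqNorm continuous_const) ?_
  refine (Metric.isBounded_closedBall (x := (0 : Coord d)) (r := 1)).subset fun z hz => ?_
  rw [mem_closedBall_zero_iff, pi_norm_le_iff_of_nonneg zero_le_one]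
  intro i
  have h1 := sq_le_sqNorm z i
  rw [show sqNorm z = 1 from hz] at h1
  rw [Real.norm_eq_abs]
  exact (sq_le_one_iff_abs_le_one _).1 h1

/-- A continuous field of positive definite matrices is uniformly elliptic on a compact set. -/
lemma exists_uniform_ellipticity {A : Coord d → Matrix (Fin d) (Fin d) ℝ} {K : Set (Coord d)}
    (hK : IsCompact K) (hA : ∀ i j, ContinuousOn (fun h => A h i j) K)
    (hpos : ∀ h ∈ K, (A h).PosDef) :
    ∃ c > 0, ∀ h ∈ K, ∀ z, c * sqNorm z ≤ quadForm (A h) z := by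
  obtain ⟨c, hc, h⟩ := (hK.prod (isCompact_sqNorm_eq_one (d := d))).exists_forall_le'
    (f := fun p => quadForm (A p.1) p.2) (a := 0) (by
      unfold quadForm
      refine continuousOn_finsetSum _ fun i _ => continuousOn_finsetSum _ fun j _ => ?_
      refine (ContinuousOn.mul (by fun_prop) ?_).mul (by fun_prop)
      exact (hA i j).comp continuousOn_fst fun p hp => hp.1) (by
      rintro ⟨h, z⟩ ⟨hh, hz⟩
      refine quadForm_pos (hpos h hh) fun h0 => ?_
      rw [h0] at hz
      simp [sqNorm] at hz)
  refine ⟨c, hc, fun x hx z => ?_⟩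
  rcases (sqNorm_nonneg z).eq_or_lt with h0 | h0
  · rw [← h0, sqNorm_eq_zero h0.symm]; simp [quadForm]
  · have h1 := h (x, (√(sqNorm z))⁻¹ • z) ⟨hx, by
      rw [mem_ofPred_eq, sqNorm_smul, inv_pow, Real.sq_sqrt h0.le, inv_mul_cancel₀ h0.ne']⟩
    simp only [quadForm_smul, inv_pow, Real.sq_sqrt h0.le] at h1
    rwa [← div_eq_inv_mul, le_div_iff₀ h0] at h1

/-- A polynomial factor costs half of the exponential decay. -/
lemma one_add_pow_mul_exp_le (N : ℕ) {c : ℝ} (hc : 0 < c) :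
    ∃ C, 0 ≤ C ∧
      ∀ r : ℝ, 0 ≤ r → (1 + r) ^ N * Real.exp (-c * r) ≤ C * Real.exp (-(c / 2) * r) := by
  have hc' : 0 < c / 2 := by positivity
  refine ⟨(N.factorial : ℝ) / (c / 2) ^ N * Real.exp (c / 2), by positivity, fun r hr => ?_⟩
  have h1 := Real.pow_div_factorial_le_exp (c / 2 * (1 + r)) (by positivity) N
  have h2 : (1 + r) ^ N
      ≤ (N.factorial : ℝ) / (c / 2) ^ N * (Real.exp (c / 2) * Real.exp (c / 2 * r)) := by
    rw [← Real.exp_add, show c / 2 + c / 2 * r = c / 2 * (1 + r) by ring]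
    rw [mul_pow, div_le_iff₀ (by positivity)] at h1
    rw [div_mul_eq_mul_div, le_div_iff₀ (by positivity)]
    linarith
  calc (1 + r) ^ N * Real.exp (-c * r)
      ≤ (N.factorial : ℝ) / (c / 2) ^ N * (Real.exp (c / 2) * Real.exp (c / 2 * r))
        * Real.exp (-c * r) := by gcongr
    _ = (N.factorial : ℝ) / (c / 2) ^ N * Real.exp (c / 2)
        * (Real.exp (c / 2 * r) * Real.exp (-c * r)) := by ring
    _ = _ := by rw [← Real.exp_add]; congr 2; ring

lemma exp_neg_mul_sqNorm (c : ℝ) (z : Coord d) :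
    Real.exp (-c * sqNorm z) = ∏ i, Real.exp (-c * z i ^ 2) := by
  rw [sqNorm, Finset.mul_sum, Real.exp_sum]

lemma integrable_exp_neg_mul_sqNorm {c : ℝ} (hc : 0 < c) :
    Integrable fun z : Coord d => Real.exp (-c * sqNorm z) := by
  simp only [exp_neg_mul_sqNorm]
  exact Integrable.fintype_prod (f := fun _ x => Real.exp (-c * x ^ 2))
    fun _ => integrable_exp_neg_mul_sq hc

/-- The majorant `(1 + |z|²)^N e^{-c|z|²}` used to dominate all Gaussian integrands. -/
noncomputable def gaussMajorant (N : ℕ) (c : ℝ) (z : Coord d) : ℝ :=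
  (1 + sqNorm z) ^ N * Real.exp (-c * sqNorm z)

lemma gaussMajorant_nonneg (N : ℕ) (c : ℝ) (z : Coord d) : 0 ≤ gaussMajorant N c z :=
  mul_nonneg (pow_nonneg (add_nonneg zero_le_one (sqNorm_nonneg z)) N) (Real.exp_nonneg _)

lemma integrable_gaussMajorant (N : ℕ) {c : ℝ} (hc : 0 < c) :
    Integrable (gaussMajorant N c : Coord d → ℝ) := by
  obtain ⟨C, hC, h⟩ := one_add_pow_mul_exp_le N hc
  refine ((integrable_exp_neg_mul_sqNorm (d := d) (half_pos hc)).const_mul C).mono' ?_ ?_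
  · unfold gaussMajorant
    exact Continuous.aestronglyMeasurable (by fun_prop)
  · refine Eventually.of_forall fun z => ?_
    rw [Real.norm_of_nonneg (gaussMajorant_nonneg N c z)]
    exact h _ (sqNorm_nonneg z)

lemma integrable_of_gaussMajorant {f : Coord d → ℝ} (hf : Continuous f) {C c : ℝ} {N : ℕ}
    (hc : 0 < c) (h : ∀ z, |f z| ≤ C * gaussMajorant N c z) : Integrable f :=
  ((integrable_gaussMajorant N hc).const_mul C).mono' hf.aestronglyMeasurable
    (Eventually.of_forall h)

lemma integral_exp_neg_half_sqNorm :
    ∫ z : Coord d, Real.exp (-(1 / 2) * sqNorm z) = (2 * Real.pi) ^ ((d : ℝ) / 2) := by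
  simp only [exp_neg_mul_sqNorm]
  rw [integral_fintype_prod_volume_eq_pow (fun x : ℝ => Real.exp (-(1 / 2) * x ^ 2)),
    integral_gaussian, Fintype.card_fin, Real.sqrt_eq_rpow, ← Real.rpow_natCast,
    ← Real.rpow_mul (by positivity)]
  congr 1 <;> ring

section PosDef

variable {A : Matrix (Fin d) (Fin d) ℝ}

open scoped MatrixOrder in
lemma exists_sqrt_matrix (hA : A.PosDef) :
    ∃ B : Matrix (Fin d) (Fin d) ℝ, Bᵀ * B = A := by
  refine ⟨CFC.sqrt A, ?_⟩
  have h1 : (CFC.sqrt A)ᴴ = CFC.sqrt A := (Matrix.nonneg_iff_posSemidef.1 (CFC.sqrt_nonneg A)).1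
  rw [Matrix.conjTranspose_eq_transpose_of_trivial] at h1
  rw [h1]
  exact CFC.sqrt_mul_sqrt_self A hA.posSemidef.nonneg

/-- The normalization of the Gaussian with precision matrix `A`. -/
lemma integral_exp_quadForm (hA : A.PosDef) :
    ∫ z, Real.exp (-(1 / 2) * quadForm A z) = (2 * Real.pi) ^ ((d : ℝ) / 2) / √A.det := by
  obtain ⟨B, rfl⟩ := exists_sqrt_matrix hA
  have hdet : 0 < (Bᵀ * B).det := hA.det_pos
  have hsq : √(Bᵀ * B).det = |B.det| := by
    rw [Matrix.det_mul, Matrix.det_transpose, Real.sqrt_mul_self_eq_abs]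
  have hB : B.det ≠ 0 := fun h => by simp [Matrix.det_mul, h] at hdet
  have hq : ∀ z, quadForm (Bᵀ * B) z = sqNorm (Matrix.toLin' B z) := by
    intro z
    rw [quadForm_eq_dotProduct, ← Matrix.mulVec_mulVec, Matrix.dotProduct_mulVec,
      Matrix.vecMul_transpose, Matrix.toLin'_apply]
    simp [dotProduct, sqNorm, sq]
  have hmeas : AEMeasurable (Matrix.toLin' B) (volume : Measure (Coord d)) :=
    (LinearMap.continuous_on_pi _).measurable.aemeasurable
  simp only [hq]
  rw [← integral_map (f := fun z => Real.exp (-(1 / 2) * sqNorm z)) hmeas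
    (Continuous.aestronglyMeasurable (by fun_prop)),
    Real.map_matrix_volume_pi_eq_smul_volume_pi hB, integral_smul_measure,
    integral_exp_neg_half_sqNorm, ENNReal.toReal_ofReal (abs_nonneg _), hsq, abs_inv, smul_eq_mul]
  field_simp

lemma exists_ellipticity (hA : A.PosDef) : ∃ c > 0, ∀ z, c * sqNorm z ≤ quadForm A z := by
  obtain ⟨c, hc, h⟩ := exists_uniform_ellipticity (A := fun _ => A) (isCompact_singleton (x := 0))
    (fun _ _ => continuousOn_const) (fun _ _ => hA)
  exact ⟨c, hc, h 0 rfl⟩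

lemma integrable_mul_exp_quadForm (hA : A.PosDef) {P : Coord d → ℝ} (hP : Continuous P) {C : ℝ}
    {N : ℕ} (h : ∀ z, |P z| ≤ C * (1 + sqNorm z) ^ N) :
    Integrable fun z => P z * Real.exp (-(1 / 2) * quadForm A z) := by
  obtain ⟨c, hc, hcA⟩ := exists_ellipticity hA
  refine integrable_of_gaussMajorant (C := C) (c := c / 2) (N := N) (by fun_prop) (half_pos hc)
    fun z => ?_
  rw [abs_mul, Real.abs_exp, gaussMajorant, ← mul_assoc]
  refine mul_le_mul (h z) (Real.exp_le_exp.2 ?_) (Real.exp_nonneg _) ((abs_nonneg _).trans (h z))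
  linarith [hcA z]

/-- The first moments of a centred Gaussian vanish. -/
lemma integral_coord_mul_exp_quadForm (k : Fin d) :
    ∫ z, z k * Real.exp (-(1 / 2) * quadForm A z) = 0 := by
  have h := integral_neg_eq_self
    (fun z : Coord d => z k * Real.exp (-(1 / 2) * quadForm A z)) volume
  have h2 : ∀ z, quadForm A (-z) = quadForm A z := fun z => by simp [quadForm]
  simp only [h2, Pi.neg_apply, neg_mul, integral_neg] at h
  simp only [neg_mul]
  linarith

lemma contDiff_quadForm {n : WithTop ℕ∞} : ContDiff ℝ n (quadForm A) := by
  unfold quadForm; fun_prop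

lemma pd_coord (k l : Fin d) (z : Coord d) :
    pd l (fun z : Coord d => z k) z = if k = l then 1 else 0 := by
  have h : HasFDerivAt (fun z : Coord d => z k) (ContinuousLinearMap.proj (R := ℝ) k) z :=
    (ContinuousLinearMap.proj (R := ℝ) (φ := fun _ : Fin d => ℝ) k).hasFDerivAt
  simp [pd, h.fderiv, Pi.single_apply]

lemma pd_quadForm (hA : A.IsHermitian) (l : Fin d) (z : Coord d) :
    pd l (quadForm A) z = 2 * ∑ j, A l j * z j := by
  have hs : ∀ i j, A i j = A j i := fun i j => by simpa using (hA.apply j i)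
  unfold quadForm
  rw [pd_sum _ fun i _ => by fun_prop]
  have h1 : ∀ i, pd l (fun y : Coord d => ∑ j, y i * A i j * y j) z
      = ∑ j, ((if i = l then 1 else 0) * A i j * z j + z i * A i j * if j = l then 1 else 0) := by
    intro i
    rw [pd_sum _ fun j _ => by fun_prop]
    refine Finset.sum_congr rfl fun j _ => ?_
    rw [pd_mul (by fun_prop) (by fun_prop), pd_mul (by fun_prop) (by fun_prop), pd_coord, pd_coord,
      pd_const]
    ring
  simp only [h1, Finset.sum_add_distrib]
  simp only [mul_ite, mul_one, mul_zero, Finset.sum_ite_eq', Finset.mem_univ, if_true, ite_mul,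
    one_mul, zero_mul]
  rw [Finset.sum_comm]
  simp only [Finset.sum_ite_eq', Finset.mem_univ, if_true]
  rw [two_mul]
  congr 1
  exact Finset.sum_congr rfl fun i _ => by rw [hs i l]; ring

/-- The second moments of a centred Gaussian, obtained by integrating `∂_l (z^k e^{-zAz/2})`. -/
lemma integral_coord_mul_coord_mul_exp_quadForm (hA : A.PosDef) (k l : Fin d) :
    ∫ z, z k * z l * Real.exp (-(1 / 2) * quadForm A z)
      = A⁻¹ k l * ∫ z, Real.exp (-(1 / 2) * quadForm A z) := by
  set e : Coord d → ℝ := fun z => Real.exp (-(1 / 2) * quadForm A z) with he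
  set M : Matrix (Fin d) (Fin d) ℝ := fun k l => ∫ z, z k * z l * e z with hM
  have hint2 : ∀ a b, Integrable fun z => z a * z b * e z := fun a b =>
    integrable_mul_exp_quadForm hA (C := 1) (N := 2) (by fun_prop) fun z => by
      rw [abs_mul, one_mul, sq]
      exact mul_le_mul (abs_le_one_add_sqNorm z a) (abs_le_one_add_sqNorm z b) (abs_nonneg _)
        (add_nonneg zero_le_one (sqNorm_nonneg z))
  have hint1 : ∀ a, Integrable fun z => z a * e z := fun a =>
    integrable_mul_exp_quadForm hA (C := 1) (N := 1) (by fun_prop) fun z => by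
      rw [one_mul, pow_one]; exact abs_le_one_add_sqNorm z a
  have hint0 : Integrable e := by
    simpa [he] using integrable_mul_exp_quadForm hA (P := fun _ => 1) (C := 1) (N := 0)
      continuous_const (by simp)
  have hpd : ∀ b z, pd b e z = -(∑ j, A b j * z j) * e z := fun b z => by
    have h1 := pd_comp (f := fun z => -(1 / 2) * quadForm A z) (Real.hasDerivAt_exp _)
      ((contDiff_quadForm (n := 1)).differentiable (by simp) z |>.const_mul _) b
    rw [he, h1, pd_const_mul ((contDiff_quadForm (n := 1)).differentiable (by simp) z),
      pd_quadForm hA.1]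
    ring
  have hsum : ∀ a b z, z a * pd b e z = -∑ j, A b j * (z a * z j * e z) := fun a b z => by
    rw [hpd, ← Finset.sum_neg_distrib, ← Finset.sum_neg_distrib, Finset.sum_mul, Finset.mul_sum]
    exact Finset.sum_congr rfl fun j _ => by ring
  have hibp : ∀ a b, ∫ z, z a * pd b e z = -∫ z, pd b (fun z : Coord d => z a) z * e z :=
    fun a b => by
    refine integral_mul_fderiv_eq_neg_fderiv_mul_of_integrable ?_ ?_ (hint1 a)
      (fun z _ => by fun_prop) (fun z _ => ?_)
    · change Integrable fun z => pd b (fun z : Coord d => z a) z * e z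
      simp only [pd_coord]
      exact hint0.const_mul _
    · change Integrable fun z => z a * pd b e z
      simp only [hsum]
      exact (integrable_finsetSum _ fun j _ => (hint2 a j).const_mul _).neg
    · exact ((contDiff_quadForm (n := 1)).differentiable (by simp) z |>.const_mul _).exp
  have hAM : A * M = (∫ z, e z) • (1 : Matrix (Fin d) (Fin d) ℝ) := by
    ext b a
    have h1 := hibp a b
    simp only [hsum, pd_coord, integral_neg, neg_inj, integral_const_mul] at h1
    rw [integral_finsetSum _ fun j _ => (hint2 a j).const_mul _] at h1
    simp only [integral_const_mul] at h1
    rw [Matrix.mul_apply, Matrix.smul_apply, Matrix.one_apply, smul_eq_mul, mul_comm]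
    convert h1 using 1
    · refine Finset.sum_congr rfl fun j _ => ?_
      simp only [hM]
      congr 2
      funext z; ring
    · simp only [eq_comm]
  have hfin : M = (∫ z, e z) • A⁻¹ := by
    have := congrArg (fun X => A⁻¹ * X) hAM
    simpa [← mul_assoc, Matrix.nonsing_inv_mul A hA.det_pos.ne'.isUnit] using this
  have := congrFun (congrFun hfin k) l
  rw [Matrix.smul_apply, smul_eq_mul, mul_comm] at this
  exact this

end PosDef

/-! ### Gaussian-dominated families and differentiation under the integral -/

/-- Continuous functions of at most polynomial growth. -/
def PolyBdd (P : Coord d → ℝ) : Prop :=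
  Continuous P ∧ ∃ (C : ℝ) (N : ℕ), ∀ z, |P z| ≤ C * (1 + sqNorm z) ^ N

namespace PolyBdd

lemma const (c : ℝ) : PolyBdd (fun _ : Coord d => c) :=
  ⟨continuous_const, |c|, 0, fun z => by simp⟩

lemma coord (i : Fin d) : PolyBdd (fun z : Coord d => z i) :=
  ⟨continuous_apply i, 1, 1, fun z => by simpa using abs_le_one_add_sqNorm z i⟩

lemma mul {P Q : Coord d → ℝ} (hP : PolyBdd P) (hQ : PolyBdd Q) :
    PolyBdd (fun z => P z * Q z) := by
  obtain ⟨hPc, C, N, hC⟩ := hP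
  obtain ⟨hQc, D, M, hD⟩ := hQ
  refine ⟨hPc.mul hQc, C * D, N + M, fun z => ?_⟩
  rw [abs_mul, pow_add, show C * D * ((1 + sqNorm z) ^ N * (1 + sqNorm z) ^ M)
    = (C * (1 + sqNorm z) ^ N) * (D * (1 + sqNorm z) ^ M) by ring]
  exact mul_le_mul (hC z) (hD z) (abs_nonneg _) ((abs_nonneg _).trans (hC z))

end PolyBdd

lemma gaussMajorant_mono {N M : ℕ} {c e : ℝ} (hN : N ≤ M) (hc : e ≤ c) (z : Coord d) :
    gaussMajorant N c z ≤ gaussMajorant M e z := by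
  have h0 := sqNorm_nonneg z
  refine mul_le_mul (pow_le_pow_right₀ (by linarith) hN) (Real.exp_le_exp.2 ?_)
    (Real.exp_nonneg _) (by positivity)
  nlinarith

/-- A jointly continuous family `z ↦ Ψ h z` dominated, uniformly in the parameter `h`, by a
polynomial times a Gaussian in `z`. -/
def GaussDom (Ψ : Coord d → Coord d → ℝ) : Prop :=
  Continuous (fun p : Coord d × Coord d => Ψ p.1 p.2) ∧
    ∃ (C c : ℝ) (N : ℕ), 0 < c ∧ ∀ h z, |Ψ h z| ≤ C * gaussMajorant N c z

namespace GaussDom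

variable {Ψ Φ : Coord d → Coord d → ℝ}

lemma add (h : GaussDom Ψ) (h' : GaussDom Φ) : GaussDom fun x z => Ψ x z + Φ x z := by
  obtain ⟨hc, C, c, N, hcpos, hb⟩ := h
  obtain ⟨hc', C', c', N', hcpos', hb'⟩ := h'
  refine ⟨hc.add hc', |C| + |C'|, min c c', max N N', lt_min hcpos hcpos', fun x z => ?_⟩
  refine (abs_add_le _ _).trans ?_
  rw [add_mul]
  refine add_le_add ((hb x z).trans ?_) ((hb' x z).trans ?_)
  · exact mul_le_mul (le_abs_self C) (gaussMajorant_mono (le_max_left _ _) (min_le_left _ _) z)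
      (gaussMajorant_nonneg _ _ _) (abs_nonneg _)
  · exact mul_le_mul (le_abs_self C') (gaussMajorant_mono (le_max_right _ _) (min_le_right _ _) z)
      (gaussMajorant_nonneg _ _ _) (abs_nonneg _)

lemma polyMul {P : Coord d → ℝ} (hP : PolyBdd P) (h : GaussDom Ψ) :
    GaussDom fun x z => P z * Ψ x z := by
  obtain ⟨hPc, D, M, hD⟩ := hP
  obtain ⟨hc, C, c, N, hcpos, hb⟩ := h
  refine ⟨(hPc.comp continuous_snd).mul hc, D * C, c, M + N, hcpos, fun x z => ?_⟩
  have := mul_le_mul (hD z) (hb x z) (abs_nonneg _) ((abs_nonneg _).trans (hD z))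
  rw [abs_mul]
  refine this.trans (le_of_eq ?_)
  rw [gaussMajorant, gaussMajorant, pow_add]
  ring

lemma zero : GaussDom fun (_ _ : Coord d) => 0 :=
  ⟨continuous_const, 0, 1, 0, one_pos, fun x z => by simp⟩

end GaussDom

/-- `GaussReg n Ψ`: the family `z ↦ Ψ h z` is `n` times differentiable in the parameter `h`, and
all its derivatives up to order `n` are Gaussian-dominated. -/
def GaussReg : ℕ → (Coord d → Coord d → ℝ) → Prop
  | 0, Ψ => GaussDom Ψ
  | n + 1, Ψ => GaussDom Ψ ∧ (∀ z, Differentiable ℝ fun h => Ψ h z) ∧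
      ∀ k, GaussReg n fun h z => pd k (fun h => Ψ h z) h

lemma gaussReg_zero {Ψ : Coord d → Coord d → ℝ} : GaussReg 0 Ψ ↔ GaussDom Ψ := by
  rw [GaussReg]

lemma gaussReg_succ {n : ℕ} {Ψ : Coord d → Coord d → ℝ} :
    GaussReg (n + 1) Ψ ↔ GaussDom Ψ ∧ (∀ z, Differentiable ℝ fun h => Ψ h z) ∧
      ∀ k, GaussReg n fun h z => pd k (fun h => Ψ h z) h := by
  rw [GaussReg]

namespace GaussReg

variable {n : ℕ} {Ψ Φ : Coord d → Coord d → ℝ}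

lemma dom (h : GaussReg n Ψ) : GaussDom Ψ := by
  cases n with
  | zero => exact gaussReg_zero.1 h
  | succ n => exact (gaussReg_succ.1 h).1

lemma differentiable (h : GaussReg (n + 1) Ψ) (z : Coord d) : Differentiable ℝ fun h => Ψ h z :=
  (gaussReg_succ.1 h).2.1 z

lemma pd (h : GaussReg (n + 1) Ψ) (k : Fin d) :
    GaussReg n fun h z => CurvedQM.pd k (fun h => Ψ h z) h :=
  (gaussReg_succ.1 h).2.2 k

lemma of_succ (h : GaussReg (n + 1) Ψ) : GaussReg n Ψ := by
  induction n generalizing Ψ with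
  | zero => exact gaussReg_zero.2 h.dom
  | succ n ih => exact gaussReg_succ.2 ⟨h.dom, h.differentiable, fun k => ih (h.pd k)⟩

lemma add (h : GaussReg n Ψ) (h' : GaussReg n Φ) : GaussReg n fun x z => Ψ x z + Φ x z := by
  induction n generalizing Ψ Φ with
  | zero => exact gaussReg_zero.2 (h.dom.add h'.dom)
  | succ n ih =>
    refine gaussReg_succ.2
      ⟨h.dom.add h'.dom, fun z => (h.differentiable z).add (h'.differentiable z), fun k => ?_⟩
    simp only [pd_add (h.differentiable _ _) (h'.differentiable _ _)]
    exact ih (h.pd k) (h'.pd k)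

lemma polyMul {P : Coord d → ℝ} (hP : PolyBdd P) (h : GaussReg n Ψ) :
    GaussReg n fun x z => P z * Ψ x z := by
  induction n generalizing Ψ with
  | zero => exact gaussReg_zero.2 (h.dom.polyMul hP)
  | succ n ih =>
    refine gaussReg_succ.2
      ⟨h.dom.polyMul hP, fun z => (h.differentiable z).const_mul _, fun k => ?_⟩
    simp only [pd_const_mul (h.differentiable _ _)]
    exact ih (h.pd k)

lemma zero : GaussReg n fun (_ _ : Coord d) => 0 := by
  induction n with
  | zero => exact gaussReg_zero.2 GaussDom.zero
  | succ n ih =>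
    refine gaussReg_succ.2 ⟨GaussDom.zero, fun z => differentiable_const _, fun k => ?_⟩
    simpa only [pd_const] using ih

lemma sum {ι : Type*} (s : Finset ι) {Ψ : ι → Coord d → Coord d → ℝ}
    (h : ∀ a ∈ s, GaussReg n (Ψ a)) : GaussReg n fun x z => ∑ a ∈ s, Ψ a x z := by
  classical
  induction s using Finset.induction_on with
  | empty => simpa using zero
  | insert a s ha ih =>
    simp only [Finset.sum_insert ha]
    exact (h a (by simp)).add (ih fun b hb => h b (by simp [hb]))

lemma continuous_comp (h : GaussReg n Ψ) {η : Coord d → Coord d} (hη : Continuous η) :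
    Continuous fun z => Ψ (η z) z :=
  h.dom.1.comp (hη.prodMk continuous_id)

lemma integrable (h : GaussReg n Ψ) {η : Coord d → Coord d} (hη : Continuous η) :
    Integrable fun z => Ψ (η z) z := by
  obtain ⟨_, C, c, N, hcpos, hb⟩ := h.dom
  exact integrable_of_gaussMajorant (h.continuous_comp hη) hcpos fun z => hb _ z

/-- Differentiation under the integral along the line `θ ↦ h₀ + θ v(z)` in parameter space, whose
direction may depend on the integration variable. -/
lemma hasDerivAt_integral (h : GaussReg 1 Ψ) {v : Coord d → Coord d}
    (hv : ∀ k, PolyBdd fun z => v z k) (h₀ : Coord d) (θ : ℝ) :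
    HasDerivAt (fun θ : ℝ => ∫ z, Ψ (h₀ + θ • v z) z)
      (∫ z, ∑ k, v z k * CurvedQM.pd k (fun h => Ψ h z) (h₀ + θ • v z)) θ := by
  have hvc : Continuous v := continuous_pi fun k => (hv k).1
  have h' : GaussReg 0 fun x z => ∑ k, v z k * CurvedQM.pd k (fun h => Ψ h z) x :=
    sum _ fun k _ => polyMul (hv k) (h.pd k)
  obtain ⟨hc', C, c, N, hcpos, hb⟩ := h'.dom
  refine (hasDerivAt_integral_of_dominated_loc_of_deriv_le (μ := volume) (s := univ)
    (F := fun (θ : ℝ) z => Ψ (h₀ + θ • v z) z)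
    (bound := fun z => C * gaussMajorant N c z)
    (F' := fun θ z => ∑ k, v z k * CurvedQM.pd k (fun h => Ψ h z) (h₀ + θ • v z))
    univ_mem ?_ (h.integrable (η := fun z => h₀ + θ • v z) (by fun_prop)) ?_ ?_ ?_ ?_).2
  · exact Eventually.of_forall fun s =>
      (h.continuous_comp (η := fun z => h₀ + s • v z) (by fun_prop)).aestronglyMeasurable
  · exact (hc'.comp (f := fun z => (h₀ + θ • v z, z)) (by fun_prop)).aestronglyMeasurable
  · exact Eventually.of_forall fun z s _ => hb _ z
  · exact (integrable_gaussMajorant N hcpos).const_mul C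
  · refine Eventually.of_forall fun z s _ => ?_
    have h1 : HasDerivAt (fun s : ℝ => h₀ + s • v z) (v z) s := by
      simpa using ((hasDerivAt_id s).smul_const (v z)).const_add h₀
    have h2 := (h.differentiable z (h₀ + s • v z)).hasFDerivAt.comp_hasDerivAt s h1
    rwa [fderiv_apply_eq_sum_pd] at h2

/-- The partial derivatives of a parametric integral known to be a differentiable function. -/
lemma pd_eq_integral (h : GaussReg 1 Ψ) {F : Coord d → ℝ} (hF : ∀ x, F x = ∫ z, Ψ x z)
    {x : Coord d} (hd : DifferentiableAt ℝ F x) (k : Fin d) :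
    CurvedQM.pd k F x = ∫ z, CurvedQM.pd k (fun h => Ψ h z) x := by
  have h1 := h.hasDerivAt_integral (v := fun _ => Pi.single k 1) (fun _ => PolyBdd.const _) x 0
  simp only [← hF] at h1
  rw [(hasDerivAt_pd hd k).unique h1]
  congr 1
  funext z
  simp [Pi.single_apply]

/-- First-order expansion of `s ↦ ∫ Ψ(sz, z) dz`: the coefficient is a divergence of first
moments. -/
lemma hasDerivAt_integral_smul (h : GaussReg 1 Ψ) {F : Fin d → Coord d → ℝ}
    (hF : ∀ k x, F k x = ∫ z, z k * Ψ x z) (hd : ∀ k, DifferentiableAt ℝ (F k) 0) :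
    HasDerivAt (fun s : ℝ => ∫ z, Ψ (s • z) z) (∑ k, CurvedQM.pd k (F k) 0) 0 := by
  have h1 := h.hasDerivAt_integral (v := fun z => z) (fun k => PolyBdd.coord k) 0 0
  simp only [zero_add, zero_smul] at h1
  convert h1 using 1
  rw [integral_finsetSum _ fun k _ =>
    (polyMul (PolyBdd.coord k) (h.pd k)).integrable (η := fun _ => 0) continuous_const]
  refine Finset.sum_congr rfl fun k _ => ?_
  rw [pd_eq_integral (polyMul (PolyBdd.coord k) h) (hF k) (hd k)]
  congr 1
  funext z
  exact pd_const_mul (h.differentiable z 0) _ k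

/-- Second-order expansion of `s ↦ ∫ Ψ(sz, z) dz`, for a family without first moments: the
coefficient is the double divergence of the second moments. -/
lemma integral_smul_expansion (h : GaussReg 2 Ψ) {F : Fin d → Fin d → Coord d → ℝ}
    (hF1 : ∀ k x, ∫ z, z k * Ψ x z = 0)
    (hF : ∀ k l x, F k l x = ∫ z, z k * z l * Ψ x z) (hd : ∀ k l, ContDiff ℝ 2 (F k l)) :
    (fun s : ℝ => (∫ z, Ψ (s • z) z) - (∫ z, Ψ 0 z)
        - s ^ 2 * (1 / 2 * ∑ k, ∑ l, CurvedQM.pd l (CurvedQM.pd k (F k l)) 0))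
      =o[𝓝[>] 0] fun s : ℝ => s ^ 2 := by
  set Ψ' : Coord d → Coord d → ℝ := fun x z => ∑ k, z k * CurvedQM.pd k (fun h => Ψ h z) x with hΨ'
  have hreg' : GaussReg 1 Ψ' := sum _ fun k _ => polyMul (PolyBdd.coord k) (h.pd k)
  have hT : ∀ s : ℝ, HasDerivAt (fun s : ℝ => ∫ z, Ψ (s • z) z) (∫ z, Ψ' (s • z) z) s := fun s => by
    have := h.of_succ.hasDerivAt_integral (v := fun z => z) (fun k => PolyBdd.coord k) 0 s
    simpa only [zero_add] using this
  have h0 : ∫ z, Ψ' ((0 : ℝ) • z) z = 0 := by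
    have h1 := (h.of_succ.hasDerivAt_integral_smul (F := fun _ _ => 0) (fun k x => (hF1 k x).symm)
      fun k => differentiableAt_const _)
    rw [(hT 0).unique h1]
    simp [pd_const]
  have hpd : ∀ k l x, CurvedQM.pd k (F k l) x
      = ∫ z, z k * z l * CurvedQM.pd k (fun h => Ψ h z) x := fun k l x => by
    rw [pd_eq_integral (polyMul ((PolyBdd.coord k).mul (PolyBdd.coord l)) h.of_succ) (hF k l)
      ((hd k l).differentiable (by simp) x)]
    congr 1
    funext z
    exact pd_const_mul (h.differentiable z x) _ k
  have hT' : HasDerivAt (fun s : ℝ => ∫ z, Ψ' (s • z) z)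
      (∑ k, ∑ l, CurvedQM.pd l (CurvedQM.pd k (F k l)) 0) 0 := by
    have h1 := hreg'.hasDerivAt_integral_smul (F := fun l x => ∑ k, CurvedQM.pd k (F k l) x)
      (fun l x => ?_) (fun l => ?_)
    · convert h1 using 1
      rw [Finset.sum_comm]
      refine Finset.sum_congr rfl fun l _ => ?_
      rw [pd_sum _ fun k _ => (ContDiff.pd (hd k l) (k := 1) (by norm_num) k).differentiable
        (by simp) 0]
    · simp only [hpd, hΨ']
      rw [← integral_finsetSum _ fun k _ =>
        (polyMul ((PolyBdd.coord k).mul (PolyBdd.coord l)) (h.pd k)).integrable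
          (η := fun _ => x) continuous_const]
      congr 1
      funext z
      rw [Finset.mul_sum]
      exact Finset.sum_congr rfl fun k _ => by ring
    · exact DifferentiableAt.fun_sum fun k _ =>
        (ContDiff.pd (hd k l) (k := 1) (by norm_num) k).differentiable (by simp) 0
  -- in the variable `t = s²` this is a first-order expansion
  set b := ∑ k, ∑ l, CurvedQM.pd l (CurvedQM.pd k (F k l)) 0 with hb
  have key := isLittleO_of_tendsto_deriv (u := fun t => ∫ z, Ψ (√t • z) z)
    (u' := fun t => (∫ z, Ψ' (√t • z) z) * (1 / (2 * √t))) (a := ∫ z, Ψ 0 z) (b := 1 / 2 * b)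
    (fun t ht => (hT (√t)).comp t (Real.hasDerivAt_sqrt ht.ne')) ?_ ?_
  · have hsq : Tendsto (fun s : ℝ => s ^ 2) (𝓝[>] 0) (𝓝[>] 0) := by
      refine tendsto_nhdsWithin_iff.2 ⟨?_, ?_⟩
      · have : Tendsto (fun s : ℝ => s ^ 2) (𝓝 0) (𝓝 (0 ^ 2)) := (continuous_pow 2).tendsto 0
        rw [zero_pow two_ne_zero] at this
        exact this.mono_left nhdsWithin_le_nhds
      · filter_upwards [self_mem_nhdsWithin] with s hs
        exact pow_pos (mem_Ioi.1 hs) 2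
    refine (key.comp_tendsto hsq).congr' ?_ (Eventually.of_forall fun _ => rfl)
    filter_upwards [self_mem_nhdsWithin] with s hs
    simp [Real.sqrt_sq (le_of_lt hs)]
  · have hc : Tendsto (fun t : ℝ => √t) (𝓝[>] 0) (𝓝 0) := by
      have := Real.continuous_sqrt.tendsto 0
      rw [Real.sqrt_zero] at this
      exact this.mono_left nhdsWithin_le_nhds
    have := (hT 0).continuousAt.tendsto.comp hc
    simpa [Function.comp_def] using this
  · have hc : Tendsto (fun t : ℝ => √t) (𝓝[>] 0) (𝓝[≠] 0) := by
      refine tendsto_nhdsWithin_iff.2 ⟨?_, ?_⟩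
      · have := Real.continuous_sqrt.tendsto 0
        rw [Real.sqrt_zero] at this
        exact this.mono_left nhdsWithin_le_nhds
      · filter_upwards [self_mem_nhdsWithin] with s hs
        exact (Real.sqrt_pos.2 hs).ne'
    have h1 := ((hasDerivAt_iff_tendsto_slope.1 hT').comp hc).const_mul (1 / 2)
    refine h1.congr' ?_
    filter_upwards [self_mem_nhdsWithin] with t ht
    have ht' : √t ≠ 0 := (Real.sqrt_pos.2 ht).ne'
    simp only [Function.comp_apply, slope_def_field, h0, sub_zero]
    field_simp

end GaussReg

/-! ### Gaussians whose precision matrix depends on the parameter -/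

/-- The unnormalized Gaussian `a(h) e^{-z·A(h)z/2}` with parameter `h`. -/
noncomputable def gaussFam (A : Coord d → Matrix (Fin d) (Fin d) ℝ) (a : Coord d → ℝ)
    (h z : Coord d) : ℝ :=
  a h * Real.exp (-(1 / 2) * quadForm (A h) z)

section GaussFam

variable {A : Coord d → Matrix (Fin d) (Fin d) ℝ} {W K : Set (Coord d)} {c : ℝ} {a : Coord d → ℝ}

lemma contDiffOn_quadForm {n : WithTop ℕ∞} (hA : ∀ i j, ContDiffOn ℝ n (fun h => A h i j) W)
    (z : Coord d) : ContDiffOn ℝ n (fun h => quadForm (A h) z) W := by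
  unfold quadForm
  exact ContDiffOn.sum fun i _ => ContDiffOn.sum fun j _ =>
    (contDiffOn_const.mul (hA i j)).mul contDiffOn_const

lemma contDiff_gaussFam (hW : IsOpen W) (hKW : K ⊆ W)
    (hA : ∀ i j, ContDiffOn ℝ ∞ (fun h => A h i j) W) (ha : TestOn K a) (z : Coord d) :
    ContDiff ℝ ∞ fun h => gaussFam A a h z :=
  contDiff_mul_of_tsupport_subset hW ha.smooth (ha.subset.trans hKW)
    (contDiffOn_const.mul (contDiffOn_quadForm hA z)).exp

lemma pd_gaussFam (hW : IsOpen W) (hKW : K ⊆ W)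
    (hA : ∀ i j, ContDiffOn ℝ ∞ (fun h => A h i j) W) (ha : TestOn K a) (k : Fin d)
    (h z : Coord d) :
    pd k (fun h => gaussFam A a h z) h = gaussFam A (pd k a) h z + ∑ i, ∑ j,
      -(1 / 2) * z i * z j * gaussFam A (fun h => a h * pd k (fun h => A h i j) h) h z := by
  by_cases hx : h ∈ W
  · have hq : DifferentiableAt ℝ (fun h => quadForm (A h) z) h :=
      ((contDiffOn_quadForm hA z).differentiableOn (by simp)).differentiableAt (hW.mem_nhds hx)
    have hAd : ∀ i j, DifferentiableAt ℝ (fun h => A h i j) h := fun i j =>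
      ((hA i j).differentiableOn (by simp)).differentiableAt (hW.mem_nhds hx)
    have h1 := pd_comp (f := fun h => -(1 / 2) * quadForm (A h) z) (Real.hasDerivAt_exp _)
      (hq.const_mul _) k
    have h2 : pd k (fun h => quadForm (A h) z) h
        = ∑ i, ∑ j, z i * pd k (fun h => A h i j) h * z j := by
      unfold quadForm
      rw [pd_sum _ fun i _ => DifferentiableAt.fun_sum fun j _ =>
        ((hAd i j).const_mul _).mul_const _]
      refine Finset.sum_congr rfl fun i _ => ?_
      rw [pd_sum _ fun j _ => ((hAd i j).const_mul _).mul_const _]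
      refine Finset.sum_congr rfl fun j _ => ?_
      rw [pd_mul ((hAd i j).const_mul _) (differentiableAt_const _), pd_const_mul (hAd i j),
        pd_const]
      ring
    unfold gaussFam
    rw [pd_mul (ha.differentiable h) (hq.const_mul _).exp, h1, pd_const_mul hq, h2]
    congr 1
    simp only [Finset.mul_sum]
    refine Finset.sum_congr rfl fun i _ => Finset.sum_congr rfl fun j _ => ?_
    ring
  · have h0 := eventuallyEq_zero_of_notMem_tsupport fun h' => hx (hKW (ha.subset h'))
    have h1 : (fun h => gaussFam A a h z) =ᶠ[𝓝 h] fun _ => 0 := by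
      filter_upwards [h0] with y hy
      simp [gaussFam, hy]
    rw [pd_congr h1, pd_const]
    simp [gaussFam, pd_congr h0, pd_const, h0.eq_of_nhds]

lemma gaussReg_gaussFam (hW : IsOpen W) (hKW : K ⊆ W)
    (hA : ∀ i j, ContDiffOn ℝ ∞ (fun h => A h i j) W) (hc : 0 < c)
    (hell : ∀ h ∈ K, ∀ z, c * sqNorm z ≤ quadForm (A h) z) (n : ℕ) (ha : TestOn K a) :
    GaussReg n (gaussFam A a) := by
  have h0 : ∀ {a}, TestOn K a → GaussDom (gaussFam A a) := fun {a} ha => by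
    refine ⟨continuous_iff_continuousAt.2 fun p => ?_, ?_⟩
    · by_cases hp : p.1 ∈ W
      · have : ContinuousOn (fun p : Coord d × Coord d => gaussFam A a p.1 p.2) (W ×ˢ univ) := by
          unfold gaussFam quadForm
          refine (ha.smooth.continuous.comp continuous_fst).continuousOn.mul
            (ContinuousOn.rexp (continuousOn_const.mul ?_))
          refine continuousOn_finsetSum _ fun i _ => continuousOn_finsetSum _ fun j _ => ?_
          refine (ContinuousOn.mul (by fun_prop) ?_).mul (by fun_prop)
          exact (hA i j).continuousOn.comp continuousOn_fst fun p hp => hp.1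
        exact this.continuousAt ((hW.prod isOpen_univ).mem_nhds ⟨hp, mem_univ _⟩)
      · have h0 := eventuallyEq_zero_of_notMem_tsupport fun h' => hp (hKW (ha.subset h'))
        refine (continuousAt_const (y := (0 : ℝ))).congr ?_
        filter_upwards [continuous_fst.continuousAt.eventually h0] with y hy
        simp [gaussFam, hy]
    · obtain ⟨C, _, hC⟩ := ha.exists_bound
      refine ⟨C, c / 2, 0, by positivity, fun h z => ?_⟩
      by_cases hx : h ∈ K
      · rw [gaussFam, abs_mul, Real.abs_exp, gaussMajorant, pow_zero, one_mul]
        refine mul_le_mul (hC h) (Real.exp_le_exp.2 ?_) (Real.exp_nonneg _)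
          ((abs_nonneg _).trans (hC h))
        linarith [hell h hx z]
      · rw [gaussFam, ha.eq_zero hx, zero_mul, abs_zero]
        exact mul_nonneg ((abs_nonneg _).trans (hC h)) (gaussMajorant_nonneg _ _ _)
  induction n generalizing a with
  | zero => exact gaussReg_zero.2 (h0 ha)
  | succ n ih =>
    refine gaussReg_succ.2 ⟨h0 ha,
      fun z => (contDiff_gaussFam hW hKW hA ha z).differentiable (by simp), fun k => ?_⟩
    simp only [pd_gaussFam hW hKW hA ha]
    refine (ih (ha.pd k)).add (GaussReg.sum _ fun i _ => GaussReg.sum _ fun j _ =>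
      GaussReg.polyMul (((PolyBdd.const _).mul (PolyBdd.coord i)).mul (PolyBdd.coord j)) (ih ?_))
    exact ha.mul_smoothOn hW hKW (ContDiffOn.pd (hA i j) hW (by simp) k)

end GaussFam

/-! ### Second-order expansion of a Gaussian with varying precision and drift -/

lemma abs_exp_sub_quadratic_le (x : ℝ) :
    |Real.exp x - (1 + x + x ^ 2 / 2)| ≤ |x| ^ 3 * Real.exp |x| := by
  have h := Complex.norm_exp_sub_sum_le_norm_mul_exp (x : ℂ) 3
  have e : Complex.exp (x : ℂ) - ∑ m ∈ Finset.range 3, (x : ℂ) ^ m / (m.factorial : ℂ)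
      = ((Real.exp x - (1 + x + x ^ 2 / 2) : ℝ) : ℂ) := by
    simp [Finset.sum_range_succ]
  rw [e, Complex.norm_real, Complex.norm_real] at h
  exact h

/-- The elementary estimate behind the expansion: `e^{sp - s²γ}` to third order in `s`, with a
constant that grows only polynomially in `X`, apart from `e^{2sX}`. -/
lemma abs_exp_drift_sub_le {s p γ X : ℝ} (hs : 0 ≤ s) (hs1 : s ≤ 1) (hX : 1 ≤ X) (hp : |p| ≤ X)
    (hγ : |γ| ≤ X) :
    |Real.exp (s * p - s ^ 2 * γ) - (1 + s * p - s ^ 2 * γ + s ^ 2 * p ^ 2 / 2)|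
      ≤ 10 * s ^ 3 * X ^ 3 * Real.exp (2 * s * X) := by
  set E := s * p - s ^ 2 * γ with hE
  have hEabs : |E| ≤ 2 * s * X := by
    have h1 : |s * p| ≤ s * X := by rw [abs_mul, abs_of_nonneg hs]; gcongr
    have h2 : |s ^ 2 * γ| ≤ s * X := by
      rw [abs_mul, abs_of_nonneg (by positivity)]
      have : s ^ 2 ≤ s := by nlinarith
      gcongr
    exact (abs_sub _ _).trans (by linarith)
  have h1 : |Real.exp E - (1 + E + E ^ 2 / 2)| ≤ 8 * s ^ 3 * X ^ 3 * Real.exp (2 * s * X) := by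
    refine (abs_exp_sub_quadratic_le E).trans ?_
    calc |E| ^ 3 * Real.exp |E| ≤ (2 * s * X) ^ 3 * Real.exp (2 * s * X) := by gcongr
      _ = _ := by ring
  have h2 : |E ^ 2 / 2 - s ^ 2 * p ^ 2 / 2| ≤ 2 * s ^ 3 * X ^ 3 * Real.exp (2 * s * X) := by
    have e : E ^ 2 / 2 - s ^ 2 * p ^ 2 / 2 = s ^ 3 * (-(p * γ) + s * γ ^ 2 / 2) := by
      rw [hE]; ring
    have h3 : |p * γ| ≤ X ^ 2 := by rw [abs_mul, sq]; gcongr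
    have h4 : |s * γ ^ 2 / 2| ≤ X ^ 2 := by
      rw [abs_div, abs_mul, abs_of_nonneg hs, abs_pow, abs_two]
      have : |γ| ^ 2 ≤ X ^ 2 := by gcongr
      nlinarith [sq_nonneg |γ|]
    have h5 : |-(p * γ) + s * γ ^ 2 / 2| ≤ 2 * X ^ 2 :=
      (abs_add_le _ _).trans (by rw [abs_neg]; linarith)
    rw [e, abs_mul, abs_of_nonneg (by positivity)]
    have h6 : (1 : ℝ) ≤ Real.exp (2 * s * X) := Real.one_le_exp (by positivity)
    calc s ^ 3 * |-(p * γ) + s * γ ^ 2 / 2| ≤ s ^ 3 * (2 * X ^ 2) := by gcongr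
      _ ≤ s ^ 3 * (2 * X ^ 3) := by gcongr; norm_num
      _ = 2 * s ^ 3 * X ^ 3 * 1 := by ring
      _ ≤ _ := by gcongr
  calc |Real.exp E - (1 + s * p - s ^ 2 * γ + s ^ 2 * p ^ 2 / 2)|
      = |(Real.exp E - (1 + E + E ^ 2 / 2)) + (E ^ 2 / 2 - s ^ 2 * p ^ 2 / 2)| := by
        congr 1; rw [hE]; ring
    _ ≤ _ := (abs_add_le _ _).trans (by linarith)

section Expansion

variable {A : Coord d → Matrix (Fin d) (Fin d) ℝ} {W K : Set (Coord d)} {c : ℝ}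
  {a γ : Coord d → ℝ} {β : Fin d → Coord d → ℝ}

/-- The mass of the unnormalized Gaussian with precision matrix `A h`. -/
noncomputable def gaussMass (A : Coord d → Matrix (Fin d) (Fin d) ℝ) (h : Coord d) : ℝ :=
  (2 * Real.pi) ^ ((d : ℝ) / 2) / sqrtDet A h

lemma contDiffOn_gaussMass (hA : IsMetricOn A W) : ContDiffOn ℝ ∞ (gaussMass A) W :=
  contDiffOn_const.div hA.contDiffOn_sqrtDet fun _ hx => (hA.sqrtDet_pos hx).ne'

lemma integral_gaussFam (hKW : K ⊆ W) (hA : IsMetricOn A W) (ha : TestOn K a) (h : Coord d) :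
    ∫ z, gaussFam A a h z = a h * gaussMass A h := by
  by_cases hx : h ∈ K
  · simp only [gaussFam]
    rw [integral_const_mul, integral_exp_quadForm (hA.posDef h (hKW hx))]
    rfl
  · simp [gaussFam, ha.eq_zero hx]

lemma integral_coord_mul_gaussFam (k : Fin d) (h : Coord d) :
    ∫ z, z k * gaussFam A a h z = 0 := by
  simp only [gaussFam, mul_left_comm _ (a h)]
  rw [integral_const_mul, integral_coord_mul_exp_quadForm, mul_zero]

lemma integral_coord_mul_coord_mul_gaussFam (hKW : K ⊆ W) (hA : IsMetricOn A W)
    (ha : TestOn K a) (k l : Fin d) (h : Coord d) :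
    ∫ z, z k * z l * gaussFam A a h z = a h * (gInv A k l h * gaussMass A h) := by
  by_cases hx : h ∈ K
  · simp only [gaussFam, mul_left_comm _ (a h)]
    rw [integral_const_mul, integral_coord_mul_coord_mul_exp_quadForm (hA.posDef h (hKW hx)),
      integral_exp_quadForm (hA.posDef h (hKW hx))]
    rfl
  · simp [gaussFam, ha.eq_zero hx]

lemma TestOn.mul_secondMoment (hW : IsOpen W) (hKW : K ⊆ W) (hA : IsMetricOn A W)
    (ha : TestOn K a) (k l : Fin d) :
    TestOn K fun h => a h * (gInv A k l h * gaussMass A h) :=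
  ha.mul_smoothOn hW hKW ((hA.contDiffOn_gInv k l).mul (contDiffOn_gaussMass hA))

/-- The `s²`-coefficient in the expansion of
`∫ a(sz) exp(-½ z·A(sz)z + s β(sz)·z - s² γ(sz)) dz`. -/
noncomputable def secondOrderCoeff (A : Coord d → Matrix (Fin d) (Fin d) ℝ) (a : Coord d → ℝ)
    (β : Fin d → Coord d → ℝ) (γ : Coord d → ℝ) : ℝ :=
  1 / 2 * ∑ k, ∑ l, pd l (pd k fun h => a h * (gInv A k l h * gaussMass A h)) 0
    + ∑ j, ∑ k, pd k (fun h => a h * β j h * (gInv A k j h * gaussMass A h)) 0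
    + 1 / 2 * ∑ i, ∑ j, a 0 * (β i 0 * β j 0) * (gInv A i j 0 * gaussMass A 0)
    - a 0 * γ 0 * gaussMass A 0

/-- The Gaussian with drift, minus its second-order Taylor polynomial in the drift. -/
noncomputable def driftRemainder (A : Coord d → Matrix (Fin d) (Fin d) ℝ) (a : Coord d → ℝ)
    (β : Fin d → Coord d → ℝ) (γ : Coord d → ℝ) (s : ℝ) (z : Coord d) : ℝ :=
  gaussFam A a (s • z) z * (Real.exp (s * ∑ j, β j (s • z) * z j - s ^ 2 * γ (s • z))
    - (1 + s * (∑ j, β j (s • z) * z j) - s ^ 2 * γ (s • z)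
      + s ^ 2 * (∑ j, β j (s • z) * z j) ^ 2 / 2))

lemma continuous_driftRemainder (hW : IsOpen W) (hKW : K ⊆ W) (hA : IsMetricOn A W)
    (ha : TestOn K a) (hβ : ∀ j, ContDiffOn ℝ ∞ (β j) W) (hγ : ContDiffOn ℝ ∞ γ W) (s : ℝ) :
    Continuous (driftRemainder A a β γ s) := by
  refine continuous_iff_continuousAt.2 fun z => ?_
  have hsz : Continuous fun z : Coord d => s • z := by fun_prop
  by_cases hz : s • z ∈ W
  · have hW' : IsOpen ((fun z : Coord d => s • z) ⁻¹' W) := hW.preimage hsz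
    have hc : ∀ {f : Coord d → ℝ}, ContDiffOn ℝ ∞ f W →
        ContinuousOn (fun z : Coord d => f (s • z)) ((fun z : Coord d => s • z) ⁻¹' W) :=
      fun hf => hf.continuousOn.comp hsz.continuousOn fun _ h => h
    have hp : ContinuousOn (fun z : Coord d => ∑ j, β j (s • z) * z j)
        ((fun z : Coord d => s • z) ⁻¹' W) :=
      continuousOn_finsetSum _ fun j _ => (hc (hβ j)).mul (by fun_prop)
    have hq : ContinuousOn (fun z : Coord d => quadForm (A (s • z)) z)
        ((fun z : Coord d => s • z) ⁻¹' W) := by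
      unfold quadForm
      exact continuousOn_finsetSum _ fun i _ => continuousOn_finsetSum _ fun j _ =>
        (ContinuousOn.mul (by fun_prop) (hc (hA.smooth i j))).mul (by fun_prop)
    have : ContinuousOn (driftRemainder A a β γ s) ((fun z : Coord d => s • z) ⁻¹' W) := by
      unfold driftRemainder gaussFam
      have hγ' := hc hγ
      have ha' : ContinuousOn (fun z : Coord d => a (s • z))
          ((fun z : Coord d => s • z) ⁻¹' W) := hc ha.smooth.contDiffOn
      exact (ha'.mul (continuousOn_const.mul hq).rexp).mul
        (((continuousOn_const.mul hp).sub (continuousOn_const.mul hγ')).rexp.sub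
          (((continuousOn_const.add (continuousOn_const.mul hp)).sub
            (continuousOn_const.mul hγ')).add ((continuousOn_const.mul (hp.pow 2)).div_const 2)))
    exact this.continuousAt (hW'.mem_nhds hz)
  · have h0 := eventuallyEq_zero_of_notMem_tsupport fun h' => hz (hKW (ha.subset h'))
    refine (continuousAt_const (y := (0 : ℝ))).congr ?_
    filter_upwards [hsz.continuousAt.eventually h0] with y hy
    simp [driftRemainder, gaussFam, hy]

/-- For small `s` the factor `e^{O(s(1+|z|²))}` in the remainder is absorbed by the Gaussian. -/
lemma exists_driftRemainder_bound (hK : IsCompact K) (hKW : K ⊆ W) (hc : 0 < c)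
    (hell : ∀ h ∈ K, ∀ z, c * sqNorm z ≤ quadForm (A h) z)
    (ha : TestOn K a) (hβ : ∀ j, ContDiffOn ℝ ∞ (β j) W) (hγ : ContDiffOn ℝ ∞ γ W) :
    ∃ C s₀ : ℝ, 0 < s₀ ∧ ∀ s, 0 ≤ s → s ≤ s₀ → ∀ z,
      |driftRemainder A a β γ s z| ≤ C * s ^ 3 * gaussMajorant 3 (c / 4) z := by
  obtain ⟨Ca, hCa0, hCa⟩ := ha.exists_bound
  have hβb : ∀ j, ∃ B, ∀ h ∈ K, |β j h| ≤ B := fun j =>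
    hK.exists_bound_of_continuousOn ((hβ j).continuousOn.mono hKW)
  choose B hB using hβb
  obtain ⟨Bγ, hBγ⟩ := hK.exists_bound_of_continuousOn (hγ.continuousOn.mono hKW)
  set D : ℝ := 1 + ∑ j, |B j| + |Bγ| with hD
  have hDpos : 1 ≤ D := by
    have : 0 ≤ ∑ j, |B j| := Finset.sum_nonneg fun _ _ => abs_nonneg _
    have := abs_nonneg Bγ
    linarith
  refine ⟨10 * Ca * D ^ 3 * Real.exp (c / 4), min 1 (c / (8 * D)), by positivity,
    fun s hs hs0 z => ?_⟩
  have hq := sqNorm_nonneg z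
  by_cases hx : s • z ∈ K
  · have hp : |∑ j, β j (s • z) * z j| ≤ D * (1 + sqNorm z) := by
      refine (Finset.abs_sum_le_sum_abs _ _).trans ?_
      calc ∑ j, |β j (s • z) * z j| ≤ ∑ j, |B j| * (1 + sqNorm z) := by
            refine Finset.sum_le_sum fun j _ => ?_
            rw [abs_mul]
            exact mul_le_mul ((hB j _ hx).trans (le_abs_self _)) (abs_le_one_add_sqNorm z j)
              (abs_nonneg _) (abs_nonneg _)
        _ = (∑ j, |B j|) * (1 + sqNorm z) := by rw [Finset.sum_mul]
        _ ≤ _ := by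
            have := abs_nonneg Bγ
            gcongr
            linarith
    have hγ' : |γ (s • z)| ≤ D * (1 + sqNorm z) := by
      have h1 : |γ (s • z)| ≤ |Bγ| := (hBγ _ hx).trans (le_abs_self _)
      have h2 : 0 ≤ ∑ j, |B j| := Finset.sum_nonneg fun _ _ => abs_nonneg _
      nlinarith [abs_nonneg Bγ]
    have hX : 1 ≤ D * (1 + sqNorm z) := by nlinarith
    have h1 := abs_exp_drift_sub_le hs (hs0.trans (min_le_left _ _)) hX hp hγ'
    have h2 : Real.exp (2 * s * (D * (1 + sqNorm z)))
        ≤ Real.exp (c / 4) * Real.exp (c / 4 * sqNorm z) := by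
      rw [← Real.exp_add]
      refine Real.exp_le_exp.2 ?_
      have h3 : s ≤ c / (8 * D) := hs0.trans (min_le_right _ _)
      rw [le_div_iff₀ (by positivity)] at h3
      nlinarith
    have h3 : |gaussFam A a (s • z) z| ≤ Ca * Real.exp (-(c / 2) * sqNorm z) := by
      rw [gaussFam, abs_mul, Real.abs_exp]
      refine mul_le_mul (hCa _) (Real.exp_le_exp.2 ?_) (Real.exp_nonneg _) hCa0
      linarith [hell _ hx z]
    rw [driftRemainder, abs_mul]
    calc _ ≤ (Ca * Real.exp (-(c / 2) * sqNorm z)) * (10 * s ^ 3 * (D * (1 + sqNorm z)) ^ 3 *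
          (Real.exp (c / 4) * Real.exp (c / 4 * sqNorm z))) := by
          refine mul_le_mul h3 (h1.trans ?_) (abs_nonneg _) (by positivity)
          gcongr
      _ = 10 * Ca * D ^ 3 * Real.exp (c / 4) * s ^ 3 * ((1 + sqNorm z) ^ 3 *
          (Real.exp (-(c / 2) * sqNorm z) * Real.exp (c / 4 * sqNorm z))) := by ring
      _ = _ := by
          rw [← Real.exp_add, gaussMajorant]
          congr 3
          ring
  · rw [driftRemainder, gaussFam, ha.eq_zero hx, zero_mul, zero_mul, abs_zero]
    exact mul_nonneg (by positivity) (gaussMajorant_nonneg _ _ _)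

/-- Laplace expansion to second order in `s` of a Gaussian integral whose amplitude, precision
matrix and drift are evaluated at `sz`. The exponential of the drift is expanded to second order;
each term is then a Gaussian moment with parameter `sz`, which is expanded in `s`. -/
theorem integral_gaussian_drift_expansion (hW : IsOpen W) (hK : IsCompact K) (hKW : K ⊆ W)
    (hA : IsMetricOn A W) (ha : TestOn K a) (hβ : ∀ j, ContDiffOn ℝ ∞ (β j) W)
    (hγ : ContDiffOn ℝ ∞ γ W) :
    (fun s : ℝ => (∫ z, gaussFam A a (s • z) z
        * Real.exp (s * ∑ j, β j (s • z) * z j - s ^ 2 * γ (s • z)))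
      - a 0 * gaussMass A 0 - s ^ 2 * secondOrderCoeff A a β γ) =o[𝓝[>] 0] fun s : ℝ => s ^ 2 := by
  obtain ⟨c, hc, hell⟩ := exists_uniform_ellipticity hK
    (fun i j => (hA.smooth i j).continuousOn.mono hKW) fun h hh => hA.posDef h (hKW hh)
  have hreg : ∀ n {b : Coord d → ℝ}, TestOn K b → GaussReg n (gaussFam A b) := fun n b hb =>
    gaussReg_gaussFam hW hKW hA.smooth hc hell n hb
  have haβ : ∀ j, TestOn K fun h => a h * β j h := fun j => ha.mul_smoothOn hW hKW (hβ j)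
  have haβ2 : ∀ i j, TestOn K fun h => a h * (β i h * β j h) := fun i j =>
    ha.mul_smoothOn hW hKW ((hβ i).mul (hβ j))
  have haγ : TestOn K fun h => a h * γ h := ha.mul_smoothOn hW hKW hγ
  -- the four kinds of integrals in the expansion of the exponential of the drift
  set T0 : ℝ → ℝ := fun s => ∫ z, gaussFam A a (s • z) z with hT0
  set T1 : Fin d → ℝ → ℝ := fun j s => ∫ z, z j * gaussFam A (fun h => a h * β j h) (s • z) z
    with hT1
  set T2 : Fin d → Fin d → ℝ → ℝ := fun i j s =>
    ∫ z, z i * z j * gaussFam A (fun h => a h * (β i h * β j h)) (s • z) z with hT2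
  set T3 : ℝ → ℝ := fun s => ∫ z, gaussFam A (fun h => a h * γ h) (s • z) z with hT3
  have hr0 : GaussReg 2 (gaussFam A a) := hreg 2 ha
  have hr1 : ∀ j, GaussReg 1 fun h z => z j * gaussFam A (fun h => a h * β j h) h z := fun j =>
    GaussReg.polyMul (PolyBdd.coord j) (hreg 1 (haβ j))
  have hr2 : ∀ i j, GaussReg 1
      fun h z => z i * z j * gaussFam A (fun h => a h * (β i h * β j h)) h z := fun i j =>
    GaussReg.polyMul ((PolyBdd.coord i).mul (PolyBdd.coord j)) (hreg 1 (haβ2 i j))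
  have hr3 : GaussReg 1 (gaussFam A fun h => a h * γ h) := hreg 1 haγ
  have e0 : (fun s : ℝ => T0 s - a 0 * gaussMass A 0 - s ^ 2 * (1 / 2 * ∑ k, ∑ l,
      pd l (pd k fun h => a h * (gInv A k l h * gaussMass A h)) 0)) =o[𝓝[>] 0]
      fun s : ℝ => s ^ 2 := by
    have := hr0.integral_smul_expansion
      (F := fun k l h => a h * (gInv A k l h * gaussMass A h))
      (fun k x => integral_coord_mul_gaussFam k x)
      (fun k l x => (integral_coord_mul_coord_mul_gaussFam hKW hA ha k l x).symm)
      (fun k l => ((ha.mul_secondMoment hW hKW hA k l).smooth).of_le ENat.LEInfty.out)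
    rwa [integral_gaussFam hKW hA ha] at this
  have e1 : ∀ j, (fun s : ℝ => T1 j s - s * ∑ k,
      pd k (fun h => a h * β j h * (gInv A k j h * gaussMass A h)) 0) =o[𝓝[>] 0]
      fun s : ℝ => s := fun j => by
    have h1 := (hr1 j).hasDerivAt_integral_smul
      (F := fun k h => a h * β j h * (gInv A k j h * gaussMass A h))
      (fun k x => by
        rw [← integral_coord_mul_coord_mul_gaussFam hKW hA (haβ j) k j x]
        simp only [mul_assoc])
      (fun k => ((haβ j).mul_secondMoment hW hKW hA k j).differentiable 0)
    have h2 := (hasDerivAt_iff_isLittleO.1 h1).mono (nhdsWithin_le_nhds (s := Ioi 0))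
    simp only [sub_zero, zero_smul, integral_coord_mul_gaussFam, smul_eq_mul] at h2
    exact h2
  have hlim : ∀ {Ψ : Coord d → Coord d → ℝ}, GaussReg 1 Ψ →
      Tendsto (fun s : ℝ => ∫ z, Ψ (s • z) z) (𝓝[>] 0) (𝓝 (∫ z, Ψ 0 z)) := fun {Ψ} hΨ => by
    have h1 :=
      (hΨ.hasDerivAt_integral (v := fun z => z) (fun k => PolyBdd.coord k) 0 0).continuousAt
    simp only [ContinuousAt, zero_add, zero_smul] at h1
    exact h1.mono_left nhdsWithin_le_nhds
  have e2 : ∀ i j, Tendsto (T2 i j) (𝓝[>] 0)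
      (𝓝 (a 0 * (β i 0 * β j 0) * (gInv A i j 0 * gaussMass A 0))) := fun i j => by
    have := hlim (hr2 i j)
    rwa [integral_coord_mul_coord_mul_gaussFam hKW hA (haβ2 i j)] at this
  have e3 : Tendsto T3 (𝓝[>] 0) (𝓝 (a 0 * γ 0 * gaussMass A 0)) := by
    have := hlim hr3
    rwa [integral_gaussFam hKW hA haγ] at this
  -- the remainder
  obtain ⟨C, s₀, hs₀, hC⟩ := exists_driftRemainder_bound hK hKW hc hell ha hβ hγ
  have hRcont := continuous_driftRemainder hW hKW hA ha hβ hγ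
  have hRint : ∀ s, 0 ≤ s → s ≤ s₀ → Integrable (driftRemainder A a β γ s) := fun s h1 h2 =>
    integrable_of_gaussMajorant (hRcont s) (by positivity : 0 < c / 4) (hC s h1 h2)
  have eR : (fun s => ∫ z, driftRemainder A a β γ s z) =o[𝓝[>] 0] fun s : ℝ => s ^ 2 := by
    have hO : (fun s => ∫ z, driftRemainder A a β γ s z) =O[𝓝[>] 0] fun s : ℝ => s ^ 3 := by
      refine Asymptotics.IsBigO.of_bound (|C| * ∫ z : Coord d, gaussMajorant 3 (c / 4) z) ?_
      filter_upwards [Ioc_mem_nhdsGT hs₀] with s hs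
      have hmaj := integrable_gaussMajorant (d := d) 3 (by positivity : 0 < c / 4)
      calc ‖∫ z, driftRemainder A a β γ s z‖ ≤ ∫ z, C * s ^ 3 * gaussMajorant 3 (c / 4) z :=
            norm_integral_le_of_norm_le (hmaj.const_mul _)
              (Eventually.of_forall fun z => hC s hs.1.le hs.2 z)
        _ = C * s ^ 3 * ∫ z : Coord d, gaussMajorant 3 (c / 4) z := integral_const_mul _ _
        _ ≤ |C| * s ^ 3 * ∫ z : Coord d, gaussMajorant 3 (c / 4) z := by
            have := integral_nonneg (μ := volume) (f := gaussMajorant (d := d) 3 (c / 4))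
              (gaussMajorant_nonneg 3 (c / 4))
            have := pow_nonneg hs.1.le 3
            gcongr
            exact le_abs_self C
        _ = _ := by
            rw [norm_pow, Real.norm_of_nonneg hs.1.le]; ring
    refine hO.trans_isLittleO ?_
    have : (fun s : ℝ => s ^ 3) =o[𝓝 0] fun s : ℝ => s ^ 2 :=
      Asymptotics.isLittleO_pow_pow (by norm_num)
    exact this.mono nhdsWithin_le_nhds
  have split : ∀ s, 0 ≤ s → s ≤ s₀ →
      ∫ z, gaussFam A a (s • z) z
        * Real.exp (s * ∑ j, β j (s • z) * z j - s ^ 2 * γ (s • z))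
      = T0 s + s * ∑ j, T1 j s + s ^ 2 * (1 / 2 * ∑ i, ∑ j, T2 i j s - T3 s)
        + ∫ z, driftRemainder A a β γ s z := by
    intro s hs1 hs2
    have hη : Continuous fun z : Coord d => s • z := by fun_prop
    have i0 := hr0.integrable hη
    have i1 := fun j => (hr1 j).integrable hη
    have i2 := fun i j => (hr2 i j).integrable hη
    have i3 := hr3.integrable hη
    have j1 := (integrable_finsetSum Finset.univ fun j _ => i1 j).const_mul s
    have j2 := ((integrable_finsetSum Finset.univ fun i _ =>
      integrable_finsetSum Finset.univ fun j _ => i2 i j).const_mul (1 / 2))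
    have j3 := j2.sub i3
    simp only [Pi.sub_def] at j3
    replace j3 := j3.const_mul (s ^ 2)
    rw [hT0, hT1, hT2, hT3]
    simp only []
    rw [← integral_finsetSum _ fun j _ => i1 j]
    simp only [← integral_finsetSum Finset.univ fun j _ => i2 _ j]
    rw [← integral_finsetSum _ fun i _ => integrable_finsetSum Finset.univ fun j _ => i2 i j,
      ← integral_const_mul, ← integral_const_mul, ← integral_sub j2 i3, ← integral_const_mul,
      ← integral_add i0 j1, ← integral_add (i0.fun_add j1) j3,
      ← integral_add ((i0.fun_add j1).fun_add j3) (hRint s hs1 hs2)]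
    refine integral_congr_ae (Eventually.of_forall fun z => ?_)
    have k1 : ∑ j, z j * gaussFam A (fun h => a h * β j h) (s • z) z
        = gaussFam A a (s • z) z * ∑ j, β j (s • z) * z j := by
      rw [Finset.mul_sum]
      refine Finset.sum_congr rfl fun j _ => ?_
      simp only [gaussFam]; ring
    have k2 : ∑ i, ∑ j, z i * z j * gaussFam A (fun h => a h * (β i h * β j h)) (s • z) z
        = gaussFam A a (s • z) z * (∑ j, β j (s • z) * z j) ^ 2 := by
      rw [sq, Finset.sum_mul_sum, Finset.mul_sum]
      refine Finset.sum_congr rfl fun i _ => ?_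
      rw [Finset.mul_sum]
      refine Finset.sum_congr rfl fun j _ => ?_
      simp only [gaussFam]; ring
    have k3 : gaussFam A (fun h => a h * γ h) (s • z) z
        = gaussFam A a (s • z) z * γ (s • z) := by
      simp only [gaussFam]; ring
    simp only [k1, k2, k3, driftRemainder]
    ring
  -- collect the four expansions
  have f1 : (fun s : ℝ => s * ∑ j, (T1 j s - s * ∑ k,
      pd k (fun h => a h * β j h * (gInv A k j h * gaussMass A h)) 0)) =o[𝓝[>] 0]
      fun s : ℝ => s ^ 2 := by
    simp only [sq]
    exact (Asymptotics.isBigO_refl _ _).mul_isLittleO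
      (Asymptotics.IsLittleO.fun_sum fun j _ => e1 j)
  have f2 : (fun s : ℝ => s ^ 2 * (1 / 2 * ∑ i, ∑ j, T2 i j s - T3 s
      - (1 / 2 * ∑ i, ∑ j, a 0 * (β i 0 * β j 0) * (gInv A i j 0 * gaussMass A 0)
        - a 0 * γ 0 * gaussMass A 0))) =o[𝓝[>] 0] fun s : ℝ => s ^ 2 := by
    have ht : Tendsto (fun s => 1 / 2 * ∑ i, ∑ j, T2 i j s - T3 s) (𝓝[>] 0)
        (𝓝 (1 / 2 * ∑ i, ∑ j, a 0 * (β i 0 * β j 0) * (gInv A i j 0 * gaussMass A 0)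
          - a 0 * γ 0 * gaussMass A 0)) :=
      ((tendsto_finsetSum _ fun i _ => tendsto_finsetSum _ fun j _ => e2 i j).const_mul _).sub e3
    have h1 := (Asymptotics.isLittleO_one_iff ℝ).2 (tendsto_sub_nhds_zero_iff.2 ht)
    simpa using (Asymptotics.isBigO_refl (fun s : ℝ => s ^ 2) (𝓝[>] 0)).mul_isLittleO h1
  refine (((e0.add f1).add f2).add eR).congr' ?_ (Eventually.of_forall fun _ => rfl)
  filter_upwards [Ioc_mem_nhdsGT hs₀] with s hs
  rw [split s hs.1.le hs.2, secondOrderCoeff, Finset.sum_sub_distrib, ← Finset.mul_sum]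
  ring

end Expansion

/-! ### Short-time expansion of the `α`-densities -/

section Alpha

variable {hbar m α : ℝ} {g : Coord d → Matrix (Fin d) (Fin d) ℝ} {U : Set (Coord d)}
  {V : Coord d → ℝ} {φ f : Coord d → ℝ} {x₀ : Coord d}

/-- The generator in non-divergence form. -/
lemma generator_eq (hb : hbar ≠ 0) (hU : IsOpen U) (hg : IsMetricOn g U) {x : Coord d}
    (hx : x ∈ U) (hφ : ContDiffOn ℝ 2 φ U) :
    generator hbar m g V φ x = hbar / (2 * m) * (∑ i, ∑ j, gInv g i j x * pd i (pd j φ) x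
      + ∑ j, divInv g j x * pd j φ x) - V x / hbar * φ x := by
  have hd : ∀ j, DifferentiableAt ℝ (pd j φ) x := fun j =>
    ((ContDiffOn.pd hφ hU (k := 1) (by norm_num) j).differentiableOn (by simp)).differentiableAt
      (hU.mem_nhds hx)
  have hsd : ∀ i j, DifferentiableAt ℝ (fun y => sqrtDet g y * gInv g i j y) x := fun i j =>
    (hg.differentiableAt_sqrtDet hU hx).mul (hg.differentiableAt_gInv hU hx i j)
  have h1 : ∀ i, pd i (fun y => sqrtDet g y * ∑ j, gInv g i j y * pd j φ y) x
      = ∑ j, (pd i (fun y => sqrtDet g y * gInv g i j y) x * pd j φ x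
        + sqrtDet g x * (gInv g i j x * pd i (pd j φ) x)) := by
    intro i
    have e : (fun y => sqrtDet g y * ∑ j, gInv g i j y * pd j φ y)
        = fun y => ∑ j, sqrtDet g y * gInv g i j y * pd j φ y := by
      funext y; simp only [Finset.mul_sum, mul_assoc]
    rw [e, pd_sum _ (f := fun j y => sqrtDet g y * gInv g i j y * pd j φ y)
      fun j _ => (hsd i j).mul (hd j)]
    refine Finset.sum_congr rfl fun j _ => ?_
    rw [pd_mul (hsd i j) (hd j), mul_assoc]
  have hs := (hg.sqrtDet_pos hx).ne'
  have h2 : ∑ i, pd i (fun y => sqrtDet g y * ∑ j, gInv g i j y * pd j φ y) x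
      = sqrtDet g x * (∑ i, ∑ j, gInv g i j x * pd i (pd j φ) x
        + ∑ j, divInv g j x * pd j φ x) := by
    simp only [h1, Finset.sum_add_distrib]
    rw [mul_add, add_comm]
    congr 1
    · simp only [Finset.mul_sum]
    · rw [Finset.sum_comm, Finset.mul_sum]
      refine Finset.sum_congr rfl fun j _ => ?_
      rw [← Finset.sum_mul, divInv]
      field_simp
  rw [generator, hamiltonian, h2]
  field_simp
  ring

lemma interp_add (α : ℝ) (x₀ h : Coord d) : interp α x₀ (x₀ + h) = x₀ + α • h := by
  simp [interp]

lemma add_smul_mem (hstar : StarConvex ℝ x₀ U) (hα : α ∈ Icc (0 : ℝ) 1) {h : Coord d}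
    (hh : x₀ + h ∈ U) : x₀ + α • h ∈ U := by
  have := hstar hh (a := 1 - α) (b := α) (by linarith [hα.2]) hα.1 (by ring)
  convert this using 1
  module

lemma contDiffOn_comp_affine (hstar : StarConvex ℝ x₀ U) (hα : α ∈ Icc (0 : ℝ) 1)
    (hf : ContDiffOn ℝ ∞ f U) :
    ContDiffOn ℝ ∞ (fun h => f (x₀ + α • h)) {h | x₀ + h ∈ U} :=
  hf.comp (by fun_prop) fun _ hh => add_smul_mem hstar hα hh

lemma IsMetricOn.comp_affine (hg : IsMetricOn g U) (hstar : StarConvex ℝ x₀ U)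
    (hα : α ∈ Icc (0 : ℝ) 1) : IsMetricOn (fun h => g (x₀ + α • h)) {h | x₀ + h ∈ U} where
  smooth i j := contDiffOn_comp_affine hstar hα (hg.smooth i j)
  posDef _ hh := hg.posDef _ (add_smul_mem hstar hα hh)

lemma isOpen_translate (hU : IsOpen U) : IsOpen {h : Coord d | x₀ + h ∈ U} :=
  hU.preimage (continuous_const.add continuous_id)

lemma tsupport_comp_add (φ : Coord d → ℝ) (x₀ : Coord d) :
    tsupport (fun h => φ (x₀ + h)) = {h | x₀ + h ∈ tsupport φ} :=
  tsupport_comp_eq_preimage φ (Homeomorph.addLeft x₀)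

lemma TestOn.translate (hφ : TestOn U φ) (x₀ : Coord d) :
    TestOn {h | x₀ + h ∈ tsupport φ} fun h => φ (x₀ + h) where
  smooth := hφ.smooth.comp (contDiff_const.add contDiff_id)
  compact := hφ.compact.comp_homeomorph (Homeomorph.addLeft x₀)
  subset := (tsupport_comp_add φ x₀).subset

/-- The derivative of a product of two functions evaluated at `x₀ + h` and `x₀ + αh`. -/
lemma pd_mul_comp_affine (hU : IsOpen U) (hstar : StarConvex ℝ x₀ U) (hα : α ∈ Icc (0 : ℝ) 1)
    (hφ : ContDiffOn ℝ ∞ φ U) (hf : ContDiffOn ℝ ∞ f U) {h : Coord d} (hh : x₀ + h ∈ U)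
    (k : Fin d) :
    pd k (fun h => φ (x₀ + h) * f (x₀ + α • h)) h
      = pd k φ (x₀ + h) * f (x₀ + α • h) + α * (φ (x₀ + h) * pd k f (x₀ + α • h)) := by
  have hd : ∀ {ψ : Coord d → ℝ}, ContDiffOn ℝ ∞ ψ U → ∀ {y}, y ∈ U → DifferentiableAt ℝ ψ y :=
    fun hψ y hy => (hψ.differentiableOn (by simp)).differentiableAt (hU.mem_nhds hy)
  have h1 := pd_comp_affine x₀ α (hd hf (add_smul_mem hstar hα hh)) k
  have h2 := pd_comp_affine x₀ 1 (x := h) (hd hφ (by simpa using hh)) k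
  simp only [one_smul, one_mul] at h2
  have d1 : DifferentiableAt ℝ (fun h => φ (x₀ + h)) h :=
    (hd hφ hh).comp h (by fun_prop)
  have d2 : DifferentiableAt ℝ (fun h => f (x₀ + α • h)) h :=
    (hd hf (add_smul_mem hstar hα hh)).comp h (by fun_prop)
  rw [pd_mul d1 d2, h1, h2]
  ring

/-- The second derivatives of a product of two functions evaluated at `x₀ + h` and `x₀ + αh`. -/
lemma pd_pd_mul_comp_affine (hU : IsOpen U) (hstar : StarConvex ℝ x₀ U) (hx₀ : x₀ ∈ U)
    (hα : α ∈ Icc (0 : ℝ) 1) (hφ : ContDiffOn ℝ ∞ φ U) (hf : ContDiffOn ℝ ∞ f U) (k l : Fin d) :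
    pd l (pd k fun h => φ (x₀ + h) * f (x₀ + α • h)) 0
      = pd l (pd k φ) x₀ * f x₀ + α * (pd k φ x₀ * pd l f x₀) + α * (pd l φ x₀ * pd k f x₀)
        + α ^ 2 * (φ x₀ * pd l (pd k f) x₀) := by
  have hW := isOpen_translate (x₀ := x₀) hU
  have h0 : (0 : Coord d) ∈ {h : Coord d | x₀ + h ∈ U} := by simpa using hx₀
  have hkφ := ContDiffOn.pd hφ hU (k := ∞) (by simp) k
  have hkf := ContDiffOn.pd hf hU (k := ∞) (by simp) k
  have e : pd k (fun h => φ (x₀ + h) * f (x₀ + α • h)) =ᶠ[𝓝 0]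
      fun h => pd k φ (x₀ + h) * f (x₀ + α • h) + α * (φ (x₀ + h) * pd k f (x₀ + α • h)) := by
    filter_upwards [hW.mem_nhds h0] with h hh
    exact pd_mul_comp_affine hU hstar hα hφ hf hh k
  have hd : ∀ {ψ ξ : Coord d → ℝ}, ContDiffOn ℝ ∞ ψ U → ContDiffOn ℝ ∞ ξ U →
      DifferentiableAt ℝ (fun h => ψ (x₀ + h) * ξ (x₀ + α • h)) 0 := fun hψ hξ => by
    have h1 : ContDiffOn ℝ ∞ (fun h => _) {h : Coord d | x₀ + h ∈ U} :=
      hψ.comp (by fun_prop : ContDiffOn ℝ ∞ (fun h : Coord d => x₀ + h) _) fun _ hh => hh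
    exact ((h1.mul (contDiffOn_comp_affine hstar hα hξ)).differentiableOn
      (by simp)).differentiableAt (hW.mem_nhds h0)
  rw [pd_congr e, pd_add (hd hkφ hf) ((hd hφ hkf).const_mul _), pd_const_mul (hd hφ hkf),
    pd_mul_comp_affine hU hstar hα hkφ hf h0, pd_mul_comp_affine hU hstar hα hφ hkf h0]
  simp only [add_zero, smul_zero]
  ring

lemma contDiffOn_alphaDrift (hU : IsOpen U) (hg : IsMetricOn g U) (α : ℝ) (i : Fin d) :
    ContDiffOn ℝ ∞ (alphaDrift α g i) U :=
  (contDiffOn_const.mul (hg.contDiffOn_divInv hU i)).sub (contDiffOn_const.mul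
    (ContDiffOn.sum fun k _ => ContDiffOn.pd (hg.contDiffOn_gInv i k) hU (by simp) k))

/-- The part of the action that does not come from completing the square, divided by `ħ t / m`. -/
noncomputable def alphaPotential (α hbar m : ℝ) (g : Coord d → Matrix (Fin d) (Fin d) ℝ)
    (V : Coord d → ℝ) (y : Coord d) : ℝ :=
  α / 2 * ∑ i, pd i (divInv g i) y - α ^ 2 / 2 * ∑ i, ∑ j, pd i (pd j (gInv g i j)) y
    + m / hbar ^ 2 * V y

lemma contDiffOn_alphaPotential (hU : IsOpen U) (hg : IsMetricOn g U) (hV : ContDiffOn ℝ ∞ V U) :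
    ContDiffOn ℝ ∞ (alphaPotential α hbar m g V) U :=
  ((contDiffOn_const.mul (ContDiffOn.sum fun i _ =>
    ContDiffOn.pd (hg.contDiffOn_divInv hU i) hU (by simp) i)).sub
    (contDiffOn_const.mul (ContDiffOn.sum fun i _ => ContDiffOn.sum fun j _ =>
      ContDiffOn.pd (ContDiffOn.pd (k := ∞) (hg.contDiffOn_gInv i j) hU (by simp) j) hU
        (by simp) i))).add (contDiffOn_const.mul hV)

/-- The drift with lowered index. -/
noncomputable def alphaCovector (α : ℝ) (g : Coord d → Matrix (Fin d) (Fin d) ℝ) (j : Fin d)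
    (y : Coord d) : ℝ :=
  ∑ i, alphaDrift α g i y * g y i j

lemma contDiffOn_alphaCovector (hU : IsOpen U) (hg : IsMetricOn g U) (α : ℝ) (j : Fin d) :
    ContDiffOn ℝ ∞ (alphaCovector α g j) U :=
  ContDiffOn.sum fun i _ => (contDiffOn_alphaDrift hU hg α i).mul (hg.smooth i j)

/-- In the variable `z = (x - x₀)/s` with `s² = ħt/m`, the action splits into a Gaussian part and
a drift part, which is small with `s`. -/
lemma alphaAction_scaled (hb : hbar ≠ 0) (hm : m ≠ 0) {s : ℝ} (hs : s ≠ 0) (z : Coord d)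
    (hsymm : ∀ i j, g (x₀ + α • s • z) i j = g (x₀ + α • s • z) j i) :
    alphaAction α hbar m g V x₀ (s ^ 2 * m / hbar) (x₀ + s • z)
      = 1 / 2 * quadForm (g (x₀ + α • s • z)) z
        - (s * (∑ j, alphaCovector α g j (x₀ + α • s • z) * z j)
        - s ^ 2 * (1 / 2 * (∑ j, alphaCovector α g j (x₀ + α • s • z)
            * alphaDrift α g j (x₀ + α • s • z))
          + alphaPotential α hbar m g V (x₀ + α • s • z))) := by
  have ht : hbar * (s ^ 2 * m / hbar) / m = s ^ 2 := by field_simp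
  have ht2 : 2 * hbar * (s ^ 2 * m / hbar) / m = 2 * s ^ 2 := by field_simp
  rw [alphaAction, interp_add, ht, ht2]
  set y := x₀ + α • s • z with hy
  set b : Fin d → ℝ := fun i => alphaDrift α g i y with hbdef
  have h1 : ∑ i, ∑ j, ((x₀ + s • z) i - x₀ i - s ^ 2 * alphaDrift α g i y) *
        (g y i j / (2 * s ^ 2)) * ((x₀ + s • z) j - x₀ j - s ^ 2 * alphaDrift α g j y)
      = 1 / 2 * ∑ i, ∑ j, z i * g y i j * z j - s / 2 * ∑ i, ∑ j, z i * g y i j * b j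
        - s / 2 * ∑ i, ∑ j, b i * g y i j * z j + s ^ 2 / 2 * ∑ i, ∑ j, b i * g y i j * b j := by
    simp only [Finset.mul_sum, ← Finset.sum_sub_distrib, ← Finset.sum_add_distrib]
    refine Finset.sum_congr rfl fun i _ => Finset.sum_congr rfl fun j _ => ?_
    simp only [Pi.add_apply, Pi.smul_apply, smul_eq_mul, hbdef]
    field_simp
    ring
  have h2 : ∑ i, ∑ j, z i * g y i j * b j = ∑ i, ∑ j, b i * g y i j * z j := by
    rw [Finset.sum_comm]
    refine Finset.sum_congr rfl fun i _ => Finset.sum_congr rfl fun j _ => ?_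
    rw [hsymm j i]; ring
  have h3 : ∀ w : Fin d → ℝ, ∑ j, alphaCovector α g j y * w j = ∑ i, ∑ j, b i * g y i j * w j := by
    intro w
    rw [Finset.sum_comm]
    refine Finset.sum_congr rfl fun j _ => ?_
    rw [alphaCovector, Finset.sum_mul]
  rw [h1, h2, h3 z, h3 (fun j => alphaDrift α g j y), quadForm, alphaPotential]
  simp only [hbdef]
  field_simp
  ring

/-- The second-order coefficient of the `α`-density tested against `φ` does not depend on `α`. The
factor `√g(x_α)` cancels the mass of the Gaussian, so the coefficient is
`½ ∂_k∂_l (φ(x₀ + h) g^{kl}(x₀ + αh)) + ∂_k (φ(x₀ + h) b^k(x₀ + αh)) - φ(x₀) c(x₀)` at `h = 0`, with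
`b` the drift and `c` the potential of the action; the terms of order `α` and `α²` cancel. -/
lemma secondOrderCoeff_alpha (hb : hbar ≠ 0) (hm : m ≠ 0) (hU : IsOpen U) (hg : IsMetricOn g U)
    (hx₀ : x₀ ∈ U) (hstar : StarConvex ℝ x₀ U) (hα : α ∈ Icc (0 : ℝ) 1)
    (hφ : ContDiffOn ℝ ∞ φ U) :
    secondOrderCoeff (fun h => g (x₀ + α • h))
      (fun h => φ (x₀ + h) * (sqrtDet g (x₀ + α • h) / (2 * Real.pi) ^ ((d : ℝ) / 2)))
      (fun j h => alphaCovector α g j (x₀ + α • h))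
      (fun h => 1 / 2 * (∑ j, alphaCovector α g j (x₀ + α • h) * alphaDrift α g j (x₀ + α • h))
          + alphaPotential α hbar m g V (x₀ + α • h))
      = m / hbar * generator hbar m g V φ x₀ := by
  set A : Coord d → Matrix (Fin d) (Fin d) ℝ := fun h => g (x₀ + α • h) with hAdef
  set a : Coord d → ℝ :=
    fun h => φ (x₀ + h) * (sqrtDet g (x₀ + α • h) / (2 * Real.pi) ^ ((d : ℝ) / 2)) with hadef
  have hA : IsMetricOn A {h | x₀ + h ∈ U} := hg.comp_affine hstar hα
  have hW := isOpen_translate (x₀ := x₀) hU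
  have h0 : (0 : Coord d) ∈ {h : Coord d | x₀ + h ∈ U} := by simpa using hx₀
  have hmass : ∀ h ∈ {h : Coord d | x₀ + h ∈ U}, a h * gaussMass A h = φ (x₀ + h) := by
    intro h hh
    have h1 : sqrtDet g (x₀ + α • h) ≠ 0 := (hA.sqrtDet_pos hh).ne'
    have h2 : (2 * Real.pi) ^ ((d : ℝ) / 2) ≠ 0 := by positivity
    simp only [hadef, gaussMass]
    change _ * (_ / sqrtDet g (x₀ + α • h)) = _
    field_simp
  have hdrift : ∀ y ∈ U, ∀ k, ∑ j, alphaCovector α g j y * gInv g k j y = alphaDrift α g k y := by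
    intro y hy k
    simp only [alphaCovector, Finset.sum_mul]
    rw [Finset.sum_comm]
    have : ∀ i, ∑ j, alphaDrift α g i y * g y i j * gInv g k j y
        = alphaDrift α g i y * if i = k then 1 else 0 := fun i => by
      rw [← hg.sum_mul_gInv hy i k, Finset.mul_sum]
      refine Finset.sum_congr rfl fun j _ => ?_
      rw [hg.gInv_symm hy k j]; ring
    simp [this]
  have e1 : ∀ k l, pd l (pd k fun h => a h * (gInv A k l h * gaussMass A h)) 0
      = pd l (pd k φ) x₀ * gInv g k l x₀ + α * (pd k φ x₀ * pd l (gInv g k l) x₀)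
        + α * (pd l φ x₀ * pd k (gInv g k l) x₀)
        + α ^ 2 * (φ x₀ * pd l (pd k (gInv g k l)) x₀) := by
    intro k l
    rw [← pd_pd_mul_comp_affine hU hstar hx₀ hα hφ (hg.contDiffOn_gInv k l) k l]
    refine pd_congr ?_ l
    filter_upwards [hW.mem_nhds h0] with h hh
    refine pd_congr ?_ k
    filter_upwards [hW.mem_nhds hh] with h' hh'
    rw [← hmass h' hh']
    change _ * (gInv g k l (x₀ + α • h') * _) = _
    ring
  have e2 : ∑ j, ∑ k, pd k (fun h => a h * alphaCovector α g j (x₀ + α • h)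
        * (gInv A k j h * gaussMass A h)) 0
      = ∑ k, (pd k φ x₀ * alphaDrift α g k x₀ + α * (φ x₀ * pd k (alphaDrift α g k) x₀)) := by
    rw [Finset.sum_comm]
    refine Finset.sum_congr rfl fun k _ => ?_
    have hcov := contDiffOn_alphaCovector hU hg α
    have hd : ∀ j, DifferentiableAt ℝ (fun h => a h * alphaCovector α g j (x₀ + α • h)
        * (gInv A k j h * gaussMass A h)) 0 := fun j => by
      have hφ' : ContDiffOn ℝ ∞ (fun h => φ (x₀ + h)) {h : Coord d | x₀ + h ∈ U} :=
        hφ.comp (by fun_prop) fun _ hh => hh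
      have := ((hφ'.mul (hA.contDiffOn_sqrtDet.div_const ((2 * Real.pi) ^ ((d : ℝ) / 2)))).mul
        (contDiffOn_comp_affine hstar hα (hcov j))).mul
          ((hA.contDiffOn_gInv k j).mul (contDiffOn_gaussMass hA))
      exact (this.differentiableOn (by simp)).differentiableAt (hW.mem_nhds h0)
    rw [← pd_sum _ fun j _ => hd j]
    have := pd_mul_comp_affine hU hstar hα hφ (contDiffOn_alphaDrift hU hg α k) h0 k
    simp only [add_zero, smul_zero] at this
    rw [← this]
    refine pd_congr ?_ k
    filter_upwards [hW.mem_nhds h0] with h hh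
    rw [← hdrift _ (add_smul_mem hstar hα hh) k, ← hmass h hh, Finset.mul_sum]
    refine Finset.sum_congr rfl fun j _ => ?_
    change _ * (gInv g k j (x₀ + α • h) * _) = _
    ring
  have hm0 := hmass 0 h0
  have e3 : ∑ i, ∑ j, a 0 * (alphaCovector α g i (x₀ + α • 0) * alphaCovector α g j (x₀ + α • 0))
        * (gInv A i j 0 * gaussMass A 0)
      = φ x₀ * ∑ i, alphaCovector α g i x₀ * alphaDrift α g i x₀ := by
    simp only [← hdrift x₀ hx₀, Finset.mul_sum]
    refine Finset.sum_congr rfl fun i _ => Finset.sum_congr rfl fun j _ => ?_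
    have : gInv A i j 0 = gInv g i j x₀ := by simp [hAdef, gInv]
    rw [add_zero] at hm0
    rw [← hm0, this]
    simp only [smul_zero, add_zero]
    ring
  -- the derivatives of the drift
  have hdi : ∀ k, DifferentiableAt ℝ (divInv g k) x₀ := fun k =>
    ((hg.contDiffOn_divInv hU k).differentiableOn (by simp)).differentiableAt (hU.mem_nhds hx₀)
  have hdg : ∀ k j, DifferentiableAt ℝ (pd j (gInv g k j)) x₀ := fun k j =>
    ((ContDiffOn.pd (hg.contDiffOn_gInv k j) hU (k := ∞) (by simp) j).differentiableOn
      (by simp)).differentiableAt (hU.mem_nhds hx₀)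
  have hpdrift : ∀ k, pd k (alphaDrift α g k) x₀
      = 1 / 2 * pd k (divInv g k) x₀ - α * ∑ j, pd k (pd j (gInv g k j)) x₀ := fun k => by
    unfold alphaDrift
    rw [pd_sub ((hdi k).const_mul _) ((DifferentiableAt.fun_sum fun j _ => hdg k j).const_mul _),
      pd_const_mul (hdi k), pd_const_mul (DifferentiableAt.fun_sum fun j _ => hdg k j),
      pd_sum _ fun j _ => hdg k j]
  -- symmetry of the inverse metric, in the three sums in which it is needed
  have s1 : ∑ k, ∑ l, pd l (pd k φ) x₀ * gInv g k l x₀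
      = ∑ i, ∑ j, gInv g i j x₀ * pd i (pd j φ) x₀ := by
    rw [Finset.sum_comm]
    refine Finset.sum_congr rfl fun i _ => Finset.sum_congr rfl fun j _ => ?_
    rw [hg.gInv_symm hx₀ j i]; ring
  have hsymm : ∀ k l, gInv g k l =ᶠ[𝓝 x₀] gInv g l k := fun k l => by
    filter_upwards [hU.mem_nhds hx₀] with y hy using hg.gInv_symm hy k l
  have s2 : ∑ k, ∑ l, pd l φ x₀ * pd k (gInv g k l) x₀
      = ∑ k, ∑ l, pd k φ x₀ * pd l (gInv g k l) x₀ := by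
    rw [Finset.sum_comm]
    refine Finset.sum_congr rfl fun i _ => Finset.sum_congr rfl fun j _ => ?_
    rw [pd_congr (hsymm j i)]
  have s3 : ∑ k, ∑ l, pd l (pd k (gInv g k l)) x₀ = ∑ k, ∑ l, pd k (pd l (gInv g k l)) x₀ := by
    rw [Finset.sum_comm]
    refine Finset.sum_congr rfl fun i _ => Finset.sum_congr rfl fun j _ => ?_
    refine pd_congr ?_ i
    filter_upwards [eventually_eventually_nhds.2 (hsymm j i)] with y hy
    exact pd_congr hy j
  rw [secondOrderCoeff, e2, e3, generator_eq hb hU hg hx₀ (hφ.of_le ENat.LEInfty.out)]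
  simp only [e1, hpdrift, Finset.sum_add_distrib, ← Finset.mul_sum, alphaDrift, alphaPotential]
  have hm1 : a 0 * gaussMass A 0 = φ x₀ := by simpa using hm0
  have e4 : ∀ r : ℝ, a 0 * r * gaussMass A 0 = φ x₀ * r := fun r => by rw [← hm1]; ring
  rw [e4, s1, s2, s3]
  simp only [smul_zero, add_zero, mul_sub, Finset.sum_sub_distrib]
  have s4 : ∑ k, pd k φ x₀ * (1 / 2 * divInv g k x₀) = 1 / 2 * ∑ j, divInv g j x₀ * pd j φ x₀ := by
    rw [Finset.mul_sum]
    exact Finset.sum_congr rfl fun k _ => by ring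
  have s5 : ∑ k, pd k φ x₀ * (α * ∑ l, pd l (gInv g k l) x₀)
      = α * ∑ k, ∑ l, pd k φ x₀ * pd l (gInv g k l) x₀ := by
    rw [Finset.mul_sum]
    refine Finset.sum_congr rfl fun k _ => ?_
    rw [← Finset.mul_sum]; ring
  simp only [s4, s5, ← Finset.mul_sum]
  field_simp
  ring

end Alpha

section AlphaDensity

variable {hbar m α : ℝ} {g : Coord d → Matrix (Fin d) (Fin d) ℝ} {U : Set (Coord d)}
  {V : Coord d → ℝ} {φ : Coord d → ℝ} {x₀ : Coord d}

lemma integral_eq_integral_scaled (f : Coord d → ℝ) (x₀ : Coord d) {s : ℝ} (hs : 0 < s) :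
    ∫ x, f x = ∫ z, s ^ d * f (x₀ + s • z) := by
  have h1 : ∫ x, f (x₀ + x) = ∫ x, f x := integral_add_left_eq_self f x₀
  have h2 := Measure.integral_comp_smul volume (fun x => f (x₀ + x)) s
  rw [Module.finrank_fin_fun, abs_of_nonneg (by positivity), h1, smul_eq_mul] at h2
  rw [integral_const_mul, h2, ← mul_assoc, mul_inv_cancel₀ (by positivity), one_mul]

lemma integrable_of_integrable_scaled {f : Coord d → ℝ} (x₀ : Coord d) {s : ℝ} (hs : s ≠ 0)
    (h : Integrable fun z => f (x₀ + s • z)) : Integrable f := by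
  have h1 := (integrable_comp_smul_iff volume (fun x => f (x₀ + x)) hs).1 h
  have h2 := h1.comp_add_left (-x₀)
  simpa using h2

lemma scaled_time (hb : 0 < hbar) (hm : 0 < m) {t : ℝ} (ht : 0 < t) :
    √(hbar * t / m) ^ 2 * m / hbar = t := by
  rw [Real.sq_sqrt (by positivity)]
  field_simp

/-- The density in the scaled variable, normalized by the Jacobian of the scaling. -/
lemma scaled_alphaDensity (hb : hbar ≠ 0) (hm : m ≠ 0) {s : ℝ} (hs : 0 < s) (z : Coord d) :
    s ^ d * alphaDensity α hbar m g V x₀ (s ^ 2 * m / hbar) (x₀ + s • z)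
      = sqrtDet g (x₀ + α • s • z) / (2 * Real.pi) ^ ((d : ℝ) / 2)
        * Real.exp (-alphaAction α hbar m g V x₀ (s ^ 2 * m / hbar) (x₀ + s • z)) := by
  have h1 : 2 * Real.pi * hbar * (s ^ 2 * m / hbar) / m = 2 * Real.pi * s ^ 2 := by field_simp
  have h2 : (s ^ 2) ^ ((d : ℝ) / 2) = s ^ d := by
    rw [← Real.rpow_natCast s 2, ← Real.rpow_mul hs.le, ← Real.rpow_natCast s d]
    congr 1
    push_cast
    ring
  rw [alphaDensity, interp_add, h1, Real.mul_rpow (by positivity) (by positivity), h2]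
  have : (2 * Real.pi) ^ ((d : ℝ) / 2) ≠ 0 := by positivity
  field_simp

lemma continuousOn_alphaDensity (hU : IsOpen U) (hg : IsMetricOn g U) (hV : ContDiffOn ℝ ∞ V U)
    (hstar : StarConvex ℝ x₀ U) (hα : α ∈ Icc (0 : ℝ) 1) (t : ℝ) :
    ContinuousOn (alphaDensity α hbar m g V x₀ t) U := by
  have hi : Continuous (interp α x₀) := by unfold interp; fun_prop
  have hmaps : MapsTo (interp α x₀) U U := fun x hx => by
    have := add_smul_mem (x₀ := x₀) (h := x - x₀) hstar hα (by simpa using hx)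
    exact this
  have hc : ∀ {f : Coord d → ℝ}, ContDiffOn ℝ ∞ f U → ContinuousOn (fun x => f (interp α x₀ x)) U :=
    fun hf => hf.continuousOn.comp hi.continuousOn hmaps
  have hb' := fun i => hc (contDiffOn_alphaDrift hU hg α i)
  unfold alphaDensity alphaAction
  refine ((hc hg.contDiffOn_sqrtDet).div_const _).mul (ContinuousOn.rexp (ContinuousOn.neg ?_))
  refine (ContinuousOn.sub (ContinuousOn.add ?_ (continuousOn_const.mul ?_))
    (continuousOn_const.mul ?_)).add (continuousOn_const.mul (hc hV))
  · refine continuousOn_finsetSum _ fun i _ => continuousOn_finsetSum _ fun j _ => ?_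
    exact ((ContinuousOn.sub (by fun_prop) (continuousOn_const.mul (hb' i))).mul
      ((hc (hg.smooth i j)).div_const _)).mul
        (ContinuousOn.sub (by fun_prop) (continuousOn_const.mul (hb' j)))
  · exact continuousOn_finsetSum _ fun i _ =>
      hc (ContDiffOn.pd (hg.contDiffOn_divInv hU i) hU (by simp) i)
  · exact continuousOn_finsetSum _ fun i _ => continuousOn_finsetSum _ fun j _ =>
      hc (ContDiffOn.pd (ContDiffOn.pd (k := ∞) (hg.contDiffOn_gInv i j) hU (by simp) j) hU
        (by simp) i)

lemma tendsto_sqrt_scaled_time (hb : 0 < hbar) (hm : 0 < m) :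
    Tendsto (fun t => √(hbar * t / m)) (𝓝[>] 0) (𝓝[>] 0) := by
  refine tendsto_nhdsWithin_iff.2 ⟨?_, ?_⟩
  · have hc : Continuous fun t => √(hbar * t / m) := by fun_prop
    have := hc.tendsto 0
    simp only [mul_zero, zero_div, Real.sqrt_zero] at this
    exact this.mono_left nhdsWithin_le_nhds
  · filter_upwards [self_mem_nhdsWithin] with t ht
    have : 0 < t := ht
    exact Real.sqrt_pos.2 (by positivity)

/-- The `α`-density satisfies the same weak short-time expansion as a Green's function. In the
variable `z = (x - x₀)/s` with `s² = ħt/m` this is the Laplace expansion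
`integral_gaussian_drift_expansion`. -/
theorem hasShortTimeExpansion_alphaDensity (hb : 0 < hbar) (hm : 0 < m) (hU : IsOpen U)
    (hg : IsMetricOn g U) (hV : ContDiffOn ℝ ∞ V U) (hx₀ : x₀ ∈ U) (hstar : StarConvex ℝ x₀ U)
    (hα : α ∈ Icc (0 : ℝ) 1) :
    HasShortTimeExpansion hbar m g V U x₀ (alphaDensity α hbar m g V x₀) := by
  intro φ hφ
  set A : Coord d → Matrix (Fin d) (Fin d) ℝ := fun h => g (x₀ + α • h) with hAdef
  set a : Coord d → ℝ :=
    fun h => φ (x₀ + h) * (sqrtDet g (x₀ + α • h) / (2 * Real.pi) ^ ((d : ℝ) / 2)) with hadef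
  set β : Fin d → Coord d → ℝ := fun j h => alphaCovector α g j (x₀ + α • h) with hβdef
  set γ : Coord d → ℝ := fun h =>
    1 / 2 * (∑ j, alphaCovector α g j (x₀ + α • h) * alphaDrift α g j (x₀ + α • h))
      + alphaPotential α hbar m g V (x₀ + α • h) with hγdef
  have hW := isOpen_translate (x₀ := x₀) hU
  have hA : IsMetricOn A {h | x₀ + h ∈ U} := hg.comp_affine hstar hα
  have hKW : {h | x₀ + h ∈ tsupport φ} ⊆ {h | x₀ + h ∈ U} := fun h hh => hφ.subset hh
  have hK : IsCompact {h | x₀ + h ∈ tsupport φ} := by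
    rw [← tsupport_comp_add]
    exact (hφ.translate x₀).compact
  have ha : TestOn {h | x₀ + h ∈ tsupport φ} a :=
    (hφ.translate x₀).mul_smoothOn hW hKW (hA.contDiffOn_sqrtDet.div_const _)
  have hcov := contDiffOn_alphaCovector hU hg α
  have hβ : ∀ j, ContDiffOn ℝ ∞ (β j) {h | x₀ + h ∈ U} := fun j =>
    contDiffOn_comp_affine hstar hα (hcov j)
  have hγ : ContDiffOn ℝ ∞ γ {h | x₀ + h ∈ U} :=
    contDiffOn_comp_affine (f := fun y => 1 / 2 * (∑ j, alphaCovector α g j y * alphaDrift α g j y)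
      + alphaPotential α hbar m g V y) hstar hα
      ((contDiffOn_const.mul (ContDiffOn.sum fun j _ =>
        (hcov j).mul (contDiffOn_alphaDrift hU hg α j))).add (contDiffOn_alphaPotential hU hg hV))
  have key := integral_gaussian_drift_expansion hW hK hKW hA ha hβ hγ
  rw [secondOrderCoeff_alpha hb.ne' hm.ne' hU hg hx₀ hstar hα hφ.smooth.contDiffOn] at key
  have hmass : a 0 * gaussMass A 0 = φ x₀ := by
    have h1 : sqrtDet g x₀ ≠ 0 := (hg.sqrtDet_pos hx₀).ne'
    have h2 : (2 * Real.pi) ^ ((d : ℝ) / 2) ≠ 0 := by positivity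
    have h3 : sqrtDet A 0 = sqrtDet g x₀ := by simp [hAdef, sqrtDet]
    simp only [hadef, gaussMass, h3, smul_zero, add_zero]
    field_simp
  rw [hmass] at key
  have hint : ∀ s > 0, ∫ z, gaussFam A a (s • z) z
      * Real.exp (s * ∑ j, β j (s • z) * z j - s ^ 2 * γ (s • z))
      = ∫ x, φ x * alphaDensity α hbar m g V x₀ (s ^ 2 * m / hbar) x := by
    intro s hs
    rw [integral_eq_integral_scaled
      (fun x => φ x * alphaDensity α hbar m g V x₀ (s ^ 2 * m / hbar) x) x₀ hs]
    refine integral_congr_ae (Eventually.of_forall fun z => ?_)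
    by_cases hz : x₀ + s • z ∈ U
    · have hy := add_smul_mem hstar hα hz
      simp only []
      rw [mul_left_comm, scaled_alphaDensity hb.ne' hm.ne' hs,
        alphaAction_scaled hb.ne' hm.ne' hs.ne' z fun i j => hg.symm hy i j]
      simp only [gaussFam, hAdef, hadef, hβdef, hγdef]
      rw [neg_sub, sub_eq_add_neg _ (1 / 2 * _), Real.exp_add, ← neg_mul]
      ring
    · simp [gaussFam, hadef, hφ.eq_zero hz]
  have h2 := key.comp_tendsto (tendsto_sqrt_scaled_time hb hm)
  have h3 : (fun t : ℝ => (∫ x, φ x * alphaDensity α hbar m g V x₀ t x) - φ x₀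
      - t * generator hbar m g V φ x₀) =o[𝓝[>] 0] fun t : ℝ => hbar / m * t := by
    refine h2.congr' ?_ ?_
    · filter_upwards [self_mem_nhdsWithin] with t ht
      have ht' : 0 < t := ht
      have hs : 0 < √(hbar * t / m) := Real.sqrt_pos.2 (by positivity)
      simp only [Function.comp_apply]
      rw [hint _ hs, scaled_time hb hm ht', Real.sq_sqrt (by positivity)]
      field_simp
    · filter_upwards [self_mem_nhdsWithin] with t ht
      have ht' : 0 < t := ht
      simp only [Function.comp_apply]
      rw [Real.sq_sqrt (by positivity)]
      ring
  exact (Asymptotics.isLittleO_const_mul_right_iff (by positivity)).1 h3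

lemma alphaAction_zero (t : ℝ) (x : Coord d) :
    alphaAction 0 hbar m g V x₀ t x = gaussAction hbar m g V x₀ t x := by
  have h1 : interp 0 x₀ x = x₀ := by simp [interp]
  have h2 : ∀ i, hbar * t / m * alphaDrift 0 g i x₀ = hbar * t / (2 * m) * divInv g i x₀ :=
    fun i => by
      rw [alphaDrift, zero_mul, sub_zero, ← mul_assoc]
      congr 1
      rw [mul_comm 2 m, ← div_div]
      ring
  simp only [alphaAction, gaussAction, h1, h2]
  simp

lemma gaussAction_eq (hU : IsOpen U) (hg : IsMetricOn g U) (hx₀ : x₀ ∈ U) (t : ℝ) (x : Coord d) :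
    gaussAction hbar m g V x₀ t x = gaussActionChristoffel hbar m g V x₀ t x := by
  simp only [gaussAction, gaussActionChristoffel, hg.contractedChristoffel_eq hU hx₀, mul_neg,
    ← sub_eq_add_neg]

lemma gaussDensity_eq (hU : IsOpen U) (hg : IsMetricOn g U) (hx₀ : x₀ ∈ U) :
    gaussDensity hbar m g V x₀ = alphaDensity 0 hbar m g V x₀ := by
  funext t x
  have h1 : interp 0 x₀ x = x₀ := by simp [interp]
  rw [gaussDensity, alphaDensity, h1, alphaAction_zero, gaussAction_eq hU hg hx₀]

end AlphaDensity

/-! ### From expansions to moments -/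

section Moments

variable {hbar m : ℝ} {g : Coord d → Matrix (Fin d) (Fin d) ℝ} {U : Set (Coord d)}
  {V : Coord d → ℝ} {χ : Coord d → ℝ} {x₀ : Coord d} {ρ σ : ℝ → Coord d → ℝ}

lemma contDiff_monomial {n : WithTop ℕ∞} (x₀ : Coord d) {M : ℕ} (I : Fin M → Fin d) :
    ContDiff ℝ n fun x : Coord d => ∏ k, (x (I k) - x₀ (I k)) :=
  contDiff_prod fun k _ => by fun_prop

/-- Two continuous families with the same short-time expansion have the same localized moments
up to `o(t)`. -/
theorem HasShortTimeExpansion.momentsAgree (hU : IsOpen U)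
    (hρ : HasShortTimeExpansion hbar m g V U x₀ ρ) (hσ : HasShortTimeExpansion hbar m g V U x₀ σ)
    (hρc : ∀ t > 0, ContinuousOn (ρ t) U) (hσc : ∀ t > 0, ContinuousOn (σ t) U)
    (hχ : TestOn U χ) : MomentsAgree χ x₀ ρ σ := by
  intro M I
  have hφ : TestOn U fun x => χ x * ∏ k, (x (I k) - x₀ (I k)) :=
    hχ.mul_smoothOn hU subset_rfl (contDiff_monomial x₀ I).contDiffOn
  refine ⟨?_, ?_⟩
  · filter_upwards [self_mem_nhdsWithin] with t ht
    exact ⟨hφ.integrable_mul hU (hρc t ht), hφ.integrable_mul hU (hσc t ht)⟩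
  · refine ((hρ _ hφ).sub (hσ _ hφ)).congr (fun t => ?_) fun _ => rfl
    simp only [momentIntegrand]
    ring

/-- A nonnegative continuous family `ρ` is concentrated at `x₀` if its moments weighted by
`|x - x₀|⁴` are `O(t²)`. -/
structure Concentrates (x₀ : Coord d) (ρ : ℝ → Coord d → ℝ) : Prop where
  continuous : ∀ t > 0, Continuous (ρ t)
  nonneg : ∀ t > 0, ∀ x, 0 ≤ ρ t x
  tail : ∀ n : ℕ, ∃ C : ℝ, ∀ᶠ t in 𝓝[>] (0 : ℝ),
    Integrable (fun x => sqNorm (x - x₀) ^ 2 * (1 + sqNorm (x - x₀)) ^ n * ρ t x) ∧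
      ∫ x, sqNorm (x - x₀) ^ 2 * (1 + sqNorm (x - x₀)) ^ n * ρ t x ≤ C * t ^ 2

lemma abs_monomial_le (x₀ x : Coord d) {M : ℕ} (I : Fin M → Fin d) :
    |∏ k, (x (I k) - x₀ (I k))| ≤ (1 + sqNorm (x - x₀)) ^ M := by
  rw [Finset.abs_prod]
  calc ∏ k, |x (I k) - x₀ (I k)| ≤ ∏ _k : Fin M, (1 + sqNorm (x - x₀)) :=
        Finset.prod_le_prod (fun _ _ => abs_nonneg _) fun k _ =>
          abs_le_one_add_sqNorm (x - x₀) (I k)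
    _ = _ := by simp

/-- A function vanishing near `x₀` and bounded by one is at most `C |x - x₀|⁴`. -/
lemma exists_le_sqNorm_sq {η : Coord d → ℝ} (h0 : η =ᶠ[𝓝 x₀] fun _ => 0) (h1 : ∀ x, |η x| ≤ 1) :
    ∃ C, 0 ≤ C ∧ ∀ x, |η x| ≤ C * sqNorm (x - x₀) ^ 2 := by
  obtain ⟨r, hr, hball⟩ := Metric.eventually_nhds_iff.1 h0
  refine ⟨1 / r ^ 4, by positivity, fun x => ?_⟩
  by_cases hx : dist x x₀ < r
  · rw [hball hx, abs_zero]; positivity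
  · refine (h1 x).trans ?_
    have h2 : r ^ 2 ≤ sqNorm (x - x₀) := by
      by_contra! hlt
      refine hx ((dist_pi_lt_iff hr).2 fun i => ?_)
      rw [Real.dist_eq]
      refine lt_of_pow_lt_pow_left₀ 2 hr.le ?_
      rw [sq_abs]
      exact (sq_le_sqNorm (x - x₀) i).trans_lt hlt
    rw [div_mul_eq_mul_div, one_mul, le_div_iff₀ (by positivity), one_mul]
    calc r ^ 4 = (r ^ 2) ^ 2 := by ring
      _ ≤ _ := by gcongr

/-- Moments weighted by a bounded function vanishing near `x₀` are `o(t)`. -/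
lemma Concentrates.tail_isLittleO (hρ : Concentrates x₀ ρ) {η : Coord d → ℝ}
    (hη : Continuous η) (h0 : η =ᶠ[𝓝 x₀] fun _ => 0) (h1 : ∀ x, |η x| ≤ 1) {M : ℕ}
    (I : Fin M → Fin d) :
    (∀ᶠ t in 𝓝[>] (0 : ℝ), Integrable (momentIntegrand η x₀ (ρ t) I)) ∧
      (fun t => ∫ x, momentIntegrand η x₀ (ρ t) I x) =o[𝓝[>] 0] fun t : ℝ => t := by
  obtain ⟨C, hC0, hC⟩ := exists_le_sqNorm_sq h0 h1
  obtain ⟨D, hD⟩ := hρ.tail M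
  have hdom : ∀ t > 0, ∀ x, ‖momentIntegrand η x₀ (ρ t) I x‖
      ≤ C * (sqNorm (x - x₀) ^ 2 * (1 + sqNorm (x - x₀)) ^ M * ρ t x) := by
    intro t ht x
    have h3 := hρ.nonneg t ht x
    have h4 := sqNorm_nonneg (x - x₀)
    rw [momentIntegrand, norm_mul, norm_mul, Real.norm_of_nonneg h3, Real.norm_eq_abs,
      Real.norm_eq_abs]
    calc |η x| * |∏ k, (x (I k) - x₀ (I k))| * ρ t x
        ≤ C * sqNorm (x - x₀) ^ 2 * (1 + sqNorm (x - x₀)) ^ M * ρ t x := by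
          gcongr
          · exact hC x
          · exact abs_monomial_le x₀ x I
      _ = _ := by ring
  refine ⟨?_, ?_⟩
  · filter_upwards [hD, self_mem_nhdsWithin] with t ht ht0
    refine (ht.1.const_mul C).mono' ?_ (Eventually.of_forall (hdom t ht0))
    exact ((hη.mul (contDiff_monomial (n := 0) x₀ I).continuous).mul
      (hρ.continuous t ht0)).aestronglyMeasurable
  · have hO : (fun t => ∫ x, momentIntegrand η x₀ (ρ t) I x) =O[𝓝[>] 0] fun t : ℝ => t ^ 2 := by
      refine Asymptotics.IsBigO.of_bound (C * D) ?_
      filter_upwards [hD, self_mem_nhdsWithin] with t ht ht0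
      refine (norm_integral_le_of_norm_le (ht.1.const_mul C)
        (Eventually.of_forall (hdom t ht0))).trans ?_
      rw [integral_const_mul, Real.norm_of_nonneg (by positivity), mul_assoc]
      exact mul_le_mul_of_nonneg_left ht.2 hC0
    refine hO.trans_isLittleO ?_
    have : (fun t : ℝ => t ^ 2) =o[𝓝 0] fun t : ℝ => t ^ 1 :=
      Asymptotics.isLittleO_pow_pow (by norm_num)
    simp only [pow_one] at this
    exact this.mono nhdsWithin_le_nhds

/-- Two concentrated families with the same short-time expansion have the same moments up to
`o(t)`. -/
theorem HasShortTimeExpansion.momentsAgree_one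
    (hρ : HasShortTimeExpansion hbar m g V univ x₀ ρ)
    (hσ : HasShortTimeExpansion hbar m g V univ x₀ σ)
    (hρc : Concentrates x₀ ρ) (hσc : Concentrates x₀ σ) :
    MomentsAgree (fun _ => 1) x₀ ρ σ := by
  let χ : ContDiffBump x₀ := ⟨1, 2, one_pos, one_lt_two⟩
  have hχ : TestOn univ χ := ⟨χ.contDiff, χ.hasCompactSupport, subset_univ _⟩
  have hloc := hρ.momentsAgree isOpen_univ hσ (fun t ht => (hρc.continuous t ht).continuousOn)
    (fun t ht => (hσc.continuous t ht).continuousOn) hχ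
  set η : Coord d → ℝ := fun x => 1 - χ x with hηdef
  have hη : Continuous η := continuous_const.sub χ.continuous
  have h0 : η =ᶠ[𝓝 x₀] fun _ => 0 := by
    filter_upwards [χ.eventuallyEq_one] with x hx
    simp [hηdef, hx]
  have h1 : ∀ x, |η x| ≤ 1 := fun x => by
    rw [abs_le]
    constructor <;> simp only [hηdef] <;> linarith [χ.nonneg (x := x), χ.le_one (x := x)]
  have hsplit : ∀ (τ : Coord d → ℝ) {M : ℕ} (I : Fin M → Fin d),
      momentIntegrand (fun _ => 1) x₀ τ I
        = fun x => momentIntegrand χ x₀ τ I x + momentIntegrand η x₀ τ I x := fun τ M I => by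
    funext x
    simp only [momentIntegrand, hηdef]
    ring
  intro M I
  obtain ⟨hint, ho⟩ := hloc M I
  obtain ⟨hintρ, hoρ⟩ := hρc.tail_isLittleO hη h0 h1 I
  obtain ⟨hintσ, hoσ⟩ := hσc.tail_isLittleO hη h0 h1 I
  refine ⟨?_, ?_⟩
  · filter_upwards [hint, hintρ, hintσ] with t h2 h3 h4
    rw [hsplit, hsplit]
    exact ⟨h2.1.add h3, h2.2.add h4⟩
  · refine ((ho.add hoρ).sub hoσ).congr' ?_ (Eventually.of_forall fun _ => rfl)
    filter_upwards [hint, hintρ, hintσ] with t h2 h3 h4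
    rw [hsplit, hsplit, integral_add h2.1 h3, integral_add h2.2 h4]
    ring

end Moments

/-! ### Bounded geometry -/

/-- Bounded functions on coordinate space. -/
def Bdd (f : Coord d → ℝ) : Prop := ∃ C, ∀ x, |f x| ≤ C

namespace Bdd

variable {f h : Coord d → ℝ}

lemma const (c : ℝ) : Bdd (fun _ : Coord d => c) := ⟨|c|, fun _ => le_rfl⟩

lemma add (hf : Bdd f) (hh : Bdd h) : Bdd fun x => f x + h x := by
  obtain ⟨C, hC⟩ := hf
  obtain ⟨D, hD⟩ := hh
  exact ⟨C + D, fun x => (abs_add_le _ _).trans (add_le_add (hC x) (hD x))⟩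

lemma mul (hf : Bdd f) (hh : Bdd h) : Bdd fun x => f x * h x := by
  obtain ⟨C, hC⟩ := hf
  obtain ⟨D, hD⟩ := hh
  refine ⟨C * D, fun x => ?_⟩
  rw [abs_mul]
  exact mul_le_mul (hC x) (hD x) (abs_nonneg _) ((abs_nonneg _).trans (hC x))

lemma neg (hf : Bdd f) : Bdd fun x => -f x := by
  obtain ⟨C, hC⟩ := hf
  exact ⟨C, fun x => by rw [abs_neg]; exact hC x⟩

lemma sub (hf : Bdd f) (hh : Bdd h) : Bdd fun x => f x - h x := by
  simpa only [sub_eq_add_neg] using hf.add hh.neg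

lemma sum {ι : Type*} (s : Finset ι) {f : ι → Coord d → ℝ} (hf : ∀ a ∈ s, Bdd (f a)) :
    Bdd fun x => ∑ a ∈ s, f a x := by
  classical
  induction s using Finset.induction_on with
  | empty => simpa using const 0
  | insert a s ha ih =>
    simp only [Finset.sum_insert ha]
    exact (hf a (by simp)).add (ih fun b hb => hf b (by simp [hb]))

lemma prod {ι : Type*} (s : Finset ι) {f : ι → Coord d → ℝ} (hf : ∀ a ∈ s, Bdd (f a)) :
    Bdd fun x => ∏ a ∈ s, f a x := by
  classical
  induction s using Finset.induction_on with
  | empty => simpa using const 1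
  | insert a s ha ih =>
    simp only [Finset.prod_insert ha]
    exact (hf a (by simp)).mul (ih fun b hb => hf b (by simp [hb]))

/-- Finitely many bounded functions have a common bound. -/
lemma exists_uniform {ι : Type*} [Fintype ι] {f : ι → Coord d → ℝ} (hf : ∀ a, Bdd (f a)) :
    ∃ C, 0 ≤ C ∧ ∀ a x, |f a x| ≤ C := by
  choose C hC using hf
  refine ⟨∑ a, |C a|, Finset.sum_nonneg fun _ _ => abs_nonneg _, fun a x => ?_⟩
  exact ((hC a x).trans (le_abs_self _)).trans
    (Finset.single_le_sum (f := fun a => |C a|) (fun _ _ => abs_nonneg _) (Finset.mem_univ a))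

end Bdd

/-- Smooth bounded functions with bounded first partial derivatives. -/
structure BddC1 (f : Coord d → ℝ) : Prop where
  smooth : ContDiff ℝ ∞ f
  bdd : Bdd f
  pd_bdd : ∀ k, Bdd (pd k f)

namespace BddC1

variable {f h : Coord d → ℝ}

lemma differentiable (hf : BddC1 f) : Differentiable ℝ f := hf.smooth.differentiable (by simp)

lemma const (c : ℝ) : BddC1 (fun _ : Coord d => c) where
  smooth := contDiff_const
  bdd := Bdd.const c
  pd_bdd k := by
    have : pd k (fun _ : Coord d => c) = fun _ => 0 := funext fun x => pd_const c x k
    rw [this]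
    exact Bdd.const 0

lemma add (hf : BddC1 f) (hh : BddC1 h) : BddC1 fun x => f x + h x where
  smooth := hf.smooth.add hh.smooth
  bdd := hf.bdd.add hh.bdd
  pd_bdd k := by
    rw [show pd k (fun x => f x + h x) = fun x => pd k f x + pd k h x from
      funext fun x => pd_add (hf.differentiable x) (hh.differentiable x) k]
    exact (hf.pd_bdd k).add (hh.pd_bdd k)

lemma mul (hf : BddC1 f) (hh : BddC1 h) : BddC1 fun x => f x * h x where
  smooth := hf.smooth.mul hh.smooth
  bdd := hf.bdd.mul hh.bdd
  pd_bdd k := by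
    rw [show pd k (fun x => f x * h x) = fun x => pd k f x * h x + f x * pd k h x from
      funext fun x => pd_mul (hf.differentiable x) (hh.differentiable x) k]
    exact ((hf.pd_bdd k).mul hh.bdd).add (hf.bdd.mul (hh.pd_bdd k))

lemma neg (hf : BddC1 f) : BddC1 fun x => -f x := by
  simpa using (const (-1)).mul hf

lemma sub (hf : BddC1 f) (hh : BddC1 h) : BddC1 fun x => f x - h x := by
  simpa only [sub_eq_add_neg] using hf.add hh.neg

lemma sum {ι : Type*} (s : Finset ι) {f : ι → Coord d → ℝ} (hf : ∀ a ∈ s, BddC1 (f a)) :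
    BddC1 fun x => ∑ a ∈ s, f a x := by
  classical
  induction s using Finset.induction_on with
  | empty => simpa using const 0
  | insert a s ha ih =>
    simp only [Finset.sum_insert ha]
    exact (hf a (by simp)).add (ih fun b hb => hf b (by simp [hb]))

end BddC1

section BoundedGeometry

variable {g : Coord d → Matrix (Fin d) (Fin d) ℝ}

/-- Uniform ellipticity bounds the entries of the inverse metric. -/
lemma abs_gInv_le (hg : IsMetricOn g univ) {c : ℝ} (hc : 0 < c)
    (hell : ∀ x v, c * sqNorm v ≤ quadForm (g x) v) (i j : Fin d) (x : Coord d) :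
    |gInv g i j x| ≤ 1 / c := by
  -- apply ellipticity to a column of the inverse
  set v : Coord d := fun i => gInv g i j x with hv
  have h1 : quadForm (g x) v = v j := by
    have : ∀ i, ∑ k, v i * g x i k * v k = v i * if i = j then 1 else 0 := fun i => by
      rw [← hg.sum_mul_gInv (mem_univ x) i j, Finset.mul_sum]
      exact Finset.sum_congr rfl fun k _ => by rw [hv]; ring
    rw [quadForm, Finset.sum_congr rfl fun i _ => this i]
    simp
  have h2 := hell x v
  rw [h1] at h2
  have h3 := sq_le_sqNorm v j
  have h4 := sq_le_sqNorm v i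
  have h5 : v j ≤ 1 / c := by
    rw [le_div_iff₀ hc]
    by_contra! hlt
    nlinarith [mul_le_mul_of_nonneg_left h3 hc.le]
  refine abs_le_of_sq_le_sq ?_ (by positivity)
  have h6 : c * v i ^ 2 ≤ 1 / c := (mul_le_mul_of_nonneg_left h4 hc.le).trans (h2.trans h5)
  have h7 : v i ^ 2 ≤ 1 / c / c := by rw [le_div_iff₀ hc]; linarith
  calc v i ^ 2 ≤ 1 / c / c := h7
    _ = (1 / c) ^ 2 := by field_simp

namespace BoundedGeometry

lemma elliptic (h : BoundedGeometry g) : ∃ c > 0, ∀ x v, c * sqNorm v ≤ quadForm (g x) v := h.1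

lemma contDiff_metric (hg : IsMetricOn g univ) (i j : Fin d) :
    ContDiff ℝ ∞ fun x => g x i j := contDiffOn_univ.1 (hg.smooth i j)

lemma bddC1_metric (h : BoundedGeometry g) (hg : IsMetricOn g univ) (i j : Fin d) :
    BddC1 fun x => g x i j := by
  obtain ⟨C, hC⟩ := h.2
  exact ⟨contDiff_metric hg i j, ⟨C, fun x => (hC x i j i i).1⟩,
    fun k => ⟨C, fun x => (hC x i j k k).2.1⟩⟩

lemma bddC1_pd_metric (h : BoundedGeometry g) (hg : IsMetricOn g univ) (i j k : Fin d) :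
    BddC1 (pd k fun x => g x i j) := by
  obtain ⟨C, hC⟩ := h.2
  exact ⟨ContDiff.pd (contDiff_metric hg i j) (by simp) k, ⟨C, fun x => (hC x i j k k).2.1⟩,
    fun l => ⟨C, fun x => (hC x i j l k).2.2⟩⟩

lemma bddC1_gInv (h : BoundedGeometry g) (hg : IsMetricOn g univ) (i j : Fin d) :
    BddC1 (gInv g i j) := by
  obtain ⟨c, hc, hell⟩ := h.elliptic
  have hb : ∀ i j, Bdd (gInv g i j) := fun i j => ⟨1 / c, abs_gInv_le hg hc hell i j⟩
  refine ⟨contDiffOn_univ.1 (hg.contDiffOn_gInv i j), hb i j, fun k => ?_⟩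
  rw [show pd k (gInv g i j) = _ from
    funext fun x => hg.pd_gInv isOpen_univ (mem_univ x) k i j]
  exact (Bdd.sum _ fun a _ => Bdd.sum _ fun b _ =>
    ((hb i a).mul (h.bddC1_pd_metric hg a b k).bdd).mul (hb b j)).neg

lemma bddC1_pd_gInv (h : BoundedGeometry g) (hg : IsMetricOn g univ) (i j k : Fin d) :
    BddC1 (pd k (gInv g i j)) := by
  rw [show pd k (gInv g i j) = _ from
    funext fun x => hg.pd_gInv isOpen_univ (mem_univ x) k i j]
  exact (BddC1.sum _ fun a _ => BddC1.sum _ fun b _ =>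
    ((h.bddC1_gInv hg i a).mul (h.bddC1_pd_metric hg a b k)).mul (h.bddC1_gInv hg b j)).neg

lemma bddC1_divInv (h : BoundedGeometry g) (hg : IsMetricOn g univ) (i : Fin d) :
    BddC1 (divInv g i) := by
  have e : divInv g i = fun x => -contractedChristoffel g i x := funext fun x => by
    rw [hg.contractedChristoffel_eq isOpen_univ (mem_univ x), neg_neg]
  rw [e]
  unfold contractedChristoffel christoffel
  refine (BddC1.sum _ fun k _ => BddC1.sum _ fun l _ => (h.bddC1_gInv hg k l).mul
    ((BddC1.const _).mul (BddC1.sum _ fun p _ => (h.bddC1_gInv hg i p).mul ?_))).neg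
  exact ((h.bddC1_pd_metric hg l p k).add (h.bddC1_pd_metric hg k p l)).sub
    (h.bddC1_pd_metric hg k l p)

lemma bddC1_alphaDrift (h : BoundedGeometry g) (hg : IsMetricOn g univ) (α : ℝ) (i : Fin d) :
    BddC1 (alphaDrift α g i) :=
  ((BddC1.const _).mul (h.bddC1_divInv hg i)).sub
    ((BddC1.const _).mul (BddC1.sum _ fun k _ => h.bddC1_pd_gInv hg i k k))

lemma bddC1_alphaCovector (h : BoundedGeometry g) (hg : IsMetricOn g univ) (α : ℝ) (j : Fin d) :
    BddC1 (alphaCovector α g j) :=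
  BddC1.sum _ fun i _ => (h.bddC1_alphaDrift hg α i).mul (h.bddC1_metric hg i j)

lemma bdd_sqrtDet (h : BoundedGeometry g) (hg : IsMetricOn g univ) : Bdd (sqrtDet g) := by
  have : Bdd fun x => (g x).det := by
    simp only [Matrix.det_apply']
    exact Bdd.sum _ fun σ _ => (Bdd.const _).mul (Bdd.prod _ fun i _ => (h.bddC1_metric hg _ _).bdd)
  obtain ⟨C, hC⟩ := this
  refine ⟨√C, fun x => ?_⟩
  rw [sqrtDet, abs_of_nonneg (Real.sqrt_nonneg _)]
  exact Real.sqrt_le_sqrt ((le_abs_self _).trans (hC x))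

/-- Coercivity of the action in the scaled variable, uniformly in the time step. -/
lemma exists_alphaAction_lower_bound {hbar m : ℝ} (hb : 0 < hbar) (hm : 0 < m)
    (h : BoundedGeometry g) (hg : IsMetricOn g univ) {V : Coord d → ℝ} (hV : ∃ c, ∀ x, c ≤ V x)
    (α : ℝ) (x₀ : Coord d) :
    ∃ c > 0, ∃ C, ∀ s, 0 < s → s ≤ 1 → ∀ z,
      c * sqNorm z - C ≤ alphaAction α hbar m g V x₀ (s ^ 2 * m / hbar) (x₀ + s • z) := by
  obtain ⟨c, hc, hell⟩ := h.elliptic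
  obtain ⟨cV, hcV⟩ := hV
  obtain ⟨B, hB0, hB⟩ := Bdd.exists_uniform fun j => (h.bddC1_alphaCovector hg α j).bdd
  obtain ⟨D, hD⟩ : Bdd fun y => ∑ j, alphaCovector α g j y * alphaDrift α g j y :=
    Bdd.sum _ fun j _ => (h.bddC1_alphaCovector hg α j).bdd.mul (h.bddC1_alphaDrift hg α j).bdd
  obtain ⟨E, hE⟩ : Bdd fun y => α / 2 * ∑ i, pd i (divInv g i) y
      - α ^ 2 / 2 * ∑ i, ∑ j, pd i (pd j (gInv g i j)) y :=
    ((Bdd.const _).mul (Bdd.sum _ fun i _ => (h.bddC1_divInv hg i).pd_bdd i)).sub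
      ((Bdd.const _).mul (Bdd.sum _ fun i _ => Bdd.sum _ fun j _ =>
        (h.bddC1_pd_gInv hg i j j).pd_bdd i))
  refine ⟨c / 4, by positivity, d * (B ^ 2 / c) + |D| + |E| + m / hbar ^ 2 * |cV|,
    fun s hs hs1 z => ?_⟩
  rw [alphaAction_scaled hb.ne' hm.ne' hs.ne' z fun i j => hg.symm (mem_univ _) i j]
  set y := x₀ + α • s • z with hy
  have hs2 : s ^ 2 ≤ 1 := pow_le_one₀ hs.le hs1
  have hs20 : 0 < s ^ 2 := by positivity
  have h1 : s * ∑ j, alphaCovector α g j y * z j ≤ c / 4 * sqNorm z + d * (B ^ 2 / c) := by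
    rw [sqNorm, Finset.mul_sum, Finset.mul_sum]
    have : (d : ℝ) * (B ^ 2 / c) = ∑ _j : Fin d, B ^ 2 / c := by simp
    rw [this, ← Finset.sum_add_distrib]
    refine Finset.sum_le_sum fun j _ => ?_
    set β := alphaCovector α g j y with hβ
    have hβB : β ^ 2 ≤ B ^ 2 := by
      rw [← sq_abs]
      exact pow_le_pow_left₀ (abs_nonneg _) (hB j y) 2
    have h2 : c * (s * (β * z j)) ≤ c * (c / 4 * z j ^ 2) + B ^ 2 := by
      nlinarith [sq_nonneg (c / 2 * z j - s * β), sq_nonneg β]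
    have h3 : c * (c / 4 * z j ^ 2 + B ^ 2 / c) = c * (c / 4 * z j ^ 2) + B ^ 2 := by
      field_simp
    rw [← h3] at h2
    exact le_of_mul_le_mul_left h2 hc
  have h2 : -(|D|) ≤ s ^ 2 * (1 / 2 * ∑ j, alphaCovector α g j y * alphaDrift α g j y) := by
    have h3 : |∑ j, alphaCovector α g j y * alphaDrift α g j y| ≤ |D| :=
      (hD y).trans (le_abs_self D)
    have h4 := (abs_le.1 h3).1
    nlinarith [abs_nonneg D]
  have h3 : -(|E| + m / hbar ^ 2 * |cV|) ≤ s ^ 2 * alphaPotential α hbar m g V y := by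
    have h4 := (abs_le.1 ((hE y).trans (le_abs_self E))).1
    have h5 : -|cV| ≤ V y := (neg_abs_le cV).trans (hcV y)
    have hmh : 0 < m / hbar ^ 2 := by positivity
    have h6 : -(|E| + m / hbar ^ 2 * |cV|) ≤ alphaPotential α hbar m g V y := by
      rw [alphaPotential]
      nlinarith
    have h7 : 0 ≤ |E| + m / hbar ^ 2 * |cV| := by positivity
    nlinarith
  have h4 := hell y z
  rw [mul_add]
  linarith

/-- The `α`-densities concentrate at `x₀`: in the variable `z = (x - x₀)/s` they are dominated by a
fixed Gaussian, and `|x - x₀|⁴ = s⁴|z|⁴` with `s² = ħt/m`. -/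
theorem concentrates_alphaDensity {hbar m α : ℝ} (hb : 0 < hbar) (hm : 0 < m)
    (h : BoundedGeometry g) (hg : IsMetricOn g univ) {V : Coord d → ℝ}
    (hVs : ContDiffOn ℝ ∞ V univ) (hV : ∃ c, ∀ x, c ≤ V x) (hα : α ∈ Icc (0 : ℝ) 1)
    (x₀ : Coord d) : Concentrates x₀ (alphaDensity α hbar m g V x₀) := by
  have hcont : ∀ t, Continuous (alphaDensity α hbar m g V x₀ t) := fun t =>
    continuousOn_univ.1 (continuousOn_alphaDensity isOpen_univ hg hVs (starConvex_univ x₀) hα t)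
  have hnonneg : ∀ t > 0, ∀ x, 0 ≤ alphaDensity α hbar m g V x₀ t x := fun t ht x =>
    mul_nonneg (div_nonneg (Real.sqrt_nonneg _) (Real.rpow_nonneg (by positivity) _))
      (Real.exp_nonneg _)
  refine ⟨fun t _ => hcont t, hnonneg, fun n => ?_⟩
  obtain ⟨c, hc, C, hC⟩ := exists_alphaAction_lower_bound hb hm h hg hV α x₀
  obtain ⟨D, hD⟩ := h.bdd_sqrtDet hg
  have hD0 : 0 ≤ D := (abs_nonneg _).trans (hD x₀)
  set E : ℝ := D / (2 * Real.pi) ^ ((d : ℝ) / 2) * Real.exp C with hE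
  have hscaled : ∀ s, 0 < s → s ≤ 1 → ∀ z,
      s ^ d * alphaDensity α hbar m g V x₀ (s ^ 2 * m / hbar) (x₀ + s • z)
        ≤ E * Real.exp (-c * sqNorm z) := by
    intro s hs hs1 z
    rw [scaled_alphaDensity hb.ne' hm.ne' hs, hE, mul_assoc, ← Real.exp_add]
    refine mul_le_mul ?_ (Real.exp_le_exp.2 ?_) (Real.exp_nonneg _) (by positivity)
    · gcongr
      exact (le_abs_self _).trans (hD _)
    · linarith [hC s hs hs1 z]
  set J : ℝ := E * ∫ z : Coord d, gaussMajorant (n + 2) c z with hJ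
  refine ⟨J * (hbar / m) ^ 2, ?_⟩
  have hmaj : ∀ s, 0 < s → s ≤ 1 → ∀ z,
      s ^ d * (sqNorm (x₀ + s • z - x₀) ^ 2 * (1 + sqNorm (x₀ + s • z - x₀)) ^ n
        * alphaDensity α hbar m g V x₀ (s ^ 2 * m / hbar) (x₀ + s • z))
        ≤ s ^ 4 * (E * gaussMajorant (n + 2) c z) := by
    intro s hs hs1 z
    have hq := sqNorm_nonneg z
    have hs2 : s ^ 2 ≤ 1 := pow_le_one₀ hs.le hs1
    rw [add_sub_cancel_left, sqNorm_smul]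
    calc s ^ d * ((s ^ 2 * sqNorm z) ^ 2 * (1 + s ^ 2 * sqNorm z) ^ n
          * alphaDensity α hbar m g V x₀ (s ^ 2 * m / hbar) (x₀ + s • z))
        = s ^ 4 * (sqNorm z ^ 2 * (1 + s ^ 2 * sqNorm z) ^ n * (s ^ d
          * alphaDensity α hbar m g V x₀ (s ^ 2 * m / hbar) (x₀ + s • z))) := by ring
      _ ≤ s ^ 4 * ((1 + sqNorm z) ^ 2 * (1 + sqNorm z) ^ n * (E * Real.exp (-c * sqNorm z))) := by
          have h1 := hscaled s hs hs1 z
          have h2 : 0 ≤ s ^ d * alphaDensity α hbar m g V x₀ (s ^ 2 * m / hbar) (x₀ + s • z) :=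
            mul_nonneg (by positivity) (hnonneg _ (by positivity) _)
          gcongr
          · linarith
          · nlinarith
      _ = _ := by rw [gaussMajorant, pow_add]; ring
  have hlim := tendsto_sqrt_scaled_time hb hm
  have hle : ∀ᶠ t in 𝓝[>] (0 : ℝ), √(hbar * t / m) ∈ Ioc (0 : ℝ) 1 :=
    hlim (Ioc_mem_nhdsGT one_pos)
  filter_upwards [hle, self_mem_nhdsWithin] with t hs ht
  have ht0 : 0 < t := ht
  set s := √(hbar * t / m) with hsdef
  have hst : s ^ 2 * m / hbar = t := scaled_time hb hm ht0
  have hs2 : s ^ 2 = hbar / m * t := by rw [hsdef, Real.sq_sqrt (by positivity)]; ring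
  have hm1 := hmaj s hs.1 hs.2
  rw [hst] at hm1
  set F : Coord d → ℝ := fun x => sqNorm (x - x₀) ^ 2 * (1 + sqNorm (x - x₀)) ^ n
    * alphaDensity α hbar m g V x₀ t x with hF
  have hFc : Continuous F := by
    have := hcont t
    simp only [hF]
    fun_prop
  have hF0 : ∀ x, 0 ≤ F x := fun x => by
    have := hnonneg t ht0 x
    have := sqNorm_nonneg (x - x₀)
    simp only [hF]
    positivity
  have hdom := ((integrable_gaussMajorant (d := d) (n + 2) hc).const_mul E).const_mul (s ^ 4)
  have hint : Integrable fun z => s ^ d * F (x₀ + s • z) :=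
    hdom.mono' (Continuous.aestronglyMeasurable (by fun_prop)) (Eventually.of_forall fun z => by
      have := hF0 (x₀ + s • z)
      have := pow_pos hs.1 d
      rw [Real.norm_of_nonneg (by positivity)]
      exact hm1 z)
  refine ⟨integrable_of_integrable_scaled x₀ hs.1.ne' ?_, ?_⟩
  · have := hint.const_mul ((s ^ d)⁻¹)
    have hsd : s ^ d ≠ 0 := (pow_pos hs.1 d).ne'
    simpa [← mul_assoc, inv_mul_cancel₀ hsd] using this
  · rw [integral_eq_integral_scaled F x₀ hs.1]
    refine (integral_mono hint hdom hm1).trans (le_of_eq ?_)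
    rw [integral_const_mul, integral_const_mul, ← hJ, show s ^ 4 = (s ^ 2) ^ 2 by ring, hs2]
    ring

end BoundedGeometry

end BoundedGeometry

/-! ### Moments of a global Green's function -/

/-- `f` is smooth, `|f| ≤ ζ₀`, and the first and second partial derivatives of `f` are bounded
by `ζ₁`. -/
structure Ctrl (f ζ₀ ζ₁ : Coord d → ℝ) : Prop where
  smooth : ContDiff ℝ ∞ f
  le : ∀ x, |f x| ≤ ζ₀ x
  pd_le : ∀ k x, |pd k f x| ≤ ζ₁ x
  pd_pd_le : ∀ k l x, |pd l (pd k f) x| ≤ ζ₁ x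

namespace Ctrl

variable {f h ζ₀ ζ₁ ξ₀ ξ₁ : Coord d → ℝ}

lemma mono (hf : Ctrl f ζ₀ ζ₁) (h : ∀ x, ζ₁ x ≤ ξ₁ x) : Ctrl f ζ₀ ξ₁ :=
  ⟨hf.smooth, hf.le, fun k x => (hf.pd_le k x).trans (h x),
    fun k l x => (hf.pd_pd_le k l x).trans (h x)⟩

lemma mul (hf : Ctrl f ζ₀ ζ₁) (hh : Ctrl h ξ₀ ξ₁) (hζ : ∀ x, 0 ≤ ζ₁ x) (hξ : ∀ x, 0 ≤ ξ₁ x) :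
    Ctrl (fun x => f x * h x) (fun x => ζ₀ x * ξ₀ x)
      (fun x => ζ₁ x * ξ₀ x + 2 * (ζ₁ x * ξ₁ x) + ζ₀ x * ξ₁ x) := by
  have hfd : Differentiable ℝ f := hf.smooth.differentiable (by simp)
  have hhd : Differentiable ℝ h := hh.smooth.differentiable (by simp)
  have hfd' : ∀ k, Differentiable ℝ (pd k f) := fun k =>
    (ContDiff.pd hf.smooth (k := ∞) (by simp) k).differentiable (by simp)
  have hhd' : ∀ k, Differentiable ℝ (pd k h) := fun k =>
    (ContDiff.pd hh.smooth (k := ∞) (by simp) k).differentiable (by simp)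
  have hm : ∀ {a b A B : ℝ}, |a| ≤ A → |b| ≤ B → |a * b| ≤ A * B := fun ha hb => by
    rw [abs_mul]
    exact mul_le_mul ha hb (abs_nonneg _) ((abs_nonneg _).trans ha)
  have e : ∀ k, pd k (fun x => f x * h x) = fun x => pd k f x * h x + f x * pd k h x := fun k =>
    funext fun x => pd_mul (hfd x) (hhd x) k
  refine ⟨hf.smooth.mul hh.smooth, fun x => hm (hf.le x) (hh.le x), fun k x => ?_,
    fun k l x => ?_⟩
  · rw [e]
    have h1 := hm (hf.pd_le k x) (hh.le x)
    have h2 := hm (hf.le x) (hh.pd_le k x)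
    have h3 := mul_nonneg (hζ x) (hξ x)
    exact (abs_add_le _ _).trans (by linarith)
  · rw [e, pd_add (f := fun x => pd k f x * h x) (g := fun x => f x * pd k h x)
      ((hfd' k x).mul (hhd x)) ((hfd x).mul (hhd' k x)), pd_mul (hfd' k x) (hhd x),
      pd_mul (hfd x) (hhd' k x)]
    have h1 := hm (hf.pd_pd_le k l x) (hh.le x)
    have h2 := hm (hf.pd_le k x) (hh.pd_le l x)
    have h3 := hm (hf.pd_le l x) (hh.pd_le k x)
    have h4 := hm (hf.le x) (hh.pd_pd_le k l x)
    refine (abs_add_le _ _).trans ?_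
    have h5 := abs_add_le (pd l (pd k f) x * h x) (pd k f x * pd l h x)
    have h6 := abs_add_le (pd l f x * pd k h x) (f x * pd l (pd k h) x)
    linarith

end Ctrl

section Weights

variable (x₀ : Coord d)

lemma contDiff_sqNorm_sub : ContDiff ℝ ∞ fun x => sqNorm (x - x₀) := by
  simp only [sqNorm, Pi.sub_apply]
  fun_prop

lemma pd_coord_sub (i k : Fin d) (x : Coord d) :
    pd k (fun x : Coord d => x i - x₀ i) x = if i = k then 1 else 0 := by
  rw [pd_sub (by fun_prop) (by fun_prop), pd_coord, pd_const, sub_zero]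

lemma pd_sqNorm_sub (k : Fin d) (x : Coord d) :
    pd k (fun x => sqNorm (x - x₀)) x = 2 * (x k - x₀ k) := by
  simp only [sqNorm, Pi.sub_apply]
  rw [pd_sum _ fun i _ => by fun_prop]
  have : ∀ i, pd k (fun x : Coord d => (x i - x₀ i) ^ 2) x
      = 2 * (x i - x₀ i) * if i = k then 1 else 0 := fun i => by
    simp only [sq]
    rw [pd_mul (by fun_prop) (by fun_prop), pd_coord_sub]
    ring
  simp [this]

/-- The weight `√(1 + |x - x₀|²)`, whose powers measure the moments. A smooth function of linear
growth is used, so that each derivative lowers the order of a power. -/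
noncomputable def weight (x : Coord d) : ℝ := √(1 + sqNorm (x - x₀))

lemma one_add_sqNorm_pos (x : Coord d) : 0 < 1 + sqNorm (x - x₀) := by
  linarith [sqNorm_nonneg (x - x₀)]

lemma weight_sq (x : Coord d) : weight x₀ x ^ 2 = 1 + sqNorm (x - x₀) :=
  Real.sq_sqrt (one_add_sqNorm_pos x₀ x).le

lemma one_le_weight (x : Coord d) : 1 ≤ weight x₀ x :=
  Real.one_le_sqrt.2 (by linarith [sqNorm_nonneg (x - x₀)])

lemma weight_pos (x : Coord d) : 0 < weight x₀ x := zero_lt_one.trans_le (one_le_weight x₀ x)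

lemma abs_sub_le_weight (x : Coord d) (i : Fin d) : |x i - x₀ i| ≤ weight x₀ x := by
  refine abs_le_of_sq_le_sq ?_ (weight_pos x₀ x).le
  rw [weight_sq]
  have := sq_le_sqNorm (x - x₀) i
  simp only [Pi.sub_apply] at this
  linarith

lemma sqNorm_le_weight_sq (x : Coord d) : sqNorm (x - x₀) ≤ weight x₀ x ^ 2 := by
  rw [weight_sq]; linarith

lemma contDiff_weight : ContDiff ℝ ∞ (weight x₀) :=
  (contDiff_const.add (contDiff_sqNorm_sub x₀)).sqrt fun x => (one_add_sqNorm_pos x₀ x).ne'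

lemma pd_weight (k : Fin d) (x : Coord d) :
    pd k (weight x₀) x = (x k - x₀ k) * (weight x₀ x)⁻¹ := by
  have hd := (contDiff_sqNorm_sub x₀).differentiable (by simp) x
  have h := pd_comp (f := fun x => 1 + sqNorm (x - x₀))
    (Real.hasDerivAt_sqrt (one_add_sqNorm_pos x₀ x).ne') (hd.const_add 1) k
  rw [pd_add (differentiableAt_const _) hd, pd_const, pd_sqNorm_sub] at h
  change pd k (weight x₀) x = _ at h
  rw [h]
  change 1 / (2 * weight x₀ x) * _ = _
  have := (weight_pos x₀ x).ne'
  field_simp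
  ring

lemma ctrl_weight : Ctrl (weight x₀) (weight x₀) fun _ => 2 := by
  have hle : ∀ (i : Fin d) x, |(x i - x₀ i) * (weight x₀ x)⁻¹| ≤ 1 := fun i x => by
    have hw := weight_pos x₀ x
    rw [abs_mul, abs_of_pos (inv_pos.2 hw), ← div_eq_mul_inv, div_le_one hw]
    exact abs_sub_le_weight x₀ x i
  have hd : Differentiable ℝ (weight x₀) := (contDiff_weight x₀).differentiable (by simp)
  refine ⟨contDiff_weight x₀, fun x => (abs_of_pos (weight_pos x₀ x)).le, fun k x => ?_,
    fun k l x => ?_⟩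
  · rw [pd_weight]
    exact (hle k x).trans one_le_two
  · have hw := weight_pos x₀ x
    have e : pd k (weight x₀) = fun x => (x k - x₀ k) * (weight x₀ x)⁻¹ := funext (pd_weight x₀ k)
    have hi := pd_comp (hasDerivAt_inv hw.ne') (hd x) l
    rw [e, pd_mul (f := fun x => x k - x₀ k) (g := fun x => (weight x₀ x)⁻¹) (by fun_prop)
      ((hd x).inv hw.ne'), hi, pd_coord_sub, pd_weight]
    have h1 : |(if k = l then (1 : ℝ) else 0) * (weight x₀ x)⁻¹| ≤ 1 := by
      have : (weight x₀ x)⁻¹ ≤ 1 := inv_le_one_of_one_le₀ (one_le_weight x₀ x)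
      split_ifs
      · rw [one_mul, abs_of_pos (inv_pos.2 hw)]; exact this
      · simp
    have h2 : |(x k - x₀ k) * (-(weight x₀ x ^ 2)⁻¹ * ((x l - x₀ l) * (weight x₀ x)⁻¹))| ≤ 1 := by
      have e2 : (x k - x₀ k) * (-(weight x₀ x ^ 2)⁻¹ * ((x l - x₀ l) * (weight x₀ x)⁻¹))
          = -(((x k - x₀ k) * (weight x₀ x)⁻¹) * ((x l - x₀ l) * (weight x₀ x)⁻¹)
            * (weight x₀ x)⁻¹) := by
        field_simp
      rw [e2, abs_neg, abs_mul, abs_mul, abs_of_pos (inv_pos.2 hw)]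
      exact mul_le_one₀ (mul_le_one₀ (hle k x) (abs_nonneg _) (hle l x)) (inv_pos.2 hw).le
        (inv_le_one_of_one_le₀ (one_le_weight x₀ x))
    exact (abs_add_le _ _).trans (by linarith)

lemma ctrl_weight_pow (n : ℕ) :
    ∃ C, 0 ≤ C ∧ Ctrl (fun x => weight x₀ x ^ (n + 1)) (fun x => weight x₀ x ^ (n + 1))
      fun x => C * weight x₀ x ^ n := by
  induction n with
  | zero => exact ⟨2, zero_le_two, by simpa using ctrl_weight x₀⟩
  | succ n ih =>
    obtain ⟨C, hC, h⟩ := ih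
    refine ⟨5 * C + 2, by positivity, ?_⟩
    have h2 := (h.mul (ctrl_weight x₀)
      (fun x => mul_nonneg hC (pow_nonneg (weight_pos x₀ x).le n)) fun _ => zero_le_two).mono
      (ξ₁ := fun x => (5 * C + 2) * weight x₀ x ^ (n + 1)) fun x => by
        have h1 := one_le_weight x₀ x
        have h3 : C * weight x₀ x ^ n ≤ C * weight x₀ x ^ (n + 1) := by gcongr; omega
        have h4 : C * weight x₀ x ^ n * weight x₀ x = C * weight x₀ x ^ (n + 1) := by ring
        linarith
    simpa only [← pow_succ] using h2

lemma ctrl_sqNorm : Ctrl (fun x => sqNorm (x - x₀)) (fun x => sqNorm (x - x₀))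
    fun x => 2 * weight x₀ x := by
  refine ⟨contDiff_sqNorm_sub x₀, fun x => (abs_of_nonneg (sqNorm_nonneg _)).le, fun k x => ?_,
    fun k l x => ?_⟩
  · rw [pd_sqNorm_sub, abs_mul, abs_two]
    linarith [abs_sub_le_weight x₀ x k]
  · rw [show pd k (fun x => sqNorm (x - x₀)) = fun x => 2 * (x k - x₀ k) from
      funext (pd_sqNorm_sub x₀ k), pd_const_mul (by fun_prop), pd_coord_sub]
    have := one_le_weight x₀ x
    split_ifs
    · rw [mul_one, abs_two]; linarith
    · rw [mul_zero, abs_zero]; linarith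

/-- The derivatives of `|x - x₀|⁴` are small near `x₀`. -/
lemma ctrl_sqNorm_sq : Ctrl (fun x => sqNorm (x - x₀) ^ 2) (fun x => sqNorm (x - x₀) ^ 2)
    fun x => 12 * (sqNorm (x - x₀) * weight x₀ x) := by
  have hd : Differentiable ℝ fun x => sqNorm (x - x₀) :=
    (contDiff_sqNorm_sub x₀).differentiable (by simp)
  have e : ∀ k, pd k (fun x => sqNorm (x - x₀) ^ 2)
      = fun x => 4 * (sqNorm (x - x₀) * (x k - x₀ k)) := fun k => funext fun x => by
    simp only [sq]
    rw [pd_mul (hd x) (hd x), pd_sqNorm_sub]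
    ring
  refine ⟨(contDiff_sqNorm_sub x₀).pow 2, fun x => (abs_of_nonneg (by positivity)).le,
    fun k x => ?_, fun k l x => ?_⟩
  · rw [e]
    have hq := sqNorm_nonneg (x - x₀)
    have hw := weight_pos x₀ x
    rw [abs_mul, abs_mul, abs_of_nonneg hq, abs_of_pos four_pos]
    have := mul_le_mul_of_nonneg_left (abs_sub_le_weight x₀ x k) hq
    nlinarith [mul_nonneg hq hw.le]
  · have hq := sqNorm_nonneg (x - x₀)
    have hw := one_le_weight x₀ x
    have hdk : DifferentiableAt ℝ (fun x : Coord d => x k - x₀ k) x := by fun_prop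
    rw [e, pd_const_mul (f := fun x => sqNorm (x - x₀) * (x k - x₀ k)) ((hd x).mul hdk),
      pd_mul (hd x) hdk, pd_sqNorm_sub, pd_coord_sub]
    have h1 : |2 * (x l - x₀ l) * (x k - x₀ k)| ≤ 2 * sqNorm (x - x₀) := by
      have hk := sq_le_sqNorm (x - x₀) k
      have hl := sq_le_sqNorm (x - x₀) l
      simp only [Pi.sub_apply] at hk hl
      rw [abs_le]
      constructor <;> nlinarith [sq_nonneg (x l - x₀ l - (x k - x₀ k)),
        sq_nonneg (x l - x₀ l + (x k - x₀ k))]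
    have h2 : |sqNorm (x - x₀) * (if k = l then (1 : ℝ) else 0)| ≤ sqNorm (x - x₀) := by
      split_ifs
      · rw [mul_one, abs_of_nonneg hq]
      · simpa using hq
    have h3 := abs_add_le (2 * (x l - x₀ l) * (x k - x₀ k))
      (sqNorm (x - x₀) * (if k = l then (1 : ℝ) else 0))
    rw [abs_mul, abs_of_pos four_pos]
    nlinarith

/-- Smooth cutoffs at distance of order `R + 1` from `x₀`. -/
noncomputable def cutoff (R : ℕ) (x : Coord d) : ℝ :=
  (⟨1, 2, one_pos, one_lt_two⟩ : ContDiffBump (0 : Coord d))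
    (-((R + 1 : ℝ)⁻¹ • x₀) + (R + 1 : ℝ)⁻¹ • x)

lemma cutoff_nonneg (R : ℕ) (x : Coord d) : 0 ≤ cutoff x₀ R x := ContDiffBump.nonneg _

lemma cutoff_le_one (R : ℕ) (x : Coord d) : cutoff x₀ R x ≤ 1 := ContDiffBump.le_one _

lemma cutoff_self (R : ℕ) : cutoff x₀ R x₀ = 1 := by
  rw [cutoff, neg_add_cancel]
  exact ContDiffBump.one_of_mem_closedBall _ (by simp)

lemma tendsto_cutoff (x : Coord d) : Tendsto (fun R => cutoff x₀ R x) atTop (𝓝 1) := by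
  refine tendsto_const_nhds.congr' ?_
  filter_upwards [eventually_ge_atTop ⌈‖x - x₀‖⌉₊] with R hR
  refine (ContDiffBump.one_of_mem_closedBall _ ?_).symm
  rw [mem_closedBall_zero_iff, show -((R + 1 : ℝ)⁻¹ • x₀) + (R + 1 : ℝ)⁻¹ • x
    = (R + 1 : ℝ)⁻¹ • (x - x₀) by module, norm_smul, norm_inv, Real.norm_of_nonneg (by positivity),
    inv_mul_le_iff₀ (by positivity), mul_one]
  have := (Nat.le_ceil ‖x - x₀‖).trans (Nat.cast_le.2 hR)
  linarith

lemma testOn_cutoff (R : ℕ) : TestOn univ (cutoff x₀ R) where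
  smooth := (ContDiffBump.contDiff _).comp (by fun_prop)
  compact := by
    let b : ContDiffBump (0 : Coord d) := ⟨1, 2, one_pos, one_lt_two⟩
    have hR : (R + 1 : ℝ)⁻¹ ≠ 0 := by positivity
    exact b.hasCompactSupport.comp_homeomorph
      ((Homeomorph.smulOfNeZero _ hR).trans (Homeomorph.addLeft (-((R + 1 : ℝ)⁻¹ • x₀))))
  subset := subset_univ _

/-- On the support of the derivatives of the cutoff at distance `R` the weight is of order `R`, so
these derivatives are bounded by a multiple of the inverse weight, uniformly in `R`. -/
lemma ctrl_cutoff :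
    ∃ C, 0 ≤ C ∧ ∀ R, Ctrl (cutoff x₀ R) (fun _ => 1) fun x => C * (weight x₀ x)⁻¹ := by
  let b : ContDiffBump (0 : Coord d) := ⟨1, 2, one_pos, one_lt_two⟩
  have hb : TestOn univ b := ⟨b.contDiff, b.hasCompactSupport, subset_univ _⟩
  obtain ⟨C₁, hC₁, h1⟩ := Bdd.exists_uniform fun k =>
    (⟨_, (hb.pd k).exists_bound.choose_spec.2⟩ : Bdd (pd k b))
  obtain ⟨C₂, hC₂, h2⟩ := Bdd.exists_uniform fun p : Fin d × Fin d =>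
    (⟨_, ((hb.pd p.1).pd p.2).exists_bound.choose_spec.2⟩ : Bdd (pd p.2 (pd p.1 b)))
  refine ⟨(C₁ + C₂) * (1 + 4 * d), by positivity, fun R => ?_⟩
  set r : ℝ := (R + 1 : ℝ)⁻¹ with hr
  have hrpos : 0 < r := by positivity
  have hr1 : r ≤ 1 := inv_le_one_of_one_le₀ (by linarith [Nat.cast_nonneg (α := ℝ) R])
  have hpd : ∀ k, pd k (cutoff x₀ R) = fun x => r * pd k b (-(r • x₀) + r • x) := fun k =>
    funext fun x => pd_comp_affine (f := b) (-(r • x₀)) r (hb.differentiable _) k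
  have hpd2 : ∀ k l x, pd l (pd k (cutoff x₀ R)) x
      = r * (r * pd l (pd k b) (-(r • x₀) + r • x)) := fun k l x => by
    rw [hpd, pd_const_mul, pd_comp_affine (f := pd k b) _ _ ((hb.pd k).differentiable _)]
    exact ((hb.pd k).differentiable _).comp x (by fun_prop)
  have hsupp : ∀ {ψ : Coord d → ℝ}, tsupport ψ ⊆ tsupport b → ∀ {D}, 0 ≤ D → (∀ x, |ψ x| ≤ D) →
      D ≤ C₁ + C₂ → ∀ x, r * |ψ (-(r • x₀) + r • x)|
        ≤ (C₁ + C₂) * (1 + 4 * d) * (weight x₀ x)⁻¹ := by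
    intro ψ hψ D hD0 hD hDC x
    have hw := weight_pos x₀ x
    by_cases hx : ψ (-(r • x₀) + r • x) = 0
    · rw [hx, abs_zero, mul_zero]; positivity
    have hmem : -(r • x₀) + r • x ∈ tsupport b := hψ (subset_tsupport _ hx)
    rw [b.tsupport_eq, mem_closedBall_zero_iff, show -(r • x₀) + r • x = r • (x - x₀) by module,
      norm_smul, Real.norm_of_nonneg hrpos.le] at hmem
    have hn : ‖x - x₀‖ * r ≤ 2 := by rw [mul_comm]; exact hmem
    have hq : sqNorm (x - x₀) ≤ d * ‖x - x₀‖ ^ 2 := by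
      rw [sqNorm]
      refine (Finset.sum_le_sum fun i _ => (?_ : (x - x₀) i ^ 2 ≤ ‖x - x₀‖ ^ 2)).trans (by simp)
      rw [← sq_abs]
      exact pow_le_pow_left₀ (abs_nonneg _) (norm_le_pi_norm (x - x₀) i) 2
    have hwr : weight x₀ x * r ≤ 1 + 4 * d := by
      refine (abs_le_of_sq_le_sq' ?_ (by positivity)).2
      rw [mul_pow, weight_sq]
      have h3 : ‖x - x₀‖ ^ 2 * r ^ 2 ≤ 4 := by
        rw [← mul_pow]
        have := pow_le_pow_left₀ (by positivity) hn 2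
        linarith
      have h4 : r ^ 2 ≤ 1 := pow_le_one₀ hrpos.le hr1
      have hd0 : (0 : ℝ) ≤ d := Nat.cast_nonneg d
      have h5 : sqNorm (x - x₀) * r ^ 2 ≤ d * 4 :=
        calc sqNorm (x - x₀) * r ^ 2 ≤ d * ‖x - x₀‖ ^ 2 * r ^ 2 := by gcongr
          _ = d * (‖x - x₀‖ ^ 2 * r ^ 2) := by ring
          _ ≤ d * 4 := by gcongr
      nlinarith
    have hr' : r ≤ (1 + 4 * d) * (weight x₀ x)⁻¹ := by
      rw [← div_eq_mul_inv, le_div_iff₀ hw]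
      linarith
    calc r * |ψ (-(r • x₀) + r • x)| ≤ (1 + 4 * d) * (weight x₀ x)⁻¹ * (C₁ + C₂) :=
          mul_le_mul hr' ((hD _).trans hDC) (abs_nonneg _) (by positivity)
      _ = _ := by ring
  refine ⟨(testOn_cutoff x₀ R).smooth, fun x => ?_, fun k x => ?_, fun k l x => ?_⟩
  · rw [abs_of_nonneg (cutoff_nonneg x₀ R x)]
    exact cutoff_le_one x₀ R x
  · rw [hpd, abs_mul, abs_of_pos hrpos]
    exact hsupp (tsupport_pd_subset _ _) hC₁ (h1 k) (by linarith) x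
  · rw [hpd2, abs_mul, abs_of_pos hrpos, abs_mul, abs_of_pos hrpos]
    refine le_trans ?_ (hsupp ((tsupport_pd_subset _ _).trans (tsupport_pd_subset _ _)) hC₂
      (h2 (k, l)) (by linarith) x)
    exact mul_le_mul_of_nonneg_left (mul_le_of_le_one_left (abs_nonneg _) hr1) hrpos.le

/-- The truncated powers of the weight lose one order under differentiation, uniformly in the
truncation. -/
lemma ctrl_weight_pow_mul_cutoff (n : ℕ) :
    ∃ C, 0 ≤ C ∧ ∀ R, Ctrl (fun x => weight x₀ x ^ (n + 1) * cutoff x₀ R x)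
      (fun x => weight x₀ x ^ (n + 1)) fun x => C * weight x₀ x ^ n := by
  obtain ⟨C, hC, h⟩ := ctrl_weight_pow x₀ n
  obtain ⟨D, hD, h'⟩ := ctrl_cutoff x₀
  refine ⟨C + 2 * C * D + D, by positivity, fun R => ?_⟩
  have hw := weight_pos x₀
  have := (h.mul (h' R) (fun x => mul_nonneg hC (pow_nonneg (hw x).le n))
    (fun x => mul_nonneg hD (inv_pos.2 (hw x)).le)).mono
    (ξ₁ := fun x => (C + 2 * C * D + D) * weight x₀ x ^ n) fun x => by
      have h1 : (weight x₀ x)⁻¹ ≤ 1 := inv_le_one_of_one_le₀ (one_le_weight x₀ x)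
      have h2 : C * weight x₀ x ^ n * (D * (weight x₀ x)⁻¹) ≤ C * D * weight x₀ x ^ n := by
        have : 0 ≤ C * D * weight x₀ x ^ n :=
          mul_nonneg (mul_nonneg hC hD) (pow_nonneg (hw x).le n)
        calc C * weight x₀ x ^ n * (D * (weight x₀ x)⁻¹)
            = C * D * weight x₀ x ^ n * (weight x₀ x)⁻¹ := by ring
          _ ≤ _ := mul_le_of_le_one_right this h1
      have h3 : weight x₀ x ^ (n + 1) * (D * (weight x₀ x)⁻¹) = D * weight x₀ x ^ n := by
        have := (hw x).ne'
        rw [pow_succ]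
        field_simp
      rw [h3]
      linarith
  simpa only [mul_one] using this

end Weights

/-- The generator without its potential part is bounded by the derivatives of the function it acts
on; the potential part is bounded on one side only. -/
lemma BoundedGeometry.exists_generator_le {hbar m : ℝ} (hb : 0 < hbar) (hm : 0 < m)
    {g : Coord d → Matrix (Fin d) (Fin d) ℝ} (h : BoundedGeometry g) (hg : IsMetricOn g univ)
    {V : Coord d → ℝ} {c : ℝ} (hV : ∀ x, c ≤ V x) :
    ∃ D, 0 ≤ D ∧ ∀ f ζ₀ ζ₁, Ctrl f ζ₀ ζ₁ → (∀ x, 0 ≤ f x) → ∀ x,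
      generator hbar m g V f x ≤ |c| / hbar * f x + D * ζ₁ x := by
  obtain ⟨C₂, hC₂, h2⟩ := Bdd.exists_uniform fun p : Fin d × Fin d => (h.bddC1_gInv hg p.1 p.2).bdd
  obtain ⟨C₁, hC₁, h1⟩ := Bdd.exists_uniform fun j => (h.bddC1_divInv hg j).bdd
  refine ⟨hbar / (2 * m) * (d * (d * C₂) + d * C₁), by positivity, fun f ζ₀ ζ₁ hf hf0 x => ?_⟩
  rw [generator_eq hb.ne' isOpen_univ hg (mem_univ x) (hf.smooth.of_le ENat.LEInfty.out).contDiffOn]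
  have hprod : ∀ {a b A B : ℝ}, |a| ≤ A → |b| ≤ B → a * b ≤ A * B := fun ha hb => by
    refine (le_abs_self _).trans ?_
    rw [abs_mul]
    exact mul_le_mul ha hb (abs_nonneg _) ((abs_nonneg _).trans ha)
  have e2 : ∑ i, ∑ j, gInv g i j x * pd i (pd j f) x ≤ d * (d * C₂) * ζ₁ x :=
    (Finset.sum_le_sum fun i _ => Finset.sum_le_sum fun j _ =>
      hprod (h2 (i, j) x) (hf.pd_pd_le j i x)).trans (le_of_eq (by simp; ring))
  have e1 : ∑ j, divInv g j x * pd j f x ≤ d * C₁ * ζ₁ x :=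
    (Finset.sum_le_sum fun j _ => hprod (h1 j x) (hf.pd_le j x)).trans (le_of_eq (by simp; ring))
  have e0 : -(V x / hbar * f x) ≤ |c| / hbar * f x := by
    have : -(V x) ≤ |c| := by linarith [neg_abs_le c, hV x]
    rw [← neg_mul, ← neg_div]
    have := hf0 x
    gcongr
  have e3 := mul_le_mul_of_nonneg_left (add_le_add e2 e1)
    (show 0 ≤ hbar / (2 * m) by positivity)
  linarith

/-- A form of Fatou's lemma. -/
lemma integrable_and_integral_le_of_tendsto {F : ℕ → Coord d → ℝ} {f : Coord d → ℝ} {C : ℝ}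
    (hF : ∀ k, Integrable (F k)) (hF0 : ∀ k x, 0 ≤ F k x)
    (hlim : ∀ x, Tendsto (fun k => F k x) atTop (𝓝 (f x))) (hC : ∀ k, ∫ x, F k x ≤ C) :
    Integrable f ∧ ∫ x, f x ≤ C := by
  have hf0 : ∀ x, 0 ≤ f x := fun x => ge_of_tendsto' (hlim x) fun k => hF0 k x
  have hC0 : 0 ≤ C := (integral_nonneg (hF0 0)).trans (hC 0)
  have hfm : AEStronglyMeasurable f volume :=
    aestronglyMeasurable_of_tendsto_ae atTop (fun k => (hF k).aestronglyMeasurable)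
      (Eventually.of_forall hlim)
  have hle : ∫⁻ x, ENNReal.ofReal (f x) ≤ ENNReal.ofReal C :=
    calc ∫⁻ x, ENNReal.ofReal (f x)
        = ∫⁻ x, liminf (fun k => ENNReal.ofReal (F k x)) atTop :=
          lintegral_congr fun x => ((ENNReal.tendsto_ofReal (hlim x)).liminf_eq).symm
      _ ≤ liminf (fun k => ∫⁻ x, ENNReal.ofReal (F k x)) atTop :=
          lintegral_liminf_le' fun k => (hF k).aemeasurable.ennreal_ofReal
      _ ≤ ENNReal.ofReal C := by
          refine liminf_le_of_frequently_le' (Eventually.of_forall fun k => ?_).frequently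
          rw [← ofReal_integral_eq_lintegral_ofReal (hF k) (Eventually.of_forall (hF0 k))]
          exact ENNReal.ofReal_le_ofReal (hC k)
  refine ⟨⟨hfm, (hasFiniteIntegral_iff_ofReal (Eventually.of_forall hf0)).2
    (hle.trans_lt ENNReal.ofReal_lt_top)⟩, ?_⟩
  rw [integral_eq_lintegral_of_nonneg_ae (Eventually.of_forall hf0) hfm]
  exact ENNReal.toReal_le_of_le_ofReal hC0 hle

namespace IsGlobalGreenFunction

variable {hbar m c : ℝ} {g : Coord d → Matrix (Fin d) (Fin d) ℝ} {V : Coord d → ℝ}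
  {x₀ : Coord d} {G : ℝ → Coord d → ℝ}

lemma greenDensity_nonneg (hG : IsGlobalGreenFunction hbar m g V x₀ G) {t : ℝ} (ht : 0 < t)
    (x : Coord d) : 0 ≤ greenDensity g G t x :=
  mul_nonneg (Real.sqrt_nonneg _) (hG.nonneg t ht x)

lemma continuous_greenDensity (hg : IsMetricOn g univ)
    (hG : IsGlobalGreenFunction hbar m g V x₀ G) {t : ℝ} (ht : 0 < t) :
    Continuous (greenDensity g G t) :=
  continuousOn_univ.1
    (hg.contDiffOn_sqrtDet.continuousOn.mul (hG.isGreen.contDiffOn_slice ht).continuousOn)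

/-- Grönwall's inequality for the integral of a test function against the Green's function. -/
lemma integral_le_of_generator_le (hb : 0 < hbar) (hm : 0 < m) (hg : IsMetricOn g univ)
    (hV : ContDiffOn ℝ ∞ V univ) (hG : IsGlobalGreenFunction hbar m g V x₀ G)
    {φ ψ : Coord d → ℝ} (hφ : TestOn univ φ) {κ : ℝ} (hκ : 0 ≤ κ)
    (hle : ∀ x, generator hbar m g V φ x ≤ κ * φ x + ψ x) {t B : ℝ} (ht : 0 < t) (hB : 0 ≤ B)
    (hψ : ∀ s ∈ Ioc 0 t, Integrable (fun x => ψ x * greenDensity g G s x) ∧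
      ∫ x, ψ x * greenDensity g G s x ≤ B) :
    ∫ x, φ x * greenDensity g G t x ≤ Real.exp (κ * t) * (φ x₀ + t * B) := by
  set u : ℝ → ℝ := fun s => ∫ x, φ x * greenDensity g G s x with hu
  set u' : ℝ → ℝ := fun s => ∫ x, generator hbar m g V φ x * greenDensity g G s x with hu'
  have hderiv : ∀ s, 0 < s → HasDerivAt u (u' s) s := fun s hs =>
    hG.isGreen.hasDerivAt_integral hm.ne' hb.ne' isOpen_univ hg hV hφ hs
  have hint : ∀ s, 0 < s → Integrable fun x => φ x * greenDensity g G s x := fun s hs =>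
    hG.isGreen.integrable_mul isOpen_univ hg hφ hs
  have hbound : ∀ s ∈ Ioc 0 t, u' s ≤ κ * u s + B := by
    intro s hs
    have h1 : u' s ≤ ∫ x, (κ * (φ x * greenDensity g G s x) + ψ x * greenDensity g G s x) := by
      refine integral_mono (hG.isGreen.integrable_mul isOpen_univ hg
        (hφ.generator isOpen_univ hg hV) hs.1)
        (((hint s hs.1).const_mul κ).add (hψ s hs).1) fun x => ?_
      have := mul_le_mul_of_nonneg_right (hle x) (hG.greenDensity_nonneg hs.1 x)
      simp only [greenDensity] at this ⊢
      linarith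
    rw [integral_add ((hint s hs.1).const_mul κ) (hψ s hs).1, integral_const_mul] at h1
    linarith [(hψ s hs).2]
  set v : ℝ → ℝ := fun s => Real.exp (-κ * s) * u s - B * s with hv
  have hvd : ∀ s, 0 < s →
      HasDerivAt v (Real.exp (-κ * s) * (-κ) * u s + Real.exp (-κ * s) * u' s - B) s := by
    intro s hs
    have h1 : HasDerivAt (fun s => Real.exp (-κ * s)) (Real.exp (-κ * s) * (-κ)) s := by
      simpa using ((hasDerivAt_id s).const_mul (-κ)).exp
    have h2 := (h1.mul (hderiv s hs)).sub ((hasDerivAt_id s).const_mul B)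
    rw [mul_one] at h2
    exact h2
  have hanti : AntitoneOn v (Ioc 0 t) := by
    refine antitoneOn_of_deriv_nonpos (convex_Ioc 0 t)
      (fun s hs => (hvd s hs.1).continuousAt.continuousWithinAt) ?_ ?_
    · rw [interior_Ioc]
      exact fun s hs => (hvd s hs.1).differentiableAt.differentiableWithinAt
    · rw [interior_Ioc]
      intro s hs
      rw [(hvd s hs.1).deriv]
      have h1 := hbound s ⟨hs.1, hs.2.le⟩
      have h2 := Real.exp_pos (-κ * s)
      have h3 : Real.exp (-κ * s) ≤ 1 := Real.exp_le_one_iff.2 (by nlinarith [hs.1])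
      have h4 := mul_le_mul_of_nonneg_left h1 h2.le
      have h5 := mul_le_mul_of_nonneg_right h3 hB
      linarith
  have hv0 : Tendsto v (𝓝[>] 0) (𝓝 (φ x₀)) := by
    have h1 : Tendsto (fun s : ℝ => Real.exp (-κ * s)) (𝓝[>] 0) (𝓝 1) := by
      have : Continuous fun s : ℝ => Real.exp (-κ * s) := by fun_prop
      simpa using (this.tendsto 0).mono_left nhdsWithin_le_nhds
    have h2 : Tendsto (fun s : ℝ => B * s) (𝓝[>] 0) (𝓝 0) := by
      have : Continuous fun s : ℝ => B * s := by fun_prop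
      simpa using (this.tendsto 0).mono_left nhdsWithin_le_nhds
    have h3 := (h1.mul (hG.isGreen.initial φ hφ.smooth hφ.compact hφ.subset)).sub h2
    rw [one_mul, sub_zero] at h3
    exact h3
  have hvt : v t ≤ φ x₀ := by
    refine ge_of_tendsto hv0 ?_
    filter_upwards [Ioc_mem_nhdsGT ht] with s hs
    exact hanti hs ⟨ht, le_rfl⟩ hs.2
  have h1 : Real.exp (-κ * t) * u t ≤ φ x₀ + t * B := by simp only [hv] at hvt; linarith
  have h2 := mul_le_mul_of_nonneg_left h1 (Real.exp_pos (κ * t)).le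
  rwa [← mul_assoc, ← Real.exp_add, neg_mul, add_neg_cancel, Real.exp_zero, one_mul] at h2

/-- Moments of order `P` are controlled by moments of order `ψ` if all truncations of `P` have
derivatives bounded by `ψ`. -/
lemma moment_le (hb : 0 < hbar) (hm : 0 < m) (hgb : BoundedGeometry g) (hg : IsMetricOn g univ)
    (hV : ContDiffOn ℝ ∞ V univ) (hVc : ∀ x, c ≤ V x)
    (hG : IsGlobalGreenFunction hbar m g V x₀ G) :
    ∃ D, 0 ≤ D ∧ ∀ P ζ ψ : Coord d → ℝ, (∀ x, 0 ≤ P x) →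
      (∀ R, Ctrl (fun x => P x * cutoff x₀ R x) ζ ψ) → ∀ t > 0, ∀ B, 0 ≤ B →
      (∀ s ∈ Ioc 0 t, Integrable (fun x => ψ x * greenDensity g G s x) ∧
        ∫ x, ψ x * greenDensity g G s x ≤ B) →
      Integrable (fun x => P x * greenDensity g G t x) ∧
        ∫ x, P x * greenDensity g G t x ≤ Real.exp (|c| / hbar * t) * (P x₀ + t * (D * B)) := by
  obtain ⟨D, hD, hgen⟩ := hgb.exists_generator_le hb hm hg hVc
  refine ⟨D, hD, fun P ζ ψ hP hctrl t ht B hB hψ => ?_⟩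
  have htest : ∀ R, TestOn univ fun x => P x * cutoff x₀ R x := fun R =>
    ⟨(hctrl R).smooth, (testOn_cutoff x₀ R).compact.mul_left, subset_univ _⟩
  refine integrable_and_integral_le_of_tendsto
    (F := fun R x => P x * cutoff x₀ R x * greenDensity g G t x)
    (fun R => hG.isGreen.integrable_mul isOpen_univ hg (htest R) ht)
    (fun R x => mul_nonneg (mul_nonneg (hP x) (cutoff_nonneg x₀ R x)) (hG.greenDensity_nonneg ht x))
    (fun x => ?_) fun R => ?_
  · simpa using ((tendsto_cutoff x₀ x).const_mul (P x)).mul_const (greenDensity g G t x)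
  · have := hG.integral_le_of_generator_le hb hm hg hV (htest R) (κ := |c| / hbar)
      (ψ := fun x => D * ψ x) (by positivity)
      (hgen _ _ _ (hctrl R) fun x => mul_nonneg (hP x) (cutoff_nonneg x₀ R x)) ht
      (mul_nonneg hD hB) fun s hs => by
        simp only [mul_assoc]
        rw [integral_const_mul]
        exact ⟨(hψ s hs).1.const_mul D, mul_le_mul_of_nonneg_left (hψ s hs).2 hD⟩
    simpa only [cutoff_self, mul_one] using this

/-- A global Green's function concentrates at `x₀`: its mass stays bounded, hence by `moment_le` so
do all its moments, those weighted by `|x - x₀|²` are `O(t)` and those weighted by `|x - x₀|⁴` are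
`O(t²)`. -/
theorem concentrates (hb : 0 < hbar) (hm : 0 < m) (hgb : BoundedGeometry g)
    (hg : IsMetricOn g univ) (hV : ContDiffOn ℝ ∞ V univ) (hVc : ∀ x, c ≤ V x)
    (hG : IsGlobalGreenFunction hbar m g V x₀ G) : Concentrates x₀ (greenDensity g G) := by
  have hw := weight_pos x₀
  have hw1 := one_le_weight x₀
  have hq := fun x : Coord d => sqNorm_nonneg (x - x₀)
  have hq0 : sqNorm (x₀ - x₀) = 0 := by simp [sqNorm]
  obtain ⟨T, hT, hmass⟩ : ∃ T > 0, ∀ t ∈ Ioc 0 T, ∫ x, greenDensity g G t x ≤ 2 := by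
    have h1 := hG.initial_bdd (fun _ => 1) continuous_const ⟨1, fun _ => by simp⟩
    simp only [one_mul] at h1
    obtain ⟨T, hT, h2⟩ := mem_nhdsGT_iff_exists_Ioc_subset.1 (h1.eventually_le_const one_lt_two)
    exact ⟨T, hT, fun t ht => h2 ht⟩
  obtain ⟨D, hD, hmom⟩ := hG.moment_le hb hm hgb hg hV hVc
  set E : ℝ := Real.exp (|c| / hbar * T) with hE
  have hEt : ∀ t ∈ Ioc 0 T, Real.exp (|c| / hbar * t) ≤ E := fun t ht =>
    Real.exp_le_exp.2 (mul_le_mul_of_nonneg_left ht.2 (by positivity))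
  have hscale : ∀ {ψ : Coord d → ℝ} {s A K : ℝ}, 0 ≤ A →
      (Integrable (fun x => ψ x * greenDensity g G s x) ∧
        ∫ x, ψ x * greenDensity g G s x ≤ K) →
      (Integrable (fun x => A * ψ x * greenDensity g G s x) ∧
        ∫ x, A * ψ x * greenDensity g G s x ≤ A * K) := fun hA h => by
    simp only [mul_assoc]
    rw [integral_const_mul]
    exact ⟨h.1.const_mul _, mul_le_mul_of_nonneg_left h.2 hA⟩
  have h0 : ∀ n : ℕ, ∃ C, 0 ≤ C ∧ ∀ t ∈ Ioc 0 T,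
      Integrable (fun x => weight x₀ x ^ n * greenDensity g G t x) ∧
        ∫ x, weight x₀ x ^ n * greenDensity g G t x ≤ C := by
    intro n
    induction n with
    | zero => exact ⟨2, zero_le_two, fun t ht => by
        simpa using ⟨hG.integrable t ht.1, hmass t ht⟩⟩
    | succ n ih =>
      obtain ⟨C, hC, h⟩ := ih
      obtain ⟨A, hA, hctrl⟩ := ctrl_weight_pow_mul_cutoff x₀ n
      have hx₀ := pow_nonneg (hw x₀).le (n + 1)
      refine ⟨E * (weight x₀ x₀ ^ (n + 1) + T * (D * (A * C))), by positivity, fun t ht => ?_⟩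
      have h1 := hmom _ _ _ (fun x => pow_nonneg (hw x).le (n + 1)) hctrl t ht.1 (A * C)
        (by positivity) fun s hs => hscale hA (h s ⟨hs.1, hs.2.trans ht.2⟩)
      refine ⟨h1.1, h1.2.trans ?_⟩
      have := hEt t ht
      have := ht.1.le
      have := ht.2
      gcongr
  have h1 : ∀ n : ℕ, ∃ C, 0 ≤ C ∧ ∀ t ∈ Ioc 0 T,
      Integrable (fun x => sqNorm (x - x₀) * weight x₀ x ^ (n + 1) * greenDensity g G t x) ∧
        ∫ x, sqNorm (x - x₀) * weight x₀ x ^ (n + 1) * greenDensity g G t x ≤ C * t := by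
    intro n
    obtain ⟨C, hC, h⟩ := h0 (n + 2)
    obtain ⟨A, hA, hctrl⟩ := ctrl_weight_pow_mul_cutoff x₀ n
    refine ⟨E * (D * ((2 + 5 * A) * C)), by positivity, fun t ht => ?_⟩
    have hctrl' : ∀ R, Ctrl
        (fun x => sqNorm (x - x₀) * weight x₀ x ^ (n + 1) * cutoff x₀ R x)
        (fun x => sqNorm (x - x₀) * weight x₀ x ^ (n + 1))
        fun x => (2 + 5 * A) * weight x₀ x ^ (n + 2) := fun R => by
      have := ((ctrl_sqNorm x₀).mul (hctrl R) (fun x => mul_nonneg zero_le_two (hw x).le)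
        fun x => mul_nonneg hA (pow_nonneg (hw x).le n)).mono
          (ξ₁ := fun x => (2 + 5 * A) * weight x₀ x ^ (n + 2)) fun x => by
        have e1 : weight x₀ x ^ (n + 1) ≤ weight x₀ x ^ (n + 2) :=
          pow_le_pow_right₀ (hw1 x) (by omega)
        have e2 : sqNorm (x - x₀) * weight x₀ x ^ n ≤ weight x₀ x ^ (n + 2) :=
          (mul_le_mul_of_nonneg_right (sqNorm_le_weight_sq x₀ x) (pow_nonneg (hw x).le n)).trans
            (le_of_eq (by ring))
        have e3 := mul_le_mul_of_nonneg_left e1 hA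
        have e4 := mul_le_mul_of_nonneg_left e2 hA
        rw [show 2 * weight x₀ x * weight x₀ x ^ (n + 1) + 2 * (2 * weight x₀ x
          * (A * weight x₀ x ^ n)) + sqNorm (x - x₀) * (A * weight x₀ x ^ n)
          = 2 * weight x₀ x ^ (n + 2) + 4 * (A * weight x₀ x ^ (n + 1))
            + A * (sqNorm (x - x₀) * weight x₀ x ^ n) by ring]
        linarith
      simpa only [mul_assoc] using this
    have h2 := hmom _ _ _ (fun x => mul_nonneg (hq x) (pow_nonneg (hw x).le (n + 1))) hctrl' t ht.1
      ((2 + 5 * A) * C) (by positivity) fun s hs =>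
        hscale (by positivity) (h s ⟨hs.1, hs.2.trans ht.2⟩)
    refine ⟨h2.1, h2.2.trans ?_⟩
    rw [hq0, zero_mul, zero_add]
    have := hEt t ht
    have := ht.1.le
    calc Real.exp (|c| / hbar * t) * (t * (D * ((2 + 5 * A) * C)))
        ≤ E * (t * (D * ((2 + 5 * A) * C))) := by gcongr
      _ = _ := by ring
  have h2 : ∀ n : ℕ, ∃ C, 0 ≤ C ∧ ∀ t ∈ Ioc 0 T,
      Integrable (fun x => sqNorm (x - x₀) ^ 2 * weight x₀ x ^ (n + 1) * greenDensity g G t x) ∧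
        ∫ x, sqNorm (x - x₀) ^ 2 * weight x₀ x ^ (n + 1) * greenDensity g G t x ≤ C * t ^ 2 := by
    intro n
    obtain ⟨C, hC, h⟩ := h1 (n + 1)
    obtain ⟨A, hA, hctrl⟩ := ctrl_weight_pow_mul_cutoff x₀ n
    refine ⟨E * (D * ((12 + 25 * A) * C)), by positivity, fun t ht => ?_⟩
    have hctrl' : ∀ R, Ctrl
        (fun x => sqNorm (x - x₀) ^ 2 * weight x₀ x ^ (n + 1) * cutoff x₀ R x)
        (fun x => sqNorm (x - x₀) ^ 2 * weight x₀ x ^ (n + 1))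
        fun x => (12 + 25 * A) * (sqNorm (x - x₀) * weight x₀ x ^ (n + 1 + 1)) := fun R => by
      have := ((ctrl_sqNorm_sq x₀).mul (hctrl R)
        (fun x => mul_nonneg (by norm_num) (mul_nonneg (hq x) (hw x).le))
        fun x => mul_nonneg hA (pow_nonneg (hw x).le n)).mono
          (ξ₁ := fun x => (12 + 25 * A) * (sqNorm (x - x₀) * weight x₀ x ^ (n + 1 + 1)))
          fun x => by
        have e1 : weight x₀ x ^ (n + 1) ≤ weight x₀ x ^ (n + 1 + 1) :=
          pow_le_pow_right₀ (hw1 x) (by omega)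
        have e2 : sqNorm (x - x₀) * weight x₀ x ^ n ≤ weight x₀ x ^ (n + 1 + 1) :=
          (mul_le_mul_of_nonneg_right (sqNorm_le_weight_sq x₀ x) (pow_nonneg (hw x).le n)).trans
            (le_of_eq (by ring))
        have e3 := mul_le_mul_of_nonneg_left e1 (mul_nonneg hA (hq x))
        have e4 := mul_le_mul_of_nonneg_left e2 (mul_nonneg hA (hq x))
        rw [show 12 * (sqNorm (x - x₀) * weight x₀ x) * weight x₀ x ^ (n + 1)
          + 2 * (12 * (sqNorm (x - x₀) * weight x₀ x) * (A * weight x₀ x ^ n))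
          + sqNorm (x - x₀) ^ 2 * (A * weight x₀ x ^ n)
          = 12 * (sqNorm (x - x₀) * weight x₀ x ^ (n + 1 + 1))
            + 24 * (A * sqNorm (x - x₀) * weight x₀ x ^ (n + 1))
            + A * sqNorm (x - x₀) * (sqNorm (x - x₀) * weight x₀ x ^ n) by ring]
        linarith
      simpa only [mul_assoc] using this
    -- the moments `h1` at times up to `t` are bounded by their bound at time `t`
    have h3 := hmom _ _ _ (fun x => mul_nonneg (pow_nonneg (hq x) 2) (pow_nonneg (hw x).le (n + 1)))
      hctrl' t ht.1 ((12 + 25 * A) * (C * t)) (by have := ht.1; positivity) fun s hs => by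
        have h4 := h s ⟨hs.1, hs.2.trans ht.2⟩
        exact hscale (by positivity) ⟨h4.1, h4.2.trans (mul_le_mul_of_nonneg_left hs.2 hC)⟩
    refine ⟨h3.1, h3.2.trans ?_⟩
    rw [hq0, zero_pow two_ne_zero, zero_mul, zero_add]
    have := hEt t ht
    have := ht.1.le
    calc Real.exp (|c| / hbar * t) * (t * (D * ((12 + 25 * A) * (C * t))))
        ≤ E * (t * (D * ((12 + 25 * A) * (C * t)))) := by gcongr
      _ = _ := by ring
  refine ⟨fun t ht => hG.continuous_greenDensity hg ht, fun t ht => hG.greenDensity_nonneg ht,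
    fun n => ?_⟩
  obtain ⟨C, hC, h⟩ := h2 (2 * n)
  refine ⟨C, ?_⟩
  filter_upwards [Ioc_mem_nhdsGT hT] with t ht
  have hle : ∀ x, sqNorm (x - x₀) ^ 2 * (1 + sqNorm (x - x₀)) ^ n * greenDensity g G t x
      ≤ sqNorm (x - x₀) ^ 2 * weight x₀ x ^ (2 * n + 1) * greenDensity g G t x := fun x => by
    have := hG.greenDensity_nonneg ht.1 x
    rw [← weight_sq, ← pow_mul]
    gcongr
    · exact hw1 x
    · omega
  have hcont := hG.continuous_greenDensity hg ht.1
  have hqc : Continuous fun x => sqNorm (x - x₀) := (contDiff_sqNorm_sub x₀).continuous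
  have hint : Integrable
      fun x => sqNorm (x - x₀) ^ 2 * (1 + sqNorm (x - x₀)) ^ n * greenDensity g G t x :=
    (h t ht).1.mono' (Continuous.aestronglyMeasurable (by fun_prop))
      (Eventually.of_forall fun x => by
        have h3 := hG.greenDensity_nonneg ht.1 x
        have h4 := hq x
        rw [Real.norm_of_nonneg (by positivity)]
        exact hle x)
  exact ⟨hint, (integral_mono hint (h t ht).1 hle).trans (h t ht).2⟩

end IsGlobalGreenFunction

end CurvedQM

theorem mainTheorem6 {d : ℕ} {hbar m : ℝ} (hhbar : 0 < hbar) (hm : 0 < m)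
    {U : Set (CurvedQM.Coord d)} (hU : IsOpen U)
    {g : CurvedQM.Coord d → Matrix (Fin d) (Fin d) ℝ} (hg : CurvedQM.IsMetricOn g U)
    {V : CurvedQM.Coord d → ℝ} (hV : ContDiffOn ℝ ∞ V U)
    {x₀ : CurvedQM.Coord d} (hx₀ : x₀ ∈ U) (hstar : StarConvex ℝ x₀ U) :
    -- the contraction identity, and the two forms of the Gaussian action
    (∀ x ∈ U, ∀ i, CurvedQM.contractedChristoffel g i x = -CurvedQM.divInv g i x) ∧
    (∀ t > 0, ∀ x, CurvedQM.gaussAction hbar m g V x₀ t x =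
      CurvedQM.gaussActionChristoffel hbar m g V x₀ t x) ∧
    (∀ t > 0, ∀ x, CurvedQM.alphaAction 0 hbar m g V x₀ t x =
      CurvedQM.gaussAction hbar m g V x₀ t x) ∧
    -- arbitrary chart: moments localized by a smooth cutoff supported in the chart
    (∀ χ : CurvedQM.Coord d → ℝ, ContDiff ℝ ∞ χ → HasCompactSupport χ → tsupport χ ⊆ U →
      (∀ G, CurvedQM.IsGreenFunction hbar m g V U x₀ G →
        CurvedQM.MomentsAgree χ x₀ (CurvedQM.greenDensity g G)
          (CurvedQM.gaussDensity hbar m g V x₀)) ∧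
      ∀ α ∈ Icc (0 : ℝ) 1,
        CurvedQM.MomentsAgree χ x₀ (CurvedQM.alphaDensity α hbar m g V x₀)
          (CurvedQM.gaussDensity hbar m g V x₀) ∧
        ∀ G, CurvedQM.IsGreenFunction hbar m g V U x₀ G →
          CurvedQM.MomentsAgree χ x₀ (CurvedQM.greenDensity g G)
            (CurvedQM.alphaDensity α hbar m g V x₀)) ∧
    -- coordinates covering the whole of `ℝ^d`, with control at infinity: the full moments
    (U = univ → CurvedQM.BoundedGeometry g → (∃ c, ∀ x, c ≤ V x) →
      (∀ G, CurvedQM.IsGlobalGreenFunction hbar m g V x₀ G →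
        CurvedQM.MomentsAgree (fun _ => 1) x₀ (CurvedQM.greenDensity g G)
          (CurvedQM.gaussDensity hbar m g V x₀)) ∧
      ∀ α ∈ Icc (0 : ℝ) 1,
        CurvedQM.MomentsAgree (fun _ => 1) x₀ (CurvedQM.alphaDensity α hbar m g V x₀)
          (CurvedQM.gaussDensity hbar m g V x₀) ∧
        ∀ G, CurvedQM.IsGlobalGreenFunction hbar m g V x₀ G →
          CurvedQM.MomentsAgree (fun _ => 1) x₀ (CurvedQM.greenDensity g G)
            (CurvedQM.alphaDensity α hbar m g V x₀)) := by
  have h0 : (0 : ℝ) ∈ Icc (0 : ℝ) 1 := ⟨le_rfl, zero_le_one⟩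
  refine ⟨fun x hx i => hg.contractedChristoffel_eq hU hx i,
    fun t _ x => CurvedQM.gaussAction_eq hU hg hx₀ t x,
    fun t _ x => CurvedQM.alphaAction_zero t x, fun χ hχ hχc hχU => ?_, ?_⟩
  · rw [CurvedQM.gaussDensity_eq hU hg hx₀]
    have hα : ∀ α ∈ Icc (0 : ℝ) 1, CurvedQM.HasShortTimeExpansion hbar m g V U x₀
        (CurvedQM.alphaDensity α hbar m g V x₀) := fun α hα =>
      CurvedQM.hasShortTimeExpansion_alphaDensity hhbar hm hU hg hV hx₀ hstar hα
    have hαc : ∀ α ∈ Icc (0 : ℝ) 1, ∀ t > 0,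
        ContinuousOn (CurvedQM.alphaDensity α hbar m g V x₀ t) U := fun α hα t _ =>
      CurvedQM.continuousOn_alphaDensity hU hg hV hstar hα t
    have hgreen : ∀ G, CurvedQM.IsGreenFunction hbar m g V U x₀ G → ∀ α ∈ Icc (0 : ℝ) 1,
        CurvedQM.MomentsAgree χ x₀ (CurvedQM.greenDensity g G)
          (CurvedQM.alphaDensity α hbar m g V x₀) := fun G hG α hα' =>
      (hG.hasShortTimeExpansion hm.ne' hhbar.ne' hU hg hV).momentsAgree hU (hα α hα')
        (fun t ht => hg.contDiffOn_sqrtDet.continuousOn.mul (hG.contDiffOn_slice ht).continuousOn)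
        (hαc α hα') ⟨hχ, hχc, hχU⟩
    exact ⟨fun G hG => hgreen G hG 0 h0, fun α hα' =>
      ⟨(hα α hα').momentsAgree hU (hα 0 h0) (hαc α hα') (hαc 0 h0) ⟨hχ, hχc, hχU⟩,
        fun G hG => hgreen G hG α hα'⟩⟩
  · rintro rfl hgb hVb
    rw [CurvedQM.gaussDensity_eq hU hg hx₀]
    have hα : ∀ α ∈ Icc (0 : ℝ) 1, CurvedQM.HasShortTimeExpansion hbar m g V univ x₀
        (CurvedQM.alphaDensity α hbar m g V x₀) := fun α hα =>
      CurvedQM.hasShortTimeExpansion_alphaDensity hhbar hm hU hg hV hx₀ hstar hα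
    have hαc : ∀ α ∈ Icc (0 : ℝ) 1,
        CurvedQM.Concentrates x₀ (CurvedQM.alphaDensity α hbar m g V x₀) := fun α hα =>
      hgb.concentrates_alphaDensity hhbar hm hg hV hVb hα x₀
    obtain ⟨c, hc⟩ := hVb
    have hgreen : ∀ G, CurvedQM.IsGlobalGreenFunction hbar m g V x₀ G → ∀ α ∈ Icc (0 : ℝ) 1,
        CurvedQM.MomentsAgree (fun _ => 1) x₀ (CurvedQM.greenDensity g G)
          (CurvedQM.alphaDensity α hbar m g V x₀) := fun G hG α hα' =>
      (hG.isGreen.hasShortTimeExpansion hm.ne' hhbar.ne' hU hg hV).momentsAgree_one (hα α hα')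
        (hG.concentrates hhbar hm hgb hg hV hc) (hαc α hα')
    exact ⟨fun G hG => hgreen G hG 0 h0, fun α hα' =>
      ⟨(hα α hα').momentsAgree_one (hα 0 h0) (hαc α hα') (hαc 0 h0),
        fun G hG => hgreen G hG α hα'⟩⟩
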